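/- Consider, for real-valued functions $u,v$ of $(x,t)\in\mathbb{R}\times[0,T)$, the Klein–Gordon–Boussinesq system $$u_{tt}=\alpha^2u_{xx}+u_{ttxx}+(f_1(u,v))_{xx},\qquad v_{tt}=v_{xx}-v+f_2(u,v),$$ $$(u,u_t,v,v_t)|_{t=0}=(u_0,u_1,v_0,v_1),$$ $$f_1(u,v)=a_{uu}u^2+2a_{uv}uv+a_{vv}v^2,\qquad f_2(u,v)=b_{uu}u^2+2b_{uv}uv+b_{vv}v^2,$$ with real coefficients, $\alpha\ne0$, the $a$'s and $b$'s not all zero, and assume $$b_{uu}=-a_{uv}=:B,\qquad b_{uv}=-a_{vv}=:C.$$ Let $1/2<r\le s\le r+1$, $u_0\in H^r$, $u_1\in H^r\cap\dot H^{r-1}$, $v_0\in H^s$, $v_1\in H^{s-1}$ (spaces over $\mathbb{R}$). Suppose in addition that $\partial_x^{-1}u_0\in L^2$ and that the energy is defined for the data, that is $\partial_x^{-1}u_1\in L^2$, $v_0\in H^1$ and $v_1\in L^2$ (the last two are automatic if $s\ge1$). Here $\partial_x^{-1}g\in L^2$ denotes the unique $L^2$ function whose weak derivative is $g$, if there is one.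 Set $$E(0)=\frac12\int_{\mathbb{R}}\left(u_1^2+\alpha^2u_0^2+(\partial_x^{-1}u_1)^2+v_0^2+(\partial_xv_0)^2+v_1^2\right)dx-\int_{\mathbb{R}}\mathfrak F(u_0,v_0)\,dx,$$ $$\mathfrak F(u,v)=-\frac{a_{uu}}3u^3+\frac{b_{vv}}3v^3+Bu^2v+Cuv^2 .$$ Assume that either (i) $E(0)<0$, or (ii) $E(0)\ge0$, $(u_0,v_0)\neq(0,0)$, and $$(2E(0))^{1/2}<\frac{\langle\partial_x^{-1}u_0,\partial_x^{-1}u_1\rangle_{L^2}+\langle u_0,u_1\rangle_{L^2}+\langle v_0,v_1\rangle_{L^2}}{\sqrt{\|\partial_x^{-1}u_0\|_{L^2}^2+\|u_0\|_{L^2}^2+\|v_0\|_{L^2}^2}} .$$ Then the local solution blows up in finite time: there are $0<T<\infty$ and a solution $(u,v)$ on $[0,T)$ (the equations being understood in the sense of tempered distributions in $x$) with $(u,u_t)\in C([0,T);H^r\times(H^r\cap\dot H^{r-1}))$ and $(v,v_t)\in C([0,T);H^s\times H^{s-1})$, such that every solution in this class on some $[0,T')$ with the same data satisfies $T'\le T$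 and coincides with $(u,v)$ on $[0,T')$, and $$\|u(t)\|_{H^r}+\|u_t(t)\|_{H^r\cap\dot H^{r-1}}+\|v(t)\|_{H^s}+\|v_t(t)\|_{H^{s-1}}\to\infty\quad\text{as }t\to T^- .$$ -/

import Mathlib

open MeasureTheory Set Filter Topology FourierTransform
open scoped ENNReal SchwartzMap

noncomputable section

namespace KGB

/-- The real Lebesgue space `L²(ℝ)`. -/
abbrev L2 : Type := Lp ℝ 2 (volume : Measure ℝ)

/-- A real `L^p` function, regarded as a complex-valued one. -/
def toComplex {p : ℝ≥0∞} (f : Lp ℝ p (volume : Measure ℝ)) : Lp ℂ p (volume : Measure ℝ) :=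
  Complex.ofRealCLM.compLp f

/-- The tempered distribution `φ ↦ ∫ f φ` of a real `L^p` function `f`. -/
def toDist {p : ℝ≥0∞} [Fact (1 ≤ p)] (f : Lp ℝ p (volume : Measure ℝ)) : 𝓢'(ℝ, ℂ) :=
  Lp.toTemperedDistribution (toComplex f)

/-- The distributional derivative `∂ₓ`. -/
def dx (f : 𝓢'(ℝ, ℂ)) : 𝓢'(ℝ, ℂ) := TemperedDistribution.derivCLM ℂ f

/-- `g ∈ L²` is the weak derivative of `f ∈ L²`. Equivalently `f = ∂ₓ⁻¹ g`; such an `f ∈ L²` is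
unique, because `0` is the only constant function in `L²(ℝ)`. -/
def IsWeakDeriv (f g : L2) : Prop := dx (toDist f) = toDist g

/-- The norm of `H^σ(ℝ)`, with value `∞` outside `H^σ(ℝ)`: the `L²` norm of the Bessel potential
of order `σ`. -/
def sobolevNorm (σ : ℝ) (f : 𝓢'(ℝ, ℂ)) : ℝ≥0∞ :=
  ⨅ (g : Lp ℂ 2 (volume : Measure ℝ))
    (_ : TemperedDistribution.besselPotential ℝ ℂ σ f = Lp.toTemperedDistribution g), ‖g‖ₑ

/-- The norm of the homogeneous space `Ḣ^σ(ℝ)` for functions in `L²(ℝ)`, with value `∞` outside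
`Ḣ^σ(ℝ)`. -/
def homSobolevNorm (σ : ℝ) (f : L2) : ℝ≥0∞ :=
  (∫⁻ ξ : ℝ, ENNReal.ofReal ((2 * Real.pi * |ξ|) ^ (2 * σ)) *
    ‖(𝓕 (toComplex f) : Lp ℂ 2 (volume : Measure ℝ)) ξ‖ₑ ^ 2) ^ (1 / 2 : ℝ)

/-- `f ∈ C(I; H^σ(ℝ))`. -/
def SobolevContinuousOn (σ : ℝ) (I : Set ℝ) (f : ℝ → 𝓢'(ℝ, ℂ)) : Prop :=
  (∀ t ∈ I, TemperedDistribution.MemSobolev σ 2 (f t)) ∧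
    ∀ t₀ ∈ I, Tendsto (fun t => sobolevNorm σ (f t - f t₀)) (𝓝[I] t₀) (𝓝 0)

/-- `f ∈ C(I; Ḣ^σ(ℝ))`, for `f` with values in `L²(ℝ)`. -/
def HomSobolevContinuousOn (σ : ℝ) (I : Set ℝ) (f : ℝ → L2) : Prop :=
  (∀ t ∈ I, homSobolevNorm σ (f t) < ∞) ∧
    ∀ t₀ ∈ I, Tendsto (fun t => homSobolevNorm σ (f t - f t₀)) (𝓝[I] t₀) (𝓝 0)

/-- `g` is the derivative at time `t` of the curve `f` of distributions on the time set `I`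
(one-sided at an endpoint of `I`). -/
def HasTimeDeriv (I : Set ℝ) (f : ℝ → 𝓢'(ℝ, ℂ)) (g : 𝓢'(ℝ, ℂ)) (t : ℝ) : Prop :=
  ∀ φ : 𝓢(ℝ, ℂ), HasDerivWithinAt (fun τ => f τ φ) (g φ) I t

/-- The coefficients of the Klein-Gordon-Boussinesq system. -/
structure Coeffs where
  α : ℝ
  auu : ℝ
  auv : ℝ
  avv : ℝ
  buu : ℝ
  buv : ℝ
  bvv : ℝ

/-- The standing assumption on the coefficients: `α ≠ 0`, and the coefficients of the
nonlinearities are not all zero. -/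
def Coeffs.Admissible (c : Coeffs) : Prop :=
  c.α ≠ 0 ∧ ¬ (c.auu = 0 ∧ c.auv = 0 ∧ c.avv = 0 ∧ c.buu = 0 ∧ c.buv = 0 ∧ c.bvv = 0)

/-- The Hamiltonian condition `b_uu = -a_uv`, `b_uv = -a_vv`. -/
def Coeffs.Hamiltonian (c : Coeffs) : Prop :=
  c.buu = -c.auv ∧ c.buv = -c.avv

/-- The pointwise product of two `L²` functions, as an element of `L¹`. -/
def mul (f g : L2) : Lp ℝ 1 (volume : Measure ℝ) := f • g

/-- `f₁(u,v) = a_uu u² + 2 a_uv u v + a_vv v²`. -/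
def f₁ (c : Coeffs) (u v : L2) : Lp ℝ 1 (volume : Measure ℝ) :=
  c.auu • mul u u + (2 * c.auv) • mul u v + c.avv • mul v v

/-- `f₂(u,v) = b_uu u² + 2 b_uv u v + b_vv v²`. -/
def f₂ (c : Coeffs) (u v : L2) : Lp ℝ 1 (volume : Measure ℝ) :=
  c.buu • mul u u + (2 * c.buv) • mul u v + c.bvv • mul v v

/-- The functions `(u, v)`, with time derivatives `(ut, vt)`, solve the Klein-Gordon-Boussinesq
system

  `u_tt = α² u_xx + u_ttxx + (f₁(u,v))_xx`,  `v_tt = v_xx - v + f₂(u,v)`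

on `ℝ × [0,T)` with initial data `(u₀, u₁, v₀, v₁)`, and
`(u, ut) ∈ C([0,T); H^r × (H^r ∩ Ḣ^(r-1)))`, `(v, vt) ∈ C([0,T); H^s × H^(s-1))`. -/
structure IsSolution (c : Coeffs) (r s T : ℝ) (u₀ u₁ v₀ v₁ : L2)
    (u ut v : ℝ → L2) (vt : ℝ → 𝓢'(ℝ, ℂ)) : Prop where
  u_mem : SobolevContinuousOn r (Ico 0 T) (fun t => toDist (u t))
  ut_mem : SobolevContinuousOn r (Ico 0 T) (fun t => toDist (ut t))
  ut_mem_hom : HomSobolevContinuousOn (r - 1) (Ico 0 T) ut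
  v_mem : SobolevContinuousOn s (Ico 0 T) (fun t => toDist (v t))
  vt_mem : SobolevContinuousOn (s - 1) (Ico 0 T) vt
  deriv_u : ∀ t ∈ Ico 0 T, HasTimeDeriv (Ico 0 T) (fun τ => toDist (u τ)) (toDist (ut t)) t
  deriv_v : ∀ t ∈ Ico 0 T, HasTimeDeriv (Ico 0 T) (fun τ => toDist (v τ)) (vt t) t
  eq_u : ∀ t ∈ Ico 0 T, ∃ utt : 𝓢'(ℝ, ℂ),
    HasTimeDeriv (Ico 0 T) (fun τ => toDist (ut τ)) utt t ∧
      utt = (c.α ^ 2 : ℝ) • dx (dx (toDist (u t))) + dx (dx utt)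
        + dx (dx (toDist (f₁ c (u t) (v t))))
  eq_v : ∀ t ∈ Ico 0 T, HasTimeDeriv (Ico 0 T) vt
    (dx (dx (toDist (v t))) - toDist (v t) + toDist (f₂ c (u t) (v t))) t
  init_u : u 0 = u₀
  init_ut : ut 0 = u₁
  init_v : v 0 = v₀
  init_vt : vt 0 = toDist v₁

/-- The norm of `(u, ut, v, vt)` in `(H^r × (H^r ∩ Ḣ^(r-1))) × (H^s × H^(s-1))`. -/
def solNorm (r s : ℝ) (u ut v : L2) (vt : 𝓢'(ℝ, ℂ)) : ℝ≥0∞ :=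
  sobolevNorm r (toDist u) + (sobolevNorm r (toDist ut) + homSobolevNorm (r - 1) ut)
    + (sobolevNorm s (toDist v) + sobolevNorm (s - 1) vt)

/-- The local solution with initial data `(u₀, u₁, v₀, v₁)` blows up in finite time: there are a
finite `T > 0` and a solution on `[0,T)` that agrees with every other solution with the same data
(none of which lives longer), and whose norm tends to infinity at time `T`. -/
def BlowsUpInFiniteTime (c : Coeffs) (r s : ℝ) (u₀ u₁ v₀ v₁ : L2) : Prop :=
  ∃ (T : ℝ) (u ut v : ℝ → L2) (vt : ℝ → 𝓢'(ℝ, ℂ)),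
    0 < T ∧ IsSolution c r s T u₀ u₁ v₀ v₁ u ut v vt ∧
    (∀ (T' : ℝ) (u' ut' v' : ℝ → L2) (vt' : ℝ → 𝓢'(ℝ, ℂ)), 0 < T' →
      IsSolution c r s T' u₀ u₁ v₀ v₁ u' ut' v' vt' →
        T' ≤ T ∧ ∀ t ∈ Ico 0 T', u' t = u t ∧ v' t = v t) ∧
    Tendsto (fun t => solNorm r s (u t) (ut t) (v t) (vt t)) (𝓝[<] T) (𝓝 ∞)

/-- `𝔉(u,v) = -(a_uu/3) u³ + (b_vv/3) v³ + B u² v + C u v²` with `B = b_uu`, `C = b_uv`. -/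
def potential (c : Coeffs) (u v : ℝ) : ℝ :=
  -(c.auu / 3) * u ^ 3 + c.bvv / 3 * v ^ 3 + c.buu * u ^ 2 * v + c.buv * u * v ^ 2

/-- The energy, where `wt` stands for `∂ₓ⁻¹ u_t` and `vx` for the weak derivative of `v`. -/
def energy (c : Coeffs) (u ut wt v vx vt : L2) : ℝ :=
  1 / 2 * (‖ut‖ ^ 2 + c.α ^ 2 * ‖u‖ ^ 2 + ‖wt‖ ^ 2 + ‖v‖ ^ 2 + ‖vx‖ ^ 2 + ‖vt‖ ^ 2)
    - ∫ x, potential c (u x) (v x)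

end KGB

end

noncomputable section

open scoped BoundedContinuousFunction ComplexConjugate Convolution NNReal

namespace KGB

/-- The complex Lebesgue space `L²(ℝ)`. -/
abbrev L2C : Type := Lp ℂ 2 (volume : Measure ℝ)

/-- Bounded continuous symbols of Fourier multipliers. -/
abbrev Sym : Type := ℝ →ᵇ ℂ

lemma Sym.memLp_top (a : Sym) : MemLp (a : ℝ → ℂ) ∞ (volume : Measure ℝ) :=
  BoundedContinuousFunction.memLp_top a

/-- Pointwise multiplication by a bounded continuous function on `L²`. -/
def mulSym (a : Sym) : L2C →L[ℂ] L2C :=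
  LinearMap.mkContinuous
    { toFun := fun f => (a.memLp_top.toLp (a : ℝ → ℂ) : Lp ℂ ∞ (volume : Measure ℝ)) • f
      map_add' := fun f g => Lp.add_smul _ f g
      map_smul' := fun c f => (Lp.smul_comm c _ f).symm } ‖a‖ (by
    intro f
    refine (Lp.norm_smul_le _ f).trans ?_
    gcongr
    rw [Lp.norm_toLp]
    refine ENNReal.toReal_le_of_le_ofReal (norm_nonneg a) ?_
    refine eLpNormEssSup_le_of_ae_bound (Eventually.of_forall fun x => ?_)
    exact a.norm_coe_le_norm x)

lemma coeFn_mulSym (a : Sym) (f : L2C) : mulSym a f =ᵐ[volume] fun ξ => a ξ * f ξ := by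
  have h1 := Lp.coeFn_lpSMul (r := 2) (a.memLp_top.toLp (a : ℝ → ℂ)) f
  filter_upwards [h1, a.memLp_top.coeFn_toLp] with ξ h2 h3
  refine h2.trans ?_
  simp [h3]

lemma norm_mulSym_le_of_bound (a : Sym) {C : ℝ} (h : ∀ ξ, ‖a ξ‖ ≤ C) (f : L2C) :
    ‖mulSym a f‖ ≤ C * ‖f‖ := by
  refine Lp.norm_le_mul_norm_of_ae_le_mul ?_
  filter_upwards [coeFn_mulSym a f] with ξ hξ
  rw [hξ, norm_mul]
  gcongr
  exact h ξ

lemma mulSym_mul (a b : Sym) (f : L2C) : mulSym (a * b) f = mulSym a (mulSym b f) := by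
  apply Lp.ext
  filter_upwards [coeFn_mulSym (a * b) f, coeFn_mulSym a (mulSym b f), coeFn_mulSym b f]
    with ξ h1 h2 h3
  simp [h1, h2, h3, mul_assoc]

lemma mulSym_add (a b : Sym) (f : L2C) : mulSym (a + b) f = mulSym a f + mulSym b f := by
  apply Lp.ext
  filter_upwards [coeFn_mulSym (a + b) f, coeFn_mulSym a f, coeFn_mulSym b f,
    Lp.coeFn_add (mulSym a f) (mulSym b f)] with ξ h1 h2 h3 h4
  rw [h1, h4]
  simp only [Pi.add_apply, h2, h3]
  simp [add_mul]

lemma mulSym_smul (c : ℂ) (a : Sym) (f : L2C) : mulSym (c • a) f = c • mulSym a f := by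
  apply Lp.ext
  filter_upwards [coeFn_mulSym (c • a) f, coeFn_mulSym a f, Lp.coeFn_smul c (mulSym a f)]
    with ξ h1 h2 h4
  simp [h1, h2, h4, mul_assoc]

lemma mulSym_one (f : L2C) : mulSym 1 f = f := by
  apply Lp.ext
  filter_upwards [coeFn_mulSym 1 f] with ξ h1
  simp [h1]

/-- The Fourier multiplier on `L²` with a bounded continuous symbol. -/
def fmul (a : Sym) : L2C →L[ℂ] L2C :=
  ((Lp.fourierTransformₗᵢ ℝ ℂ).symm.toContinuousLinearEquiv : L2C →L[ℂ] L2C) ∘L mulSym a ∘L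
    ((Lp.fourierTransformₗᵢ ℝ ℂ).toContinuousLinearEquiv : L2C →L[ℂ] L2C)

lemma fmul_apply (a : Sym) (f : L2C) : fmul a f = 𝓕⁻ (mulSym a (𝓕 f : L2C)) := rfl

lemma fourier_fmul (a : Sym) (f : L2C) : (𝓕 (fmul a f) : L2C) = mulSym a (𝓕 f : L2C) := by
  rw [fmul_apply, fourier_fourierInv_eq]

lemma norm_fourierInv_L2 (f : L2C) : ‖(𝓕⁻ f : L2C)‖ = ‖f‖ :=
  (Lp.fourierTransformₗᵢ ℝ ℂ).symm.norm_map f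

lemma norm_fmul (a : Sym) (f : L2C) : ‖fmul a f‖ = ‖mulSym a (𝓕 f : L2C)‖ := by
  rw [fmul_apply, norm_fourierInv_L2]

lemma fmul_mul (a b : Sym) (f : L2C) : fmul (a * b) f = fmul a (fmul b f) := by
  rw [fmul_apply, mulSym_mul, ← fourier_fmul b, ← fmul_apply]

lemma fmul_comm (a b : Sym) (f : L2C) : fmul a (fmul b f) = fmul b (fmul a f) := by
  rw [← fmul_mul, ← fmul_mul, mul_comm]

lemma fmul_add (a b : Sym) (f : L2C) : fmul (a + b) f = fmul a f + fmul b f := by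
  rw [fmul_apply, mulSym_add, fourierInv_add]; rfl

lemma fmul_smul (c : ℂ) (a : Sym) (f : L2C) : fmul (c • a) f = c • fmul a f := by
  rw [fmul_apply, mulSym_smul, fourierInv_smul]; rfl

lemma fmul_sub (a b : Sym) (f : L2C) : fmul (a - b) f = fmul a f - fmul b f := by
  have : a - b = a + (-1 : ℂ) • b := by ext; simp [sub_eq_add_neg]
  rw [this, fmul_add, fmul_smul]; simp [sub_eq_add_neg]

lemma fmul_one (f : L2C) : fmul 1 f = f := by
  rw [fmul_apply, mulSym_one, fourierInv_fourier_eq]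

lemma norm_fmul_le_of_bound (a : Sym) {C : ℝ} (h : ∀ ξ, ‖a ξ‖ ≤ C) (f : L2C) :
    ‖fmul a f‖ ≤ C * ‖f‖ := by
  rw [norm_fmul]
  refine (norm_mulSym_le_of_bound a h _).trans_eq ?_
  rw [Lp.norm_fourier_eq]

lemma norm_fmul_of_norm_eq_one (a : Sym) (h : ∀ ξ, ‖a ξ‖ = 1) (f : L2C) : ‖fmul a f‖ = ‖f‖ := by
  rw [norm_fmul, ← Lp.norm_fourier_eq f]
  apply le_antisymm
  · simpa using norm_mulSym_le_of_bound a (fun ξ => (h ξ).le) (𝓕 f : L2C)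
  · refine Lp.norm_le_norm_of_ae_le ?_
    filter_upwards [coeFn_mulSym a (𝓕 f : L2C)] with ξ hξ
    rw [hξ, norm_mul, h ξ, one_mul]

lemma fmul_injective (a : Sym) (h : ∀ ξ, a ξ ≠ 0) : Function.Injective (fmul a) := by
  refine (injective_iff_map_eq_zero _).2 fun f hf => ?_
  have h1 : mulSym a (𝓕 f : L2C) = 0 := by
    rw [← fourier_fmul, hf]; exact (Lp.fourierTransformₗᵢ ℝ ℂ).map_zero
  have h2 : (𝓕 f : L2C) = 0 := by
    apply Lp.ext
    have h3 := coeFn_mulSym a (𝓕 f : L2C)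
    rw [h1] at h3
    filter_upwards [h3, Lp.coeFn_zero ℂ 2 (volume : Measure ℝ)] with ξ h4 h5
    rw [h5] at h4 ⊢
    simpa [h ξ] using h4.symm
  exact (Lp.fourierTransformₗᵢ ℝ ℂ).map_eq_zero_iff.1 h2

lemma tendsto_mulSym {ι : Type*} {l : Filter ι} [l.IsCountablyGenerated] (a : ι → Sym) (b : Sym)
    {C : ℝ} (hC : ∀ i ξ, ‖a i ξ‖ ≤ C) (hb : ∀ ξ, ‖b ξ‖ ≤ C)
    (h : ∀ ξ, Tendsto (fun i => a i ξ) l (𝓝 (b ξ))) (f : L2C) :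
    Tendsto (fun i => mulSym (a i) f) l (𝓝 (mulSym b f)) := by
  rw [Lp.tendsto_Lp_iff_tendsto_eLpNorm' (fun i => mulSym (a i) f) (mulSym b f)]
  have hC0 : 0 ≤ C := (norm_nonneg _).trans (hb 0)
  have key : Tendsto (fun i => ∫⁻ ξ, ‖(a i ξ - b ξ) * f ξ‖ₑ ^ (2 : ℝ)) l
      (𝓝 (∫⁻ _ξ : ℝ, 0)) := by
    refine tendsto_lintegral_filter_of_dominated_convergence
      (fun ξ => (ENNReal.ofReal (2 * C) * ‖f ξ‖ₑ) ^ (2 : ℝ)) ?_ ?_ ?_ ?_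
    · refine Eventually.of_forall fun i => ?_
      exact (((a i).continuous.sub b.continuous).measurable.mul
        (Lp.stronglyMeasurable f).measurable).enorm.pow_const _
    · refine Eventually.of_forall fun i => Eventually.of_forall fun ξ => ?_
      gcongr
      rw [enorm_mul]
      gcongr
      rw [← ofReal_norm]
      apply ENNReal.ofReal_le_ofReal
      refine (norm_sub_le _ _).trans ?_
      linarith [hC i ξ, hb ξ]
    · simp_rw [ENNReal.mul_rpow_of_nonneg _ _ (by norm_num : (0 : ℝ) ≤ 2)]
      rw [lintegral_const_mul' _ _ (by finiteness)]
      refine ENNReal.mul_ne_top (by finiteness) ?_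
      have := (Lp.memLp f).eLpNorm_lt_top
      rw [eLpNorm_lt_top_iff_lintegral_rpow_enorm_lt_top (by norm_num) (by norm_num)] at this
      simpa using this.ne
    · refine Eventually.of_forall fun ξ => ?_
      have h1 : Tendsto (fun i => (a i ξ - b ξ) * f ξ) l (𝓝 0) := by
        have := ((h ξ).sub_const (b ξ)).mul_const (f ξ)
        simpa using this
      have h2 := (ENNReal.continuous_rpow_const (y := (2 : ℝ))).tendsto _ |>.comp h1.enorm
      simpa [Function.comp_def] using h2
  simp only [lintegral_zero] at key
  have h2 := (ENNReal.continuous_rpow_const (y := (1 / 2 : ℝ))).tendsto _ |>.comp key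
  rw [ENNReal.zero_rpow_of_pos (by norm_num)] at h2
  refine h2.congr fun i => ?_
  rw [eLpNorm_eq_lintegral_rpow_enorm_toReal (by norm_num) (by norm_num)]
  simp only [Function.comp, ENNReal.toReal_ofNat]
  congr 1
  apply lintegral_congr_ae
  filter_upwards [coeFn_mulSym (a i) f, coeFn_mulSym b f] with ξ h1 h2
  simp [h1, h2, sub_mul]

lemma tendsto_fmul {ι : Type*} {l : Filter ι} [l.IsCountablyGenerated] (a : ι → Sym) (b : Sym)
    {C : ℝ} (hC : ∀ i ξ, ‖a i ξ‖ ≤ C) (hb : ∀ ξ, ‖b ξ‖ ≤ C)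
    (h : ∀ ξ, Tendsto (fun i => a i ξ) l (𝓝 (b ξ))) (f : L2C) :
    Tendsto (fun i => fmul (a i) f) l (𝓝 (fmul b f)) :=
  ((Lp.fourierTransformₗᵢ ℝ ℂ).symm.continuous.tendsto _).comp
    (tendsto_mulSym a b hC hb h (𝓕 f : L2C))

/-- The inclusion of real `L²` into complex `L²`. -/
def toC : L2 →L[ℝ] L2C := Complex.ofRealCLM.compLpL 2 volume

/-- The real part. -/
def reL : L2C →L[ℝ] L2 := Complex.reCLM.compLpL 2 volume

/-- The imaginary part. -/
def imL : L2C →L[ℝ] L2 := Complex.imCLM.compLpL 2 volume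

/-- Complex conjugation on `L²`. -/
def conjL : L2C →L[ℝ] L2C := (Complex.conjCLE : ℂ →L[ℝ] ℂ).compLpL 2 volume

/-- The reflection `f ↦ f(-·)` on `L²`. -/
def reflL : L2C →ₗᵢ[ℝ] L2C :=
  Lp.compMeasurePreservingₗᵢ ℝ (fun x : ℝ => -x) (Measure.measurePreserving_neg volume)

lemma toComplex_eq (f : L2) : toComplex f = toC f := rfl

lemma coeFn_toC (f : L2) : toC f =ᵐ[volume] fun x => (f x : ℂ) :=
  ContinuousLinearMap.coeFn_compLpL _ f

lemma coeFn_reL (f : L2C) : reL f =ᵐ[volume] fun x => (f x).re :=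
  ContinuousLinearMap.coeFn_compLpL _ f

lemma coeFn_imL (f : L2C) : imL f =ᵐ[volume] fun x => (f x).im :=
  ContinuousLinearMap.coeFn_compLpL _ f

lemma coeFn_conjL (f : L2C) : conjL f =ᵐ[volume] fun x => conj (f x) :=
  ContinuousLinearMap.coeFn_compLpL _ f

lemma coeFn_reflL (f : L2C) : reflL f =ᵐ[volume] fun x => f (-x) :=
  Lp.coeFn_compMeasurePreserving f (Measure.measurePreserving_neg volume)

lemma reL_toC (f : L2) : reL (toC f) = f := by
  apply Lp.ext
  filter_upwards [coeFn_reL (toC f), coeFn_toC f] with x h1 h2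
  rw [h1, h2, Complex.ofReal_re]

lemma imL_toC (f : L2) : imL (toC f) = 0 := by
  apply Lp.ext
  filter_upwards [coeFn_imL (toC f), coeFn_toC f, Lp.coeFn_zero ℝ 2 (volume : Measure ℝ)]
    with x h1 h2 h3
  rw [h1, h2, h3, Complex.ofReal_im, Pi.zero_apply]

lemma toC_injective : Function.Injective toC := fun f g h => by
  rw [← reL_toC f, h, reL_toC]

lemma norm_toC (f : L2) : ‖toC f‖ = ‖f‖ := by
  apply le_antisymm
  · refine Lp.norm_le_norm_of_ae_le ?_
    filter_upwards [coeFn_toC f] with x h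
    simp [h]
  · refine Lp.norm_le_norm_of_ae_le ?_
    filter_upwards [coeFn_toC f] with x h
    simp [h]

lemma toC_re_add_im (f : L2C) : toC (reL f) + Complex.I • toC (imL f) = f := by
  apply Lp.ext
  filter_upwards [Lp.coeFn_add (toC (reL f)) (Complex.I • toC (imL f)),
    Lp.coeFn_smul Complex.I (toC (imL f)), coeFn_toC (reL f), coeFn_toC (imL f), coeFn_reL f,
    coeFn_imL f] with x h1 h2 h3 h4 h5 h6
  rw [h1, Pi.add_apply, h2, Pi.smul_apply, h3, h4, h5, h6, smul_eq_mul, mul_comm,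
    Complex.re_add_im]

lemma reL_I_smul (f : L2C) : reL (Complex.I • f) = - imL f := by
  apply Lp.ext
  filter_upwards [coeFn_reL (Complex.I • f), Lp.coeFn_smul Complex.I f, coeFn_imL f,
    Lp.coeFn_neg (imL f)] with x h1 h2 h3 h4
  rw [h1, h2, h4, Pi.neg_apply, h3]; simp

lemma imL_I_smul (f : L2C) : imL (Complex.I • f) = reL f := by
  apply Lp.ext
  filter_upwards [coeFn_imL (Complex.I • f), Lp.coeFn_smul Complex.I f, coeFn_reL f]
    with x h1 h2 h3
  rw [h1, h2, h3]; simp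

lemma norm_reL_le (f : L2C) : ‖reL f‖ ≤ ‖f‖ := by
  refine Lp.norm_le_norm_of_ae_le ?_
  filter_upwards [coeFn_reL f] with x h
  rw [h]; exact Complex.abs_re_le_norm _

lemma conjL_toC (f : L2) : conjL (toC f) = toC f := by
  apply Lp.ext
  filter_upwards [coeFn_conjL (toC f), coeFn_toC f] with x h1 h2
  simp [h1, h2]

lemma toC_reL (f : L2C) : toC (reL f) = (1 / 2 : ℝ) • (f + conjL f) := by
  apply Lp.ext
  filter_upwards [coeFn_toC (reL f), coeFn_reL f, coeFn_conjL f, Lp.coeFn_add f (conjL f),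
    Lp.coeFn_smul (1 / 2 : ℝ) (f + conjL f)] with x h1 h2 h3 h4 h5
  rw [h1, h2, h5, Pi.smul_apply, h4, Pi.add_apply, h3, Complex.add_conj]
  simp

lemma eq_toC_of_imL_eq_zero {f : L2C} (h : imL f = 0) : f = toC (reL f) := by
  conv_lhs => rw [← toC_re_add_im f, h]
  simp

/-- Two continuous maps agreeing on Schwartz functions agree on `L²`. -/
lemma L2C_ext_schwartz {A B : L2C → L2C} (hA : Continuous A) (hB : Continuous B)
    (h : ∀ φ : 𝓢(ℝ, ℂ), A (φ.toLp 2) = B (φ.toLp 2)) : A = B :=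
  (SchwartzMap.denseRange_toLpCLM (E := ℝ) (F := ℂ) (μ := volume) (p := 2)
    ENNReal.ofNat_ne_top).equalizer hA hB (funext h)

lemma conjL_fourier (f : L2C) : conjL (𝓕 f : L2C) = (𝓕⁻ (conjL f) : L2C) := by
  have key : (fun f : L2C => conjL (𝓕 f : L2C)) = fun f => (𝓕⁻ (conjL f) : L2C) := by
    refine L2C_ext_schwartz (conjL.continuous.comp (Lp.fourierTransformₗᵢ ℝ ℂ).continuous)
      ((Lp.fourierTransformₗᵢ ℝ ℂ).symm.continuous.comp conjL.continuous) fun φ => ?_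
    set ψ : 𝓢(ℝ, ℂ) := SchwartzMap.postcompCLM (𝕜 := ℝ) (Complex.conjCLE : ℂ →L[ℝ] ℂ) φ with hψ
    have h1 : conjL (φ.toLp 2) = ψ.toLp 2 := by
      apply Lp.ext
      filter_upwards [coeFn_conjL (φ.toLp 2), φ.coeFn_toLp 2 volume, ψ.coeFn_toLp 2 volume]
        with x h1 h2 h3
      rw [h1, h2, h3]; simp [hψ]
    rw [h1, SchwartzMap.toLp_fourier_eq, SchwartzMap.toLp_fourierInv_eq]
    apply Lp.ext
    filter_upwards [coeFn_conjL ((𝓕 φ).toLp 2), (𝓕 φ).coeFn_toLp 2 volume,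
      (𝓕⁻ ψ).coeFn_toLp 2 volume] with x h1 h2 h3
    rw [h1, h2, h3, SchwartzMap.fourier_coe, SchwartzMap.fourierInv_coe, Real.fourier_eq,
      Real.fourierInv_eq, ← integral_conj]
    congr 1
    ext y
    simp [hψ, Circle.smul_def, Real.fourierChar_apply, ← Complex.exp_conj, Complex.conj_ofNat]
  exact congrFun key f

lemma reflL_fourier (f : L2C) : reflL (𝓕 f : L2C) = (𝓕⁻ f : L2C) := by
  have key : (fun f : L2C => reflL (𝓕 f : L2C)) = fun f => (𝓕⁻ f : L2C) := by
    refine L2C_ext_schwartz (reflL.continuous.comp (Lp.fourierTransformₗᵢ ℝ ℂ).continuous)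
      ((Lp.fourierTransformₗᵢ ℝ ℂ).symm.continuous) fun φ => ?_
    rw [SchwartzMap.toLp_fourier_eq, SchwartzMap.toLp_fourierInv_eq]
    apply Lp.ext
    filter_upwards [coeFn_reflL ((𝓕 φ).toLp 2),
      (Measure.measurePreserving_neg volume).quasiMeasurePreserving.ae
        ((𝓕 φ).coeFn_toLp 2 volume),
      (𝓕⁻ φ).coeFn_toLp 2 volume] with x h1 h2 h3
    rw [h1, h2, h3, SchwartzMap.fourier_coe, SchwartzMap.fourierInv_coe,
      Real.fourierInv_eq_fourier_neg]
  exact congrFun key f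

lemma reflL_reflL (f : L2C) : reflL (reflL f) = f := by
  apply Lp.ext
  filter_upwards [coeFn_reflL (reflL f),
    (Measure.measurePreserving_neg volume).quasiMeasurePreserving.ae (coeFn_reflL f)] with x h1 h2
  rw [h1, h2, neg_neg]

lemma fourier_conjL (f : L2C) : (𝓕 (conjL f) : L2C) = reflL (conjL (𝓕 f : L2C)) := by
  rw [conjL_fourier, ← reflL_fourier, reflL_reflL]

/-- Hermitian symbols: the multiplier maps real functions to real functions. -/
def Sym.Herm (a : Sym) : Prop := ∀ ξ, a (-ξ) = conj (a ξ)

lemma fmul_conjL {a : Sym} (ha : a.Herm) (f : L2C) : fmul a (conjL f) = conjL (fmul a f) := by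
  apply (Lp.fourierTransformₗᵢ ℝ ℂ).injective
  change (𝓕 (fmul a (conjL f)) : L2C) = (𝓕 (conjL (fmul a f)) : L2C)
  rw [fourier_fmul, fourier_conjL, fourier_conjL, fourier_fmul]
  set g : L2C := 𝓕 f
  apply Lp.ext
  have hq := (Measure.measurePreserving_neg (volume : Measure ℝ)).quasiMeasurePreserving
  filter_upwards [coeFn_mulSym a (reflL (conjL g)), coeFn_reflL (conjL g),
    coeFn_reflL (conjL (mulSym a g)), hq.ae (coeFn_conjL g), hq.ae (coeFn_conjL (mulSym a g)),
    hq.ae (coeFn_mulSym a g)] with ξ h1 h2 h3 h4 h5 h6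
  rw [h1, h2, h3, h4, h5, h6, map_mul, ha, Complex.conj_conj]

/-- The Fourier multiplier on real `L²` with a Hermitian symbol. -/
def rmul (a : Sym) : L2 →L[ℝ] L2 := reL ∘L (fmul a).restrictScalars ℝ ∘L toC

lemma rmul_apply (a : Sym) (f : L2) : rmul a f = reL (fmul a (toC f)) := rfl

lemma toC_rmul {a : Sym} (ha : a.Herm) (f : L2) : toC (rmul a f) = fmul a (toC f) := by
  rw [rmul_apply, toC_reL, ← fmul_conjL ha, conjL_toC, ← two_smul ℝ (fmul a (toC f)), smul_smul]
  norm_num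

lemma fmul_eq_re_im {a : Sym} (ha : a.Herm) (f : L2C) :
    fmul a f = toC (rmul a (reL f)) + Complex.I • toC (rmul a (imL f)) := by
  conv_lhs => rw [← toC_re_add_im f]
  rw [map_add, map_smul, toC_rmul ha, toC_rmul ha]

lemma reL_fmul {a : Sym} (ha : a.Herm) (f : L2C) : reL (fmul a f) = rmul a (reL f) := by
  rw [fmul_eq_re_im ha, map_add, reL_toC, reL_I_smul, imL_toC]; simp

lemma imL_fmul {a : Sym} (ha : a.Herm) (f : L2C) : imL (fmul a f) = rmul a (imL f) := by
  rw [fmul_eq_re_im ha, map_add, imL_toC, imL_I_smul, reL_toC]; simp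

lemma rmul_mul {b : Sym} (a : Sym) (hb : b.Herm) (f : L2) :
    rmul (a * b) f = rmul a (rmul b f) := by
  rw [rmul_apply, fmul_mul, ← toC_rmul hb, ← rmul_apply]

lemma norm_rmul_le_of_bound (a : Sym) {C : ℝ} (h : ∀ ξ, ‖a ξ‖ ≤ C) (f : L2) :
    ‖rmul a f‖ ≤ C * ‖f‖ := by
  rw [rmul_apply, ← norm_toC f]
  exact (norm_reL_le _).trans (norm_fmul_le_of_bound a h _)

lemma rmul_injective {a : Sym} (ha : a.Herm) (h : ∀ ξ, a ξ ≠ 0) :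
    Function.Injective (rmul a) := fun f g hfg => by
  apply toC_injective
  apply fmul_injective a h
  rw [← toC_rmul ha, ← toC_rmul ha, hfg]

lemma inner_toC (f g : L2) : inner ℂ (toC f) (toC g) = ((inner ℝ f g : ℝ) : ℂ) := by
  rw [L2.inner_def, L2.inner_def, ← integral_complex_ofReal]
  apply integral_congr_ae
  filter_upwards [coeFn_toC f, coeFn_toC g] with x h1 h2
  rw [h1, h2]; simp

lemma inner_fmul_left (a b : Sym) (hab : ∀ ξ, conj (a ξ) = b ξ) (f g : L2C) :
    inner ℂ (fmul a f) g = inner ℂ f (fmul b g) := by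
  rw [← Lp.inner_fourier_eq (fmul a f), ← Lp.inner_fourier_eq f, fourier_fmul, fourier_fmul,
    L2.inner_def, L2.inner_def]
  apply integral_congr_ae
  filter_upwards [coeFn_mulSym a (𝓕 f : L2C), coeFn_mulSym b (𝓕 g : L2C)] with x h1 h2
  rw [h1, h2]; simp [← hab]; ring

lemma inner_rmul_left {a b : Sym} (ha : a.Herm) (hb : b.Herm) (hab : ∀ ξ, conj (a ξ) = b ξ)
    (f g : L2) : inner ℝ (rmul a f) g = inner ℝ f (rmul b g) := by
  have := inner_fmul_left a b hab (toC f) (toC g)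
  rw [← toC_rmul ha, ← toC_rmul hb, inner_toC, inner_toC] at this
  exact_mod_cast this

lemma fmul_real_smul (a : Sym) (c : ℝ) (f : L2C) : fmul a (c • f) = c • fmul a f :=
  (fmul a).map_smul_of_tower c f

lemma ofReal_smul_L2C (c : ℝ) (f : L2C) : (c : ℂ) • f = c • f := by
  apply Lp.ext
  filter_upwards [Lp.coeFn_smul c f, Lp.coeFn_smul (c : ℂ) f] with x h1 h2
  rw [h1, h2]; simp

/-- The square `1 + (2πξ)²` of the symbol of `(1 - ∂ₓ²)^(1/2)`. -/
def japSq (ξ : ℝ) : ℝ := 1 + ‖2 * Real.pi * ξ‖ ^ 2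

/-- The real weight `(1 + (2πξ)²)^(p/2) (1 + ξ²)^(q/2)`. -/
def weight (p q ξ : ℝ) : ℝ := japSq ξ ^ (p / 2) * (1 + ‖ξ‖ ^ 2) ^ (q / 2)

lemma japSq_pos (ξ : ℝ) : 0 < japSq ξ := by unfold japSq; positivity

lemma weight_pos (p q ξ : ℝ) : 0 < weight p q ξ := by
  have := japSq_pos ξ
  unfold weight; positivity

lemma weight_neg_arg (p q ξ : ℝ) : weight p q (-ξ) = weight p q ξ := by
  simp [weight, japSq]

lemma weight_mul (p q p' q' ξ : ℝ) :
    weight p q ξ * weight p' q' ξ = weight (p + p') (q + q') ξ := by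
  have h1 := japSq_pos ξ
  have h2 : 0 < 1 + ‖ξ‖ ^ 2 := by positivity
  unfold weight
  rw [add_div, add_div, Real.rpow_add h1, Real.rpow_add h2]
  ring

lemma weight_zero_zero (ξ : ℝ) : weight 0 0 ξ = 1 := by simp [weight]

lemma hasTemperateGrowth_japSq_rpow (p : ℝ) :
    (fun ξ : ℝ => japSq ξ ^ (p / 2)).HasTemperateGrowth := by
  have h1 := Function.hasTemperateGrowth_one_add_norm_sq_rpow ℝ (p / 2)
  have h2 : (fun ξ : ℝ => 2 * Real.pi * ξ).HasTemperateGrowth := by fun_prop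
  exact h1.comp h2

lemma hasTemperateGrowth_weight (p q : ℝ) : (weight p q).HasTemperateGrowth :=
  (hasTemperateGrowth_japSq_rpow p).mul (Function.hasTemperateGrowth_one_add_norm_sq_rpow ℝ (q / 2))

lemma continuous_weight (p q : ℝ) : Continuous (weight p q) :=
  (hasTemperateGrowth_weight p q).1.continuous

/-- The complex-valued version of `weight`. -/
def weightC (p q : ℝ) : ℝ → ℂ := fun ξ => (weight p q ξ : ℂ)

lemma hasTemperateGrowth_weightC (p q : ℝ) : (weightC p q).HasTemperateGrowth :=
  Function.Complex.hasTemperateGrowth_ofReal.comp (hasTemperateGrowth_weight p q)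

lemma one_le_two_pi : 1 ≤ 2 * Real.pi := by linarith [Real.pi_gt_three]

lemma japSq_le (ξ : ℝ) : japSq ξ ≤ (2 * Real.pi) ^ 2 * (1 + ‖ξ‖ ^ 2) := by
  have h : 1 ≤ (2 * Real.pi) ^ 2 := one_le_pow₀ one_le_two_pi
  rw [japSq, norm_mul, mul_pow, Real.norm_of_nonneg (by positivity)]
  linarith

lemma le_japSq (ξ : ℝ) : 1 + ‖ξ‖ ^ 2 ≤ japSq ξ := by
  have h : 1 ≤ (2 * Real.pi) ^ 2 := one_le_pow₀ one_le_two_pi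
  rw [japSq, norm_mul, mul_pow, Real.norm_of_nonneg (by positivity : 0 ≤ 2 * Real.pi)]
  nlinarith [sq_nonneg ‖ξ‖]

/-- The constant in the bound for bounded weights. -/
def weightBound (p : ℝ) : ℝ := (2 * Real.pi) ^ |p|

lemma weight_le {p q : ℝ} (h : p + q ≤ 0) (ξ : ℝ) : weight p q ξ ≤ weightBound p := by
  have h2 : 1 ≤ 1 + ‖ξ‖ ^ 2 := by nlinarith [sq_nonneg ‖ξ‖]
  have h3 := japSq_pos ξ
  have e : weight p q ξ = (japSq ξ / (1 + ‖ξ‖ ^ 2)) ^ (p / 2) * (1 + ‖ξ‖ ^ 2) ^ ((p + q) / 2) := by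
    rw [weight, Real.div_rpow h3.le (by positivity), add_div, Real.rpow_add (by positivity)]
    have : (1 + ‖ξ‖ ^ 2) ^ (p / 2) ≠ 0 := by positivity
    field_simp
  have h4 : 1 ≤ japSq ξ / (1 + ‖ξ‖ ^ 2) := by
    rw [one_le_div (by positivity)]; exact le_japSq ξ
  have h5 : japSq ξ / (1 + ‖ξ‖ ^ 2) ≤ (2 * Real.pi) ^ 2 := by
    rw [div_le_iff₀ (by positivity)]; exact japSq_le ξ
  rw [e]
  calc _ ≤ (japSq ξ / (1 + ‖ξ‖ ^ 2)) ^ (|p| / 2) * 1 := by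
        gcongr ?_ * ?_
        · exact Real.rpow_le_rpow_of_exponent_le h4 (by linarith [le_abs_self p])
        · exact Real.rpow_le_one_of_one_le_of_nonpos h2 (by linarith)
    _ ≤ ((2 * Real.pi) ^ 2) ^ (|p| / 2) := by rw [mul_one]; gcongr
    _ = weightBound p := by
        rw [weightBound, ← Real.rpow_natCast, ← Real.rpow_mul (by positivity)]
        congr 1; push_cast; ring

lemma norm_weightC (p q ξ : ℝ) : ‖weightC p q ξ‖ = weight p q ξ := by
  rw [weightC, Complex.norm_real, Real.norm_of_nonneg (weight_pos p q ξ).le]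

/-- The bounded symbol `weightC p q` for `p + q ≤ 0` (and `0` otherwise). -/
def W (p q : ℝ) : Sym := by
  classical
  exact if h : p + q ≤ 0 then
    BoundedContinuousFunction.ofNormedAddCommGroup (weightC p q)
      (hasTemperateGrowth_weightC p q).1.continuous (weightBound p)
      (fun ξ => (norm_weightC p q ξ).trans_le (weight_le h ξ)) else 0

lemma coe_W {p q : ℝ} (h : p + q ≤ 0) : (W p q : ℝ → ℂ) = weightC p q := by
  rw [W, dif_pos h]; rfl

lemma W_apply {p q : ℝ} (h : p + q ≤ 0) (ξ : ℝ) : W p q ξ = (weight p q ξ : ℂ) := by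
  rw [coe_W h]; rfl

lemma W_ne_zero {p q : ℝ} (h : p + q ≤ 0) (ξ : ℝ) : W p q ξ ≠ 0 := by
  rw [W_apply h]; exact_mod_cast (weight_pos p q ξ).ne'

lemma herm_W (p q : ℝ) : (W p q).Herm := fun ξ => by
  by_cases h : p + q ≤ 0
  · rw [W_apply h, W_apply h, weight_neg_arg, Complex.conj_ofReal]
  · rw [W, dif_neg h]; simp

lemma W_mul {p q p' q' : ℝ} (h : p + q ≤ 0) (h' : p' + q' ≤ 0) :
    W p q * W p' q' = W (p + p') (q + q') := by
  ext ξ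
  rw [BoundedContinuousFunction.mul_apply, W_apply h, W_apply h', W_apply (by linarith),
    ← weight_mul, Complex.ofReal_mul]

lemma norm_W_le {p q : ℝ} (h : p + q ≤ 0) (ξ : ℝ) : ‖W p q ξ‖ ≤ weightBound p := by
  rw [coe_W h, norm_weightC]; exact weight_le h ξ

lemma W_zero_zero : W 0 0 = 1 := by
  ext ξ
  rw [W_apply (by simp), weight_zero_zero]; simp

lemma norm_W_zero_le {q : ℝ} (h : q ≤ 0) (ξ : ℝ) : ‖W 0 q ξ‖ ≤ 1 := by
  simpa [weightBound] using norm_W_le (p := 0) (q := q) (by linarith) ξ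

lemma two_pi_mul_sq_le (ξ : ℝ) : (2 * Real.pi * ξ) ^ 2 ≤ japSq ξ := by
  rw [japSq, Real.norm_eq_abs, sq_abs]; linarith

lemma weight_neg_two (ξ : ℝ) : weight (-2) 0 ξ = (japSq ξ)⁻¹ := by
  simp [weight, Real.rpow_neg_one]

lemma japSq_eq (ξ : ℝ) : japSq ξ = 1 + (2 * Real.pi * ξ) ^ 2 := by
  rw [japSq, Real.norm_eq_abs, sq_abs]

/-- The symbol `2πiξ` of `∂ₓ`. -/
def dsym (ξ : ℝ) : ℂ := 2 * Real.pi * Complex.I * ξ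

lemma hasTemperateGrowth_dsym : dsym.HasTemperateGrowth := by
  unfold dsym; fun_prop

lemma norm_dsym_mul_le (ξ : ℝ) : ‖dsym ξ * weightC (-2) 0 ξ‖ ≤ 1 := by
  rw [norm_mul, norm_weightC, weight_neg_two, ← div_eq_mul_inv, div_le_one (japSq_pos ξ)]
  have h1 : ‖dsym ξ‖ = |2 * Real.pi * ξ| := by
    simp [dsym, abs_mul, abs_of_pos Real.pi_pos]
  rw [h1, japSq_eq]
  nlinarith [sq_abs (2 * Real.pi * ξ), sq_nonneg (|2 * Real.pi * ξ| - 1)]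

lemma dsym_sq (ξ : ℝ) : dsym ξ ^ 2 = -((2 * Real.pi * ξ) ^ 2 : ℝ) := by
  rw [dsym]; push_cast; ring_nf; simp

lemma norm_dsym_sq_mul_le (ξ : ℝ) : ‖dsym ξ ^ 2 * weightC (-2) 0 ξ‖ ≤ 1 := by
  rw [norm_mul, norm_weightC, weight_neg_two, ← div_eq_mul_inv, div_le_one (japSq_pos ξ), dsym_sq,
    norm_neg, Complex.norm_real, Real.norm_of_nonneg (by positivity)]
  exact two_pi_mul_sq_le ξ

/-- The symbol of `∂ₓ (1 - ∂ₓ²)⁻¹`. -/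
def D1 : Sym := BoundedContinuousFunction.ofNormedAddCommGroup (fun ξ => dsym ξ * weightC (-2) 0 ξ)
  (hasTemperateGrowth_dsym.1.continuous.mul (hasTemperateGrowth_weightC _ _).1.continuous) 1
  norm_dsym_mul_le

/-- The symbol of `∂ₓ² (1 - ∂ₓ²)⁻¹`. -/
def D2 : Sym := BoundedContinuousFunction.ofNormedAddCommGroup
  (fun ξ => dsym ξ ^ 2 * weightC (-2) 0 ξ)
  ((hasTemperateGrowth_dsym.1.continuous.pow 2).mul
    (hasTemperateGrowth_weightC _ _).1.continuous) 1 norm_dsym_sq_mul_le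

lemma coe_D1 : (D1 : ℝ → ℂ) = fun ξ => dsym ξ * weightC (-2) 0 ξ := rfl
lemma coe_D2 : (D2 : ℝ → ℂ) = fun ξ => dsym ξ ^ 2 * weightC (-2) 0 ξ := rfl

lemma conj_dsym (ξ : ℝ) : conj (dsym ξ) = -dsym ξ := by
  simp [dsym, Complex.conj_ofNat]

lemma dsym_neg (ξ : ℝ) : dsym (-ξ) = -dsym ξ := by simp [dsym]

lemma conj_weightC (p q ξ : ℝ) : conj (weightC p q ξ) = weightC p q ξ := Complex.conj_ofReal _

lemma weightC_neg_arg (p q ξ : ℝ) : weightC p q (-ξ) = weightC p q ξ := by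
  simp [weightC, weight_neg_arg]

lemma herm_D1 : D1.Herm := fun ξ => by
  simp [coe_D1, conj_dsym, dsym_neg, conj_weightC, weightC_neg_arg]

lemma herm_D2 : D2.Herm := fun ξ => by
  simp [coe_D2, conj_dsym, dsym_neg, conj_weightC, weightC_neg_arg]

lemma norm_D2_le (ξ : ℝ) : ‖D2 ξ‖ ≤ 1 := norm_dsym_sq_mul_le ξ

/-- The symbol `(1 + (2πξ)²)^(1/2)`. -/
def jap (ξ : ℝ) : ℝ := weight 1 0 ξ

lemma continuous_jap : Continuous jap := continuous_weight 1 0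

/-- The symbol `exp (i t (1 + (2πξ)²)^(1/2))` of the Klein-Gordon half-wave group. -/
def wave (t : ℝ) : Sym := BoundedContinuousFunction.ofNormedAddCommGroup
  (fun ξ => Complex.exp ((t * jap ξ : ℝ) * Complex.I))
  (by have := continuous_jap; fun_prop) 1 (fun ξ => (Complex.norm_exp_ofReal_mul_I _).le)

lemma wave_apply (t ξ : ℝ) : wave t ξ = Complex.exp ((t * jap ξ : ℝ) * Complex.I) := rfl

lemma norm_wave (t ξ : ℝ) : ‖wave t ξ‖ = 1 := Complex.norm_exp_ofReal_mul_I _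

lemma wave_zero : wave 0 = 1 := by ext ξ; simp [wave_apply]

lemma wave_add (s t : ℝ) : wave (s + t) = wave s * wave t := by
  ext ξ
  rw [BoundedContinuousFunction.mul_apply, wave_apply, wave_apply, wave_apply, ← Complex.exp_add]
  congr 1; push_cast; ring

lemma fmul_wave_neg_wave (t : ℝ) (f : L2C) : fmul (wave (-t)) (fmul (wave t) f) = f := by
  rw [← fmul_mul, ← wave_add, neg_add_cancel, wave_zero, fmul_one]

lemma fmul_wave_wave_neg (t : ℝ) (f : L2C) : fmul (wave t) (fmul (wave (-t)) f) = f := by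
  rw [← fmul_mul, ← wave_add, add_neg_cancel, wave_zero, fmul_one]

lemma norm_fmul_wave (t : ℝ) (f : L2C) : ‖fmul (wave t) f‖ = ‖f‖ :=
  norm_fmul_of_norm_eq_one _ (norm_wave t) f

lemma tendsto_fmul_wave {ι : Type*} {l : Filter ι} [l.IsCountablyGenerated] {τ : ι → ℝ} {t : ℝ}
    (h : Tendsto τ l (𝓝 t)) {f : ι → L2C} {f₀ : L2C} (hf : Tendsto f l (𝓝 f₀)) :
    Tendsto (fun i => fmul (wave (τ i)) (f i)) l (𝓝 (fmul (wave t) f₀)) := by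
  have h1 : Tendsto (fun i => fmul (wave (τ i)) f₀) l (𝓝 (fmul (wave t) f₀)) := by
    refine tendsto_fmul (fun i => wave (τ i)) (wave t) (fun i ξ => (norm_wave _ ξ).le)
      (fun ξ => (norm_wave t ξ).le) (fun ξ => ?_) f₀
    simp only [wave_apply]
    have hc : Continuous fun s : ℝ => Complex.exp ((s * jap ξ : ℝ) * Complex.I) := by fun_prop
    exact (hc.tendsto t).comp h
  have h2 : Tendsto (fun i => fmul (wave (τ i)) (f i - f₀)) l (𝓝 0) := by
    rw [tendsto_zero_iff_norm_tendsto_zero]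
    simp only [norm_fmul_wave]
    rw [← tendsto_zero_iff_norm_tendsto_zero]
    simpa using hf.sub_const f₀
  simpa using h1.add h2

/-- The half-wave evolution of `(1 - ∂ₓ²)^(-1/2) Z` is differentiable in time. -/
lemma hasDerivAt_fmul_wave (c t : ℝ) (Z : L2C) :
    HasDerivAt (fun s => fmul (wave (c * s)) (fmul (W (-1) 0) Z))
      (fmul (wave (c * t)) ((c * Complex.I) • Z)) t := by
  have h0 : (-1 : ℝ) + 0 ≤ 0 := by norm_num
  rw [hasDerivAt_iff_tendsto_slope]
  set q : ℝ → Sym := fun s => ((s - t)⁻¹ : ℂ) • ((wave (c * s) - wave (c * t)) * W (-1) 0)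
  have key : ∀ ξ : ℝ, (weight 1 0 ξ : ℂ) * (weight (-1) 0 ξ : ℂ) = 1 := fun ξ => by
    rw [← Complex.ofReal_mul, weight_mul]; simp [weight_zero_zero]
  have hd : ∀ ξ s, HasDerivAt (fun s : ℝ => Complex.exp ((c * s * jap ξ : ℝ) * Complex.I))
      (Complex.exp ((c * s * jap ξ : ℝ) * Complex.I) * (c * jap ξ * Complex.I)) s := by
    intro ξ s
    have h1 : HasDerivAt (fun s : ℝ => ((c * s * jap ξ : ℝ) : ℂ) * Complex.I)
        (((c * 1 * jap ξ : ℝ) : ℂ) * Complex.I) s :=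
      ((((hasDerivAt_id s).const_mul c).mul_const (jap ξ)).ofReal_comp).mul_const _
    convert h1.cexp using 1
    push_cast; ring
  have hq : Tendsto (fun s => fmul (q s) Z) (𝓝[≠] t)
      (𝓝 (fmul ((c * Complex.I) • wave (c * t)) Z)) := by
    refine tendsto_fmul (C := |c|) q _ ?_ ?_ ?_ Z
    · intro s ξ
      have hb : ‖wave (c * s) ξ - wave (c * t) ξ‖ ≤ |c| * jap ξ * |s - t| := by
        have := Convex.norm_image_sub_le_of_norm_hasDerivWithin_le (s := univ)
          (f := fun s : ℝ => Complex.exp ((c * s * jap ξ : ℝ) * Complex.I))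
          (C := |c| * jap ξ) (fun x _ => (hd ξ x).hasDerivWithinAt) ?_ convex_univ (mem_univ t)
          (mem_univ s)
        · simpa [wave_apply] using this
        · intro x _
          rw [norm_mul, Complex.norm_exp_ofReal_mul_I]
          simp [abs_of_pos (weight_pos 1 0 ξ), jap]
      simp only [q, BoundedContinuousFunction.coe_smul, BoundedContinuousFunction.coe_mul,
        BoundedContinuousFunction.coe_sub, Pi.mul_apply, Pi.sub_apply, smul_eq_mul, norm_mul,
        norm_inv, W_apply h0]
      rw [← Complex.ofReal_sub, Complex.norm_real, Complex.norm_real, Real.norm_eq_abs,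
        Real.norm_of_nonneg (weight_pos _ _ _).le]
      have h1 : jap ξ * weight (-1) 0 ξ = 1 := by exact_mod_cast key ξ
      have h2 := weight_pos (-1) 0 ξ
      rcases eq_or_ne s t with rfl | hst
      · simp
      have h3 : 0 < |s - t| := abs_pos.2 (sub_ne_zero.2 hst)
      calc _ ≤ |s - t|⁻¹ * (|c| * jap ξ * |s - t| * weight (-1) 0 ξ) := by gcongr
        _ = |c| * (jap ξ * weight (-1) 0 ξ) := by field_simp
        _ = |c| := by rw [h1, mul_one]
    · intro ξ
      simp [norm_wave]
    · intro ξ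
      have h1 := (hasDerivAt_iff_tendsto_slope.1 (hd ξ t)).mul_const (weight (-1) 0 ξ : ℂ)
      have e : Complex.exp ((c * t * jap ξ : ℝ) * Complex.I) * (c * jap ξ * Complex.I) *
          (weight (-1) 0 ξ : ℂ) = ((c * Complex.I) • wave (c * t)) ξ := by
        have : (jap ξ : ℂ) * (weight (-1) 0 ξ : ℂ) = 1 := key ξ
        simp only [BoundedContinuousFunction.coe_smul, smul_eq_mul, wave_apply]
        linear_combination (Complex.exp ((c * t * jap ξ : ℝ) * Complex.I) * c * Complex.I) * this
      rw [e] at h1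
      refine h1.congr fun s => ?_
      simp only [q, slope, vsub_eq_sub, BoundedContinuousFunction.coe_smul,
        BoundedContinuousFunction.coe_mul, BoundedContinuousFunction.coe_sub, Pi.mul_apply,
        Pi.sub_apply, wave_apply, smul_eq_mul, W_apply h0, Complex.real_smul]
      push_cast; ring
  rw [fmul_smul, ← map_smul] at hq
  refine hq.congr fun s => ?_
  simp only [q, slope, vsub_eq_sub]
  rw [fmul_smul, fmul_mul, fmul_sub]
  rw [← Complex.ofReal_sub, ← Complex.ofReal_inv, ofReal_smul_L2C]

/-- Product rule for the half-wave evolution of a differentiable curve. -/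
lemma hasDerivWithinAt_fmul_wave {I : Set ℝ} {X : ℝ → L2C} {X' Z : L2C} {t : ℝ} (c : ℝ)
    (hX : HasDerivWithinAt X X' I t) (hZ : X t = fmul (W (-1) 0) Z) :
    HasDerivWithinAt (fun s => fmul (wave (c * s)) (X s))
      (fmul (wave (c * t)) (X' + (c * Complex.I) • Z)) I t := by
  have h1 := (hasDerivAt_fmul_wave c t Z).hasDerivWithinAt (s := I)
  rw [← hZ] at h1
  rw [hasDerivWithinAt_iff_tendsto_slope] at h1 hX ⊢
  have hc : Tendsto (fun s : ℝ => c * s) (𝓝[I \ {t}] t) (𝓝 (c * t)) :=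
    ((continuous_const.mul continuous_id).tendsto t).mono_left nhdsWithin_le_nhds
  have h2 := (tendsto_fmul_wave hc hX).add h1
  rw [← map_add] at h2
  refine h2.congr fun s => ?_
  simp only [slope, vsub_eq_sub]
  rw [fmul_real_smul, ← smul_add, map_sub]
  congr 1
  abel

/-- The embedding of `L²` into the tempered distributions. -/
def tdist : L2C →L[ℂ] 𝓢'(ℝ, ℂ) := Lp.toTemperedDistributionCLM ℂ volume 2

lemma toDist_eq (f : L2) : toDist f = tdist (toC f) := rfl

lemma tdist_eq (f : L2C) : tdist f = Lp.toTemperedDistribution f := rfl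

lemma tdist_injective : Function.Injective tdist :=
  LinearMap.ker_eq_bot.1 (Lp.ker_toTemperedDistributionCLM_eq_bot (F := ℂ)
    (μ := (volume : Measure ℝ)) (p := 2))

/-- Fourier multipliers on tempered distributions. -/
abbrev dmul (g : ℝ → ℂ) : 𝓢'(ℝ, ℂ) →L[ℂ] 𝓢'(ℝ, ℂ) :=
  TemperedDistribution.fourierMultiplierCLM ℂ g

lemma dmul_congr {g h : ℝ → ℂ} (e : ∀ ξ, g ξ = h ξ) (f : 𝓢'(ℝ, ℂ)) : dmul g f = dmul h f := by
  rw [funext e]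

lemma dmul_dmul {g h : ℝ → ℂ} (hg : g.HasTemperateGrowth) (hh : h.HasTemperateGrowth)
    (f : 𝓢'(ℝ, ℂ)) : dmul g (dmul h f) = dmul (fun ξ => g ξ * h ξ) f := by
  rw [dmul, dmul, TemperedDistribution.fourierMultiplierCLM_fourierMultiplierCLM_apply hh hg]
  exact dmul_congr (fun ξ => mul_comm _ _) f

lemma dmul_one (f : 𝓢'(ℝ, ℂ)) : dmul (fun _ => 1) f = f := by simp [dmul]

lemma dmul_add {g h : ℝ → ℂ} (hg : g.HasTemperateGrowth) (hh : h.HasTemperateGrowth)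
    (f : 𝓢'(ℝ, ℂ)) : dmul (fun ξ => g ξ + h ξ) f = dmul g f + dmul h f := by
  change dmul (g + h) f = _
  simp only [dmul, TemperedDistribution.fourierMultiplierCLM_apply]
  rw [TemperedDistribution.smulLeftCLM_add hg hh, add_apply, FourierTransform.fourierInv_add]

lemma dmul_tdist (a : Sym) (ha : (a : ℝ → ℂ).HasTemperateGrowth) (f : L2C) :
    dmul a (tdist f) = tdist (fmul a f) := by
  rw [dmul, TemperedDistribution.fourierMultiplierCLM_apply, tdist_eq, tdist_eq,
    Lp.fourier_toTemperedDistribution_eq, fmul_apply, ← Lp.fourierInv_toTemperedDistribution_eq]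
  congr 1
  exact (Lp.toTemperedDistribution_smul_eq ha a.memLp_top (𝓕 f : L2C)).symm

lemma dmul_weightC_tdist {p q : ℝ} (h : p + q ≤ 0) (f : L2C) :
    dmul (weightC p q) (tdist f) = tdist (fmul (W p q) f) := by
  rw [← dmul_tdist _ (by rw [coe_W h]; exact hasTemperateGrowth_weightC p q), coe_W h]

lemma dmul_weightC_dmul_weightC (p q p' q' : ℝ) (f : 𝓢'(ℝ, ℂ)) :
    dmul (weightC p q) (dmul (weightC p' q') f) = dmul (weightC (p + p') (q + q')) f := by
  rw [dmul_dmul (hasTemperateGrowth_weightC _ _) (hasTemperateGrowth_weightC _ _)]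
  refine dmul_congr (fun ξ => ?_) f
  simp only [weightC]
  rw [← Complex.ofReal_mul, weight_mul]

lemma weightC_zero_zero : weightC 0 0 = fun _ => 1 := by
  ext ξ; simp [weightC, weight_zero_zero]

lemma dmul_weightC_zero_zero (f : 𝓢'(ℝ, ℂ)) : dmul (weightC 0 0) f = f := by
  rw [weightC_zero_zero, dmul_one]

lemma besselPotential_eq (s : ℝ) (f : 𝓢'(ℝ, ℂ)) :
    TemperedDistribution.besselPotential ℝ ℂ s f = dmul (weightC 0 s) f := by
  rw [TemperedDistribution.besselPotential]
  refine dmul_congr (fun ξ => ?_) f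
  simp [weightC, weight]

lemma dx_eq (f : 𝓢'(ℝ, ℂ)) : dx f = dmul dsym f := by
  have h1 : dx f = LineDeriv.lineDerivOp (1 : ℝ) f := by
    ext g
    rw [dx, TemperedDistribution.derivCLM_apply_apply, TemperedDistribution.lineDerivOp_apply_apply]
    congr 2
  rw [h1, TemperedDistribution.lineDeriv_eq_fourierMultiplierCLM, ← smul_apply,
    ← TemperedDistribution.fourierMultiplierCLM_smul (by fun_prop)]
  refine dmul_congr (fun ξ => ?_) f
  simp [dsym]

/-- If `f = B^{-σ} g` then the Sobolev norm of `f` of order `σ` is the `L²` norm of `g`. -/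
lemma sobolevNorm_eq {σ : ℝ} {f : 𝓢'(ℝ, ℂ)} {g : L2C}
    (h : TemperedDistribution.besselPotential ℝ ℂ σ f = tdist g) : sobolevNorm σ f = ‖g‖ₑ := by
  apply le_antisymm
  · exact iInf₂_le g h
  · refine le_iInf₂ fun g' hg' => ?_
    have : g = g' := tdist_injective (h.symm.trans hg')
    rw [this]

lemma memSobolev_iff {σ : ℝ} {f : 𝓢'(ℝ, ℂ)} : TemperedDistribution.MemSobolev σ 2 f ↔
    ∃ g : L2C, TemperedDistribution.besselPotential ℝ ℂ σ f = tdist g := Iff.rfl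

lemma besselPotential_eq_iff {σ : ℝ} {f : 𝓢'(ℝ, ℂ)} {g : L2C} :
    TemperedDistribution.besselPotential ℝ ℂ σ f = tdist g ↔ f = dmul (weightC 0 (-σ)) (tdist g) := by
  rw [besselPotential_eq]
  constructor
  · intro h
    rw [← h, dmul_weightC_dmul_weightC]; simp [dmul_weightC_zero_zero]
  · intro h
    rw [h, dmul_weightC_dmul_weightC]; simp [dmul_weightC_zero_zero]

lemma sobolevContinuousOn_of {σ : ℝ} {I : Set ℝ} {f : ℝ → 𝓢'(ℝ, ℂ)} {g : ℝ → L2C}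
    (h : ∀ t ∈ I, TemperedDistribution.besselPotential ℝ ℂ σ (f t) = tdist (g t))
    (hg : ContinuousOn g I) : SobolevContinuousOn σ I f := by
  refine ⟨fun t ht => ⟨g t, h t ht⟩, fun t₀ ht₀ => ?_⟩
  have h1 : Tendsto (fun t => ‖g t - g t₀‖ₑ) (𝓝[I] t₀) (𝓝 0) := by
    have h2 : Tendsto (fun t => g t - g t₀) (𝓝[I] t₀) (𝓝 0) := by
      simpa using (hg t₀ ht₀).tendsto.sub_const (g t₀)
    simpa using h2.enorm
  refine h1.congr' ?_
  filter_upwards [self_mem_nhdsWithin] with t ht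
  refine (sobolevNorm_eq ?_).symm
  rw [map_sub, map_sub, h t ht, h t₀ ht₀]

lemma SobolevContinuousOn.exists_continuousOn {σ : ℝ} {I : Set ℝ} {f : ℝ → 𝓢'(ℝ, ℂ)}
    (hf : SobolevContinuousOn σ I f) : ∃ g : ℝ → L2C, ContinuousOn g I ∧
      ∀ t ∈ I, TemperedDistribution.besselPotential ℝ ℂ σ (f t) = tdist (g t) := by
  classical
  choose! g hg using hf.1
  refine ⟨g, fun t₀ ht₀ => ?_, hg⟩
  have h1 : Tendsto (fun t => ‖g t - g t₀‖ₑ) (𝓝[I] t₀) (𝓝 0) := by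
    refine (hf.2 t₀ ht₀).congr' ?_
    filter_upwards [self_mem_nhdsWithin] with t ht
    refine sobolevNorm_eq ?_
    rw [map_sub, map_sub, hg t ht, hg t₀ ht₀]
    rfl
  rw [ContinuousWithinAt, tendsto_iff_edist_tendsto_0]
  simpa [edist_eq_enorm_sub] using h1

/-- Time derivatives commute with Fourier multipliers. -/
lemma HasTimeDeriv.dmul {I : Set ℝ} {f : ℝ → 𝓢'(ℝ, ℂ)} {f' : 𝓢'(ℝ, ℂ)} {t : ℝ}
    (h : HasTimeDeriv I f f' t) (g : ℝ → ℂ) :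
    HasTimeDeriv I (fun τ => dmul g (f τ)) (KGB.dmul g f') t := fun φ =>
  h (𝓕 (SchwartzMap.smulLeftCLM ℂ g (𝓕⁻ φ)))

lemma HasTimeDeriv.congr {I : Set ℝ} {f g : ℝ → 𝓢'(ℝ, ℂ)} {f' : 𝓢'(ℝ, ℂ)} {t : ℝ}
    (h : HasTimeDeriv I f f' t) (ht : t ∈ I) (hfg : ∀ τ ∈ I, g τ = f τ) :
    HasTimeDeriv I g f' t := fun φ =>
  (h φ).congr (fun τ hτ => by rw [hfg τ hτ]) (by rw [hfg t ht])

lemma hasTimeDeriv_tdist {I : Set ℝ} {f : ℝ → L2C} {f' : L2C} {t : ℝ}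
    (h : HasDerivWithinAt f f' I t) : HasTimeDeriv I (fun τ => tdist (f τ)) (tdist f') t := by
  intro φ
  let L : L2C →L[ℂ] ℂ := (PointwiseConvergenceCLM.evalCLM (RingHom.id ℂ) ℂ φ) ∘L tdist
  exact (L.restrictScalars ℝ).hasFDerivAt.comp_hasDerivWithinAt t h

/-- On `L¹ ∩ L²` the inverse Fourier transform of `L²` is given by the inverse Fourier integral. -/
lemma coeFn_fourierInv_toLp {k : ℝ → ℂ} (h1 : Integrable k) (h2 : MemLp k 2) :
    (𝓕⁻ (h2.toLp k) : L2C) =ᵐ[volume] (𝓕⁻ k : ℝ → ℂ) := by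
  have hc : Continuous (𝓕⁻ k : ℝ → ℂ) := by
    rw [Real.fourierInv_eq_fourier_comp_neg]
    exact VectorFourier.fourierIntegral_continuous Real.continuous_fourierChar
      (by exact continuous_inner) h1.comp_neg
  refine ae_eq_of_integral_contDiff_smul_eq ((Lp.memLp _).locallyIntegrable (by norm_num))
    hc.locallyIntegrable fun g hg hgc => ?_
  have hg₁ : HasCompactSupport (Complex.ofRealCLM ∘ g) := hgc.comp_left rfl
  have hg₂ : ContDiff ℝ (⊤ : ℕ∞) (Complex.ofRealCLM ∘ g) := by fun_prop
  set φ : 𝓢(ℝ, ℂ) := hg₁.toSchwartzMap hg₂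
  have hφ : ∀ x, φ x = g x := fun x => rfl
  have e1 : tdist (𝓕⁻ (h2.toLp k) : L2C) φ = tdist (h2.toLp k) (𝓕⁻ φ) := by
    rw [tdist_eq, ← Lp.fourierInv_toTemperedDistribution_eq]; rfl
  have e2 : tdist (h2.toLp k) (𝓕⁻ φ) = ∫ x, (𝓕⁻ φ : 𝓢(ℝ, ℂ)) x • k x := by
    rw [tdist_eq, Lp.toTemperedDistribution_apply]
    apply integral_congr_ae
    filter_upwards [h2.coeFn_toLp] with x hx
    rw [hx]
  have e3 : ∫ x, (𝓕⁻ φ : 𝓢(ℝ, ℂ)) x • k x = ∫ x, φ x • (𝓕⁻ k : ℝ → ℂ) x := by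
    have := VectorFourier.integral_fourierIntegral_smul_eq_flip (μ := (volume : Measure ℝ))
      (ν := (volume : Measure ℝ)) (L := -(innerₗ ℝ)) (f := φ) (g := k)
      Real.continuous_fourierChar (by simpa using! continuous_inner.neg) φ.integrable h1
    have p1 : ∀ (q : ℝ → ℂ) (x : ℝ), (𝓕⁻ q : ℝ → ℂ) x =
        VectorFourier.fourierIntegral Real.fourierChar volume (-(innerₗ ℝ)) q x := fun q x => by
      rw [Real.fourierInv_eq]; simp [VectorFourier.fourierIntegral]
    have p2 : ∀ (q : ℝ → ℂ) (x : ℝ), (𝓕⁻ q : ℝ → ℂ) x =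
        VectorFourier.fourierIntegral Real.fourierChar volume (-(innerₗ ℝ)).flip q x :=
      fun q x => by
        rw [Real.fourierInv_eq]
        simp only [VectorFourier.fourierIntegral]
        congr 1; ext v
        simp [mul_comm]
    refine Eq.trans ?_ (this.trans ?_)
    · refine integral_congr_ae (Eventually.of_forall fun x => ?_)
      simp only [SchwartzMap.fourierInv_coe, p1]
    · refine integral_congr_ae (Eventually.of_forall fun x => ?_)
      simp only [p2]
  rw [tdist_eq, Lp.toTemperedDistribution_apply] at e1
  simpa [hφ] using e1.trans (e2.trans e3)

lemma weight_kernel_sq_le {r : ℝ} (hr : 0 ≤ r) (ξ η : ℝ) :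
    (weight 0 r ξ * weight 0 (-r) η * weight 0 (-r) (ξ - η)) ^ 2 ≤
      4 ^ r * (weight 0 (-(2 * r)) η + weight 0 (-(2 * r)) (ξ - η)) := by
  have ha : 0 < 1 + ‖η‖ ^ 2 := by positivity
  have hb : 0 < 1 + ‖ξ - η‖ ^ 2 := by positivity
  have hc : 0 < 1 + ‖ξ‖ ^ 2 := by positivity
  have hw : ∀ p q x, weight p q x ^ 2 = weight (p + p) (q + q) x := fun p q x => by
    rw [sq, weight_mul]
  have h1 : 1 + ‖ξ‖ ^ 2 ≤ 4 * max (1 + ‖η‖ ^ 2) (1 + ‖ξ - η‖ ^ 2) := by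
    have h2 := le_max_left (1 + ‖η‖ ^ 2) (1 + ‖ξ - η‖ ^ 2)
    have h3 := le_max_right (1 + ‖η‖ ^ 2) (1 + ‖ξ - η‖ ^ 2)
    simp only [Real.norm_eq_abs, sq_abs] at *
    nlinarith [sq_nonneg (ξ - 2 * η)]
  have h4 : (1 + ‖ξ‖ ^ 2) ^ r ≤ 4 ^ r * ((1 + ‖η‖ ^ 2) ^ r + (1 + ‖ξ - η‖ ^ 2) ^ r) := by
    calc _ ≤ (4 * max (1 + ‖η‖ ^ 2) (1 + ‖ξ - η‖ ^ 2)) ^ r := by gcongr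
      _ = 4 ^ r * (max (1 + ‖η‖ ^ 2) (1 + ‖ξ - η‖ ^ 2)) ^ r :=
        Real.mul_rpow (by norm_num) (le_max_of_le_left ha.le)
      _ ≤ _ := by
        gcongr
        rcases max_cases (1 + ‖η‖ ^ 2) (1 + ‖ξ - η‖ ^ 2) with ⟨h, -⟩ | ⟨h, -⟩ <;> rw [h]
        · exact le_add_of_nonneg_right (by positivity)
        · exact le_add_of_nonneg_left (by positivity)
  rw [mul_pow, mul_pow, hw, hw, hw]
  simp only [weight, add_zero, zero_div, Real.rpow_zero, one_mul]
  have e1 : (r + r) / 2 = r := by ring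
  have e2 : (-r + -r) / 2 = -r := by ring
  have e3 : -(2 * r) / 2 = -r := by ring
  rw [e1, e2, e3]
  have ia : (1 + ‖η‖ ^ 2) ^ r * (1 + ‖η‖ ^ 2) ^ (-r) = 1 := by
    rw [← Real.rpow_add ha]; simp
  have ib : (1 + ‖ξ - η‖ ^ 2) ^ r * (1 + ‖ξ - η‖ ^ 2) ^ (-r) = 1 := by
    rw [← Real.rpow_add hb]; simp
  calc _ = (1 + ‖ξ‖ ^ 2) ^ r * ((1 + ‖η‖ ^ 2) ^ (-r) * (1 + ‖ξ - η‖ ^ 2) ^ (-r)) := by ring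
    _ ≤ 4 ^ r * ((1 + ‖η‖ ^ 2) ^ r + (1 + ‖ξ - η‖ ^ 2) ^ r) *
        ((1 + ‖η‖ ^ 2) ^ (-r) * (1 + ‖ξ - η‖ ^ 2) ^ (-r)) := by gcongr
    _ = 4 ^ r * ((1 + ‖η‖ ^ 2) ^ r * (1 + ‖η‖ ^ 2) ^ (-r) * (1 + ‖ξ - η‖ ^ 2) ^ (-r) +
        (1 + ‖ξ - η‖ ^ 2) ^ r * (1 + ‖ξ - η‖ ^ 2) ^ (-r) * (1 + ‖η‖ ^ 2) ^ (-r)) := by ring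
    _ = _ := by rw [ia, ib]; ring

lemma integrable_weight {q : ℝ} (hq : q < -1) : Integrable (weight 0 q) := by
  have := integrable_rpow_neg_one_add_norm_sq (E := ℝ) (μ := volume) (r := -q)
    (by rw [Module.finrank_self]; push_cast; linarith)
  refine this.congr (Eventually.of_forall fun x => ?_)
  simp [weight]

/-- Weighted convolution estimate behind the algebra property of `H^r`, `r > 1/2`. -/
lemma lintegral_weighted_convolution_sq_le {r : ℝ} (hr : 1 / 2 < r) {F G : ℝ → ℝ≥0∞}
    (hF : Measurable F) (hG : Measurable G) :
    ∫⁻ ξ, (∫⁻ η, ENNReal.ofReal (weight 0 r ξ * weight 0 (-r) η * weight 0 (-r) (ξ - η)) *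
        (F η * G (ξ - η))) ^ 2 ≤
      ENNReal.ofReal (4 ^ r) * (2 * ∫⁻ η, ENNReal.ofReal (weight 0 (-(2 * r)) η)) *
        ((∫⁻ η, F η ^ 2) * ∫⁻ η, G η ^ 2) := by
  set M := ∫⁻ η, ENNReal.ofReal (weight 0 (-(2 * r)) η)
  have hw := fun q => (continuous_weight 0 q).measurable
  have hin : ∀ ξ, (∫⁻ η, ENNReal.ofReal (weight 0 r ξ * weight 0 (-r) η * weight 0 (-r) (ξ - η)) *
        (F η * G (ξ - η))) ^ 2 ≤
      ENNReal.ofReal (4 ^ r) * (2 * M) * ∫⁻ η, F η ^ 2 * G (ξ - η) ^ 2 := by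
    intro ξ
    have hK : Measurable fun η =>
        ENNReal.ofReal (weight 0 r ξ * weight 0 (-r) η * weight 0 (-r) (ξ - η)) :=
      (((hw _).const_mul _).mul ((hw _).comp (measurable_const.sub measurable_id))).ennreal_ofReal
    have hH : Measurable fun η => F η * G (ξ - η) :=
      hF.mul (hG.comp (measurable_const.sub measurable_id))
    have cs := ENNReal.lintegral_mul_le_Lp_mul_Lq volume Real.HolderConjugate.two_two
      hK.aemeasurable hH.aemeasurable
    simp only [Pi.mul_apply, ENNReal.rpow_ofNat] at cs
    have hsq : ∀ x : ℝ≥0∞, (x ^ (1 / 2 : ℝ)) ^ 2 = x := fun x => by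
      rw [← ENNReal.rpow_natCast, ← ENNReal.rpow_mul]; norm_num
    refine (pow_le_pow_left' cs 2).trans ?_
    rw [mul_pow, hsq, hsq]
    gcongr
    · calc _ ≤ ∫⁻ η, ENNReal.ofReal (4 ^ r) * (ENNReal.ofReal (weight 0 (-(2 * r)) η) +
            ENNReal.ofReal (weight 0 (-(2 * r)) (ξ - η))) := by
            refine lintegral_mono fun η => ?_
            rw [← ENNReal.ofReal_pow, ← ENNReal.ofReal_add, ← ENNReal.ofReal_mul]
            · exact ENNReal.ofReal_le_ofReal (weight_kernel_sq_le (by linarith) ξ η)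
            · positivity
            · exact (weight_pos _ _ _).le
            · exact (weight_pos _ _ _).le
            · have h1 := weight_pos 0 r ξ
              have h2 := weight_pos 0 (-r) η
              have h3 := weight_pos 0 (-r) (ξ - η)
              positivity
        _ = _ := by
            rw [lintegral_const_mul' _ _ (by finiteness),
              lintegral_add_left (hw _).ennreal_ofReal,
              lintegral_sub_left_eq_self (fun η => ENNReal.ofReal (weight 0 (-(2 * r)) η)) ξ,
              ← two_mul]
    · exact (mul_pow _ _ _).le
  refine (lintegral_mono hin).trans ?_
  have hm : Measurable (Function.uncurry fun ξ η => F η ^ 2 * G (ξ - η) ^ 2) :=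
    ((hF.comp measurable_snd).pow_const _).mul
      ((hG.comp (measurable_fst.sub measurable_snd)).pow_const _)
  have hm2 : Measurable fun ξ => ∫⁻ η, F η ^ 2 * G (ξ - η) ^ 2 := hm.lintegral_prod_right'
  rw [lintegral_const_mul _ hm2, lintegral_lintegral_swap hm.aemeasurable]
  gcongr
  refine le_of_eq ?_
  rw [← lintegral_mul_const _ (hF.pow_const 2)]
  refine lintegral_congr fun η => ?_
  have hGm : Measurable fun ξ => G (ξ - η) ^ 2 :=
    (hG.comp (measurable_id.sub measurable_const)).pow_const 2
  rw [lintegral_const_mul _ hGm, lintegral_sub_right_eq_self (fun ξ => G ξ ^ 2) η]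

lemma L2C_enorm_sq (f : L2C) : ‖f‖ₑ ^ 2 = ∫⁻ x, ‖f x‖ₑ ^ 2 := by
  rw [Lp.enorm_def, eLpNorm_eq_lintegral_rpow_enorm_toReal (by norm_num) (by norm_num)]
  simp only [ENNReal.toReal_ofNat, ENNReal.rpow_ofNat]
  rw [← ENNReal.rpow_natCast, ← ENNReal.rpow_mul]; norm_num

lemma memLp_two_weight {q : ℝ} (hq : q < -1 / 2) : MemLp (weightC 0 q) 2 := by
  refine (memLp_two_iff_integrable_sq_norm
    (hasTemperateGrowth_weightC 0 q).1.continuous.aestronglyMeasurable).2 ?_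
  have : (fun x => ‖weightC 0 q x‖ ^ 2) = weight 0 (q + q) := by
    ext x; rw [norm_weightC, sq, weight_mul, add_zero]
  rw [this]
  exact integrable_weight (by linarith)

/-- The algebra property of `H^r`, `r > 1/2`, in terms of Bessel potentials of `L²` functions. -/
lemma exists_product {r : ℝ} (hr : 1 / 2 < r) : ∃ C : ℝ, 0 ≤ C ∧ ∀ f g : L2C, ∃ h : L2C,
    ‖h‖ ≤ C * ‖f‖ * ‖g‖ ∧ fmul (W 0 (-r)) h =ᵐ[volume]
      fun x => fmul (W 0 (-r)) f x * fmul (W 0 (-r)) g x := by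
  have hr0 : (0 : ℝ) + -r ≤ 0 := by linarith
  set K : ℝ≥0∞ := ENNReal.ofReal (4 ^ r) * (2 * ∫⁻ η, ENNReal.ofReal (weight 0 (-(2 * r)) η))
    with hKdef
  have hK : K ≠ ∞ := by
    refine ENNReal.mul_ne_top (by finiteness) (ENNReal.mul_ne_top (by finiteness) ?_)
    have := (integrable_weight (q := -(2 * r)) (by linarith)).lintegral_lt_top
    exact this.ne
  refine ⟨√K.toReal, Real.sqrt_nonneg _, fun f g => ?_⟩
  set F : L2C := 𝓕 f with hF
  set G : L2C := 𝓕 g with hG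
  set fh : ℝ → ℂ := fun ξ => weightC 0 (-r) ξ * F ξ
  set gh : ℝ → ℂ := fun ξ => weightC 0 (-r) ξ * G ξ
  have hw := memLp_two_weight (q := -r) (by linarith)
  have fh1 : Integrable fh := hw.integrable_mul (Lp.memLp F)
  have gh1 : Integrable gh := hw.integrable_mul (Lp.memLp G)
  have aeF : mulSym (W 0 (-r)) F =ᵐ[volume] fh := by
    filter_upwards [coeFn_mulSym (W 0 (-r)) F] with ξ h
    rw [h, coe_W hr0]
  have aeG : mulSym (W 0 (-r)) G =ᵐ[volume] gh := by
    filter_upwards [coeFn_mulSym (W 0 (-r)) G] with ξ h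
    rw [h, coe_W hr0]
  have fh2 : MemLp fh 2 := (memLp_congr_ae aeF).1 (Lp.memLp _)
  have gh2 : MemLp gh 2 := (memLp_congr_ae aeG).1 (Lp.memLp _)
  have ef : fmul (W 0 (-r)) f =ᵐ[volume] (𝓕⁻ fh : ℝ → ℂ) := by
    refine EventuallyEq.trans ?_ (coeFn_fourierInv_toLp fh1 fh2)
    have : mulSym (W 0 (-r)) F = fh2.toLp fh := Lp.ext (aeF.trans fh2.coeFn_toLp.symm)
    rw [fmul_apply, ← hF, this]
  have eg : fmul (W 0 (-r)) g =ᵐ[volume] (𝓕⁻ gh : ℝ → ℂ) := by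
    refine EventuallyEq.trans ?_ (coeFn_fourierInv_toLp gh1 gh2)
    have : mulSym (W 0 (-r)) G = gh2.toLp gh := Lp.ext (aeG.trans gh2.coeFn_toLp.symm)
    rw [fmul_apply, ← hG, this]
  set k : ℝ → ℂ := fh ⋆[ContinuousLinearMap.mul ℂ ℂ] gh with hk
  have k1 : Integrable k := fh1.integrable_convolution _ gh1
  have ek : ∀ x, (𝓕⁻ k : ℝ → ℂ) x = (𝓕⁻ fh : ℝ → ℂ) x * (𝓕⁻ gh : ℝ → ℂ) x := fun x => by
    simp only [Real.fourierInv_eq_fourier_neg]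
    exact Real.fourier_mul_convolution_eq fh1 gh1 (-x)
  set h : ℝ → ℂ := fun ξ => weightC 0 r ξ * k ξ with hh
  have hm : AEStronglyMeasurable h volume :=
    (hasTemperateGrowth_weightC 0 r).1.continuous.aestronglyMeasurable.mul k1.1
  have hb : ∫⁻ ξ, ‖h ξ‖ₑ ^ 2 ≤ K * (‖F‖ₑ ^ 2 * ‖G‖ₑ ^ 2) := by
    rw [L2C_enorm_sq, L2C_enorm_sq]
    refine le_trans (lintegral_mono fun ξ => ?_) (lintegral_weighted_convolution_sq_le hr
      (Lp.stronglyMeasurable F).measurable.enorm (Lp.stronglyMeasurable G).measurable.enorm)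
    refine pow_le_pow_left' ?_ 2
    simp only [hh, hk, MeasureTheory.convolution, enorm_mul]
    refine (mul_le_mul_right (enorm_integral_le_lintegral_enorm _) _).trans ?_
    rw [← lintegral_const_mul' _ _ (by finiteness)]
    refine lintegral_mono fun η => le_of_eq ?_
    have hn : ∀ q x, ‖weightC 0 q x‖ₑ = ENNReal.ofReal (weight 0 q x) := fun q x => by
      rw [← ofReal_norm, norm_weightC]
    simp only [fh, gh, ContinuousLinearMap.mul_apply', enorm_mul, hn]
    rw [ENNReal.ofReal_mul (mul_nonneg (weight_pos _ _ _).le (weight_pos _ _ _).le),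
      ENNReal.ofReal_mul (weight_pos _ _ _).le]
    ring
  have h2 : MemLp h 2 := by
    refine ⟨hm, ?_⟩
    rw [eLpNorm_lt_top_iff_lintegral_rpow_enorm_lt_top (by norm_num) (by norm_num)]
    simp only [ENNReal.toReal_ofNat, ENNReal.rpow_ofNat]
    refine hb.trans_lt (ENNReal.mul_lt_top hK.lt_top ?_)
    exact ENNReal.mul_lt_top (by finiteness) (by finiteness)
  have aek : mulSym (W 0 (-r)) (h2.toLp h) =ᵐ[volume] k := by
    filter_upwards [coeFn_mulSym (W 0 (-r)) (h2.toLp h), h2.coeFn_toLp] with ξ h3 h4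
    rw [h3, h4, W_apply hr0]
    simp only [hh, weightC]
    rw [← mul_assoc, ← Complex.ofReal_mul, weight_mul]
    simp [weight_zero_zero]
  have k2 : MemLp k 2 := (memLp_congr_ae aek).1 (Lp.memLp _)
  refine ⟨𝓕⁻ (h2.toLp h), ?_, ?_⟩
  · rw [norm_fourierInv_L2, ← Lp.norm_fourier_eq f, ← Lp.norm_fourier_eq g, ← hF, ← hG]
    have h3 : ‖h2.toLp h‖ₑ ^ 2 ≤ K * (‖F‖ₑ ^ 2 * ‖G‖ₑ ^ 2) := by
      rw [L2C_enorm_sq]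
      refine le_trans (le_of_eq ?_) hb
      apply lintegral_congr_ae
      filter_upwards [h2.coeFn_toLp] with ξ h3
      rw [h3]
    have h4 := ENNReal.toReal_mono (by finiteness) h3
    simp only [ENNReal.toReal_mul, ENNReal.toReal_pow, toReal_enorm] at h4
    refine abs_le_of_sq_le_sq' ?_ (by positivity) |>.2
    rw [mul_pow, mul_pow, Real.sq_sqrt ENNReal.toReal_nonneg, mul_assoc]
    exact h4
  · have e1 : fmul (W 0 (-r)) (𝓕⁻ (h2.toLp h) : L2C) = 𝓕⁻ (k2.toLp k) := by
      rw [fmul_apply, fourier_fourierInv_eq]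
      congr 1
      exact Lp.ext (aek.trans k2.coeFn_toLp.symm)
    rw [e1]
    filter_upwards [coeFn_fourierInv_toLp k1 k2, ef, eg] with x h3 h4 h5
    rw [h3, h4, h5, ek]

/-- Half-open time intervals starting at `0`, bounded or not. -/
structure TimeInterval (I : Set ℝ) : Prop where
  zero_mem : (0 : ℝ) ∈ I
  nonneg : ∀ t ∈ I, 0 ≤ t
  Icc_subset : ∀ t ∈ I, Icc 0 t ⊆ I
  exists_gt : ∀ t ∈ I, ∃ t' ∈ I, t < t'

lemma timeInterval_Ico {T : ℝ} (hT : 0 < T) : TimeInterval (Ico 0 T) where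
  zero_mem := ⟨le_rfl, hT⟩
  nonneg := fun t ht => ht.1
  Icc_subset := fun t ht s hs => ⟨hs.1, hs.2.trans_lt ht.2⟩
  exists_gt := fun t ht => by
    obtain ⟨t', h1, h2⟩ := exists_between ht.2
    exact ⟨t', ⟨ht.1.trans h1.le, h2⟩, h1⟩

lemma timeInterval_Ici : TimeInterval (Ici 0) where
  zero_mem := self_mem_Ici
  nonneg := fun t ht => ht
  Icc_subset := fun _ _ => Icc_subset_Ici_self
  exists_gt := fun t ht => ⟨t + 1, by simp only [mem_Ici] at *; linarith, by linarith⟩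

section

variable {E : Type*} [NormedAddCommGroup E] [NormedSpace ℝ E] {I : Set ℝ}

lemma TimeInterval.Icc_mem_nhdsWithin (hI : TimeInterval I) {t t' : ℝ} (h : t < t') :
    Icc 0 t' ∈ 𝓝[I] t := by
  filter_upwards [self_mem_nhdsWithin, mem_nhdsWithin_of_mem_nhds (Iio_mem_nhds h)] with s hs hs'
  exact ⟨hI.nonneg s hs, le_of_lt hs'⟩

lemma TimeInterval.Ici_mem_nhdsWithin (hI : TimeInterval I) {t : ℝ} (ht : t ∈ I) :
    I ∈ 𝓝[Ici t] t := by
  obtain ⟨t', ht', h⟩ := hI.exists_gt t ht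
  filter_upwards [self_mem_nhdsWithin, mem_nhdsWithin_of_mem_nhds (Iio_mem_nhds h)] with s hs hs'
  exact hI.Icc_subset t' ht' ⟨(hI.nonneg t ht).trans hs, le_of_lt hs'⟩

lemma TimeInterval.hasDerivWithinAt_Ici (hI : TimeInterval I) {t : ℝ} (ht : t ∈ I) {f : ℝ → E}
    {f' : E} (h : HasDerivWithinAt f f' I t) : HasDerivWithinAt f f' (Ici t) t :=
  h.mono_of_mem_nhdsWithin (hI.Ici_mem_nhdsWithin ht)

lemma TimeInterval.hasDerivWithinAt_primitive [CompleteSpace E] (hI : TimeInterval I) {g : ℝ → E}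
    (hg : ContinuousOn g I) {t : ℝ} (ht : t ∈ I) :
    HasDerivWithinAt (fun t => ∫ s in (0 : ℝ)..t, g s) (g t) I t := by
  obtain ⟨t', ht', h⟩ := hI.exists_gt t ht
  have h0 := hI.nonneg t ht
  have hc : ContinuousOn g (Icc 0 t') := hg.mono (hI.Icc_subset t' ht')
  have hm : t ∈ Icc 0 t' := ⟨h0, h.le⟩
  have : Fact (t ∈ Icc 0 t') := ⟨hm⟩
  have key : HasDerivWithinAt (fun t => ∫ s in (0 : ℝ)..t, g s) (g t) (Icc 0 t') t := by
    refine intervalIntegral.integral_hasDerivWithinAt_right ?_ ?_ (hc t hm)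
    · refine ContinuousOn.intervalIntegrable (hc.mono ?_)
      rw [uIcc_of_le h0]
      exact Icc_subset_Icc_right h.le
    · exact hc.stronglyMeasurableAtFilter_nhdsWithin measurableSet_Icc t
  exact key.mono_of_mem_nhdsWithin (hI.Icc_mem_nhdsWithin h)

lemma TimeInterval.eq_zero_of_hasDerivWithinAt_zero (hI : TimeInterval I) {f : ℝ → E}
    (hf : ∀ t ∈ I, HasDerivWithinAt f 0 I t) {t : ℝ} (ht : t ∈ I) : f t = f 0 := by
  have hs := hI.Icc_subset t ht
  refine constant_of_has_deriv_right_zero (a := 0) (b := t) (f := f) ?_ ?_ t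
    ⟨hI.nonneg t ht, le_rfl⟩
  · exact fun s hs' => ((hf s (hs hs')).continuousWithinAt).mono hs
  · intro s hs'
    exact hI.hasDerivWithinAt_Ici (hs ⟨hs'.1, hs'.2.le⟩) (hf s (hs ⟨hs'.1, hs'.2.le⟩))

lemma TimeInterval.eq_of_hasDerivWithinAt_eq (hI : TimeInterval I) {f g f' : ℝ → E}
    (hf : ∀ t ∈ I, HasDerivWithinAt f (f' t) I t) (hg : ∀ t ∈ I, HasDerivWithinAt g (f' t) I t)
    (h0 : f 0 = g 0) {t : ℝ} (ht : t ∈ I) : f t = g t := by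
  have := hI.eq_zero_of_hasDerivWithinAt_zero (f := f - g)
    (fun s hs => by simpa using (hf s hs).sub (hg s hs)) ht
  rw [Pi.sub_apply, Pi.sub_apply, h0, sub_self] at this
  exact sub_eq_zero.1 this

lemma TimeInterval.uniqueDiffWithinAt (hI : TimeInterval I) {t : ℝ} (ht : t ∈ I) :
    UniqueDiffWithinAt ℝ I t :=
  (uniqueDiffWithinAt_Ici t).mono_nhds (nhdsWithin_le_iff.2 (hI.Ici_mem_nhdsWithin ht))

/-- `y` solves `y' = g(t, y)` on `I`. -/
def IsODESol (g : ℝ → E → E) (I : Set ℝ) (y : ℝ → E) : Prop :=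
  ∀ t ∈ I, HasDerivWithinAt y (g t (y t)) I t

/-- Vector fields that are continuous in time, and bounded and Lipschitz continuous on balls,
uniformly in time. -/
structure LocLip (g : ℝ → E → E) : Prop where
  cont : ∀ x, Continuous fun t => g t x
  lip : ∀ R : ℝ, ∃ K : ℝ≥0, ∀ t, LipschitzOnWith K (g t) (Metric.closedBall 0 R)
  bdd : ∀ R : ℝ, ∃ L : ℝ≥0, ∀ t, ∀ x ∈ Metric.closedBall (0 : E) R, ‖g t x‖ ≤ L

lemma IsODESol.continuousOn {g : ℝ → E → E} {y : ℝ → E} (hy : IsODESol g I y) :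
    ContinuousOn y I := fun t ht => (hy t ht).continuousWithinAt

lemma IsODESol.mono {g : ℝ → E → E} {y : ℝ → E} {J : Set ℝ} (hy : IsODESol g I y) (hJ : J ⊆ I) :
    IsODESol g J y := fun t ht => (hy t (hJ ht)).mono hJ

lemma IsODESol.unique {g : ℝ → E → E} (hg : LocLip g) (hI : TimeInterval I) {y z : ℝ → E}
    (hy : IsODESol g I y) (hz : IsODESol g I z) (h0 : y 0 = z 0) {t : ℝ} (ht : t ∈ I) :
    y t = z t := by
  have hs := hI.Icc_subset t ht
  have hyc := hy.continuousOn.mono hs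
  have hzc := hz.continuousOn.mono hs
  obtain ⟨R₁, h₁⟩ := (isCompact_Icc.image_of_continuousOn hyc).isBounded.subset_closedBall 0
  obtain ⟨R₂, h₂⟩ := (isCompact_Icc.image_of_continuousOn hzc).isBounded.subset_closedBall 0
  obtain ⟨K, hK⟩ := hg.lip (max R₁ R₂)
  refine ODE_solution_unique_of_mem_Icc_right (v := g) (K := K)
    (s := fun _ => Metric.closedBall 0 (max R₁ R₂)) (a := 0) (b := t) (fun s _ => hK s) hyc ?_ ?_
    hzc ?_ ?_ h0 ⟨hI.nonneg t ht, le_rfl⟩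
  · exact fun s hs' => hI.hasDerivWithinAt_Ici (hs ⟨hs'.1, hs'.2.le⟩) (hy s (hs ⟨hs'.1, hs'.2.le⟩))
  · exact fun s hs' => Metric.closedBall_subset_closedBall (le_max_left _ _)
      (h₁ ⟨s, ⟨hs'.1, hs'.2.le⟩, rfl⟩)
  · exact fun s hs' => hI.hasDerivWithinAt_Ici (hs ⟨hs'.1, hs'.2.le⟩) (hz s (hs ⟨hs'.1, hs'.2.le⟩))
  · exact fun s hs' => Metric.closedBall_subset_closedBall (le_max_right _ _)
      (h₂ ⟨s, ⟨hs'.1, hs'.2.le⟩, rfl⟩)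

lemma LocLip.exists_local [CompleteSpace E] {g : ℝ → E → E} (hg : LocLip g) (R : ℝ) :
    ∃ τ > 0, ∀ t₀, ∀ x₀ : E, ‖x₀‖ ≤ R → ∃ α : ℝ → E, α t₀ = x₀ ∧
      IsODESol g (Icc t₀ (t₀ + τ)) α := by
  obtain ⟨K, hK⟩ := hg.lip (R + 1)
  obtain ⟨L, hL⟩ := hg.bdd (R + 1)
  refine ⟨1 / (L + 1), by positivity, fun t₀ x₀ hx₀ => ?_⟩
  have hτ : 0 < 1 / ((L : ℝ) + 1) := by positivity
  have hsub : Metric.closedBall x₀ ((1 : ℝ≥0) : ℝ) ⊆ Metric.closedBall 0 (R + 1) := by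
    refine Metric.closedBall_subset_closedBall' ?_
    rw [dist_zero_right]; push_cast; linarith
  have hp : IsPicardLindelof g (tmin := t₀) (tmax := t₀ + 1 / (L + 1)) ⟨t₀, ⟨le_rfl, by linarith⟩⟩ x₀ 1 0
      L K :=
    { lipschitzOnWith := fun t _ => (hK t).mono hsub
      continuousOn := fun x _ => (hg.cont x).continuousOn
      norm_le := fun t _ x hx => hL t x (hsub hx)
      mul_max_le := by
        simp only [add_sub_cancel_left, sub_self, max_eq_left hτ.le]
        rw [mul_one_div, NNReal.coe_one, NNReal.coe_zero, sub_zero, div_le_one (by positivity)]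
        linarith }
  obtain ⟨α, h1, h2⟩ := hp.exists_eq_forall_mem_Icc_hasDerivWithinAt₀
  exact ⟨α, h1, h2⟩

lemma IsODESol.extend {g : ℝ → E → E} {T t₁ τ : ℝ} {y α : ℝ → E} (hy : IsODESol g (Ico 0 T) y)
    (ht₁ : t₁ ∈ Ico 0 T) (hα : IsODESol g (Icc t₁ (t₁ + τ)) α) (h : α t₁ = y t₁) (hτ : 0 < τ) :
    ∃ z : ℝ → E, z 0 = y 0 ∧ IsODESol g (Ico 0 (t₁ + τ)) z := by
  classical
  set z : ℝ → E := fun t => if t ≤ t₁ then y t else α t with hz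
  have e1 : ∀ t ≤ t₁, z t = y t := fun t ht => if_pos ht
  have e2 : ∀ t, t₁ ≤ t → z t = α t := fun t ht => by
    rcases ht.eq_or_lt with rfl | h'
    · rw [e1 _ le_rfl, h]
    · exact if_neg h'.not_ge
  refine ⟨z, e1 0 ht₁.1, fun t ht => ?_⟩
  have d1 : ∀ t ∈ Icc 0 t₁, HasDerivWithinAt z (g t (z t)) (Icc 0 t₁) t := fun t ht => by
    rw [e1 t ht.2]
    exact ((hy t ⟨ht.1, ht.2.trans_lt ht₁.2⟩).mono
      (fun s hs => ⟨hs.1, hs.2.trans_lt ht₁.2⟩)).congr (fun s hs => e1 s hs.2) (e1 t ht.2)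
  have d2 : ∀ t ∈ Icc t₁ (t₁ + τ), HasDerivWithinAt z (g t (z t)) (Icc t₁ (t₁ + τ)) t :=
    fun t ht => by
      rw [e2 t ht.1]
      exact (hα t ht).congr (fun s hs => e2 s hs.1) (e2 t ht.1)
  rcases lt_trichotomy t t₁ with h1 | h1 | h1
  · refine (d1 t ⟨ht.1, h1.le⟩).mono_of_mem_nhdsWithin ?_
    filter_upwards [self_mem_nhdsWithin, mem_nhdsWithin_of_mem_nhds (Iio_mem_nhds h1)] with s hs hs'
    exact ⟨hs.1, le_of_lt hs'⟩
  · refine ((d1 t ⟨ht.1, h1.le⟩).union (d2 t ⟨h1.ge, by linarith⟩)).mono fun s hs => ?_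
    rcases le_total s t₁ with h2 | h2
    · exact Or.inl ⟨hs.1, h2⟩
    · exact Or.inr ⟨h2, hs.2.le⟩
  · refine (d2 t ⟨h1.le, ht.2.le⟩).mono_of_mem_nhdsWithin ?_
    filter_upwards [self_mem_nhdsWithin, mem_nhdsWithin_of_mem_nhds (Ioi_mem_nhds h1)] with s hs hs'
    exact ⟨le_of_lt hs', hs.2.le⟩

/-- Maximal solutions: a global one, or one whose norm tends to infinity in finite time. -/
theorem LocLip.exists_maximal [CompleteSpace E] {g : ℝ → E → E} (hg : LocLip g) (x₀ : E) :
    ∃ y : ℝ → E, y 0 = x₀ ∧ (IsODESol g (Ici 0) y ∨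
      ∃ T > 0, IsODESol g (Ico 0 T) y ∧ Tendsto (fun t => ‖y t‖) (𝓝[<] T) atTop) := by
  classical
  set S : Set ℝ := {T | 0 < T ∧ ∃ y : ℝ → E, y 0 = x₀ ∧ IsODESol g (Ico 0 T) y} with hS
  have hne : S.Nonempty := by
    obtain ⟨τ, hτ, h⟩ := hg.exists_local ‖x₀‖
    obtain ⟨α, h1, h2⟩ := h 0 x₀ le_rfl
    rw [zero_add] at h2
    exact ⟨τ, hτ, α, h1, h2.mono Ico_subset_Icc_self⟩
  have hpos : ∀ T ∈ S, 0 < T := fun T hT => hT.1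
  choose! sol sol0 hsol using fun T (hT : T ∈ S) => hT.2
  set y : ℝ → E := fun t => if h : ∃ T ∈ S, t < T then sol h.choose t else x₀ with hy
  have hys : ∀ T ∈ S, ∀ t ∈ Ico 0 T, y t = sol T t := by
    intro T hT t ht
    have h : ∃ T ∈ S, t < T := ⟨T, hT, ht.2⟩
    rw [hy]
    simp only [dif_pos h]
    obtain ⟨h1, h2⟩ := h.choose_spec
    set T' := h.choose
    refine IsODESol.unique hg (timeInterval_Ico (lt_min (hpos T hT) (hpos T' h1)))
      ((hsol T' h1).mono (Ico_subset_Ico_right (min_le_right _ _)))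
      ((hsol T hT).mono (Ico_subset_Ico_right (min_le_left _ _))) ?_ ⟨ht.1, lt_min ht.2 h2⟩
    rw [sol0 _ h1, sol0 T hT]
  have hder : ∀ T ∈ S, IsODESol g (Ico 0 T) y := fun T hT t ht => by
    rw [hys T hT t ht]
    exact (hsol T hT t ht).congr (fun s hs => hys T hT s hs) (hys T hT t ht)
  obtain ⟨T₀, hT₀⟩ := hne
  refine ⟨y, by rw [hys T₀ hT₀ 0 ⟨le_rfl, hpos T₀ hT₀⟩, sol0 T₀ hT₀], ?_⟩
  by_cases hb : BddAbove S
  · right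
    have hsup : ∀ T ∈ S, T ≤ sSup S := fun T hT => le_csSup hb hT
    have hT0 : 0 < sSup S := (hpos T₀ hT₀).trans_le (hsup T₀ hT₀)
    have hsolT : IsODESol g (Ico 0 (sSup S)) y := fun t ht => by
      obtain ⟨T, hT, h⟩ := exists_lt_of_lt_csSup ⟨T₀, hT₀⟩ ht.2
      refine (hder T hT t ⟨ht.1, h⟩).mono_of_mem_nhdsWithin ?_
      filter_upwards [self_mem_nhdsWithin, mem_nhdsWithin_of_mem_nhds (Iio_mem_nhds h)]
        with s hs hs'
      exact ⟨hs.1, hs'⟩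
    refine ⟨sSup S, hT0, hsolT, ?_⟩
    rw [tendsto_atTop]
    intro R
    by_contra hcon
    obtain ⟨τ, hτ, hloc⟩ := hg.exists_local R
    have hf : ∃ᶠ t in 𝓝[<] (sSup S), ‖y t‖ < R := by
      rw [not_eventually] at hcon
      exact hcon.mono fun t ht => not_le.1 ht
    have hev : ∀ᶠ t in 𝓝[<] (sSup S), t ∈ Ioo (max 0 (sSup S - τ)) (sSup S) :=
      Ioo_mem_nhdsLT (max_lt hT0 (by linarith))
    obtain ⟨t₁, h1, h2⟩ := (hf.and_eventually hev).exists
    obtain ⟨α, h3, h4⟩ := hloc t₁ (y t₁) h1.le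
    have h5 : t₁ ∈ Ico 0 (sSup S) := ⟨(le_max_left _ _).trans h2.1.le, h2.2⟩
    obtain ⟨z, hz0, hz⟩ := hsolT.extend h5 h4 h3 hτ
    have h6 : t₁ + τ ∈ S := ⟨by linarith [h5.1], z, by
      rw [hz0, hys T₀ hT₀ 0 ⟨le_rfl, hpos T₀ hT₀⟩, sol0 T₀ hT₀], hz⟩
    have h7 := hsup _ h6
    have h8 := (le_max_right 0 (sSup S - τ)).trans_lt h2.1
    linarith
  · left
    intro t ht
    obtain ⟨T, hT, h⟩ := not_bddAbove_iff.1 hb t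
    refine (hder T hT t ⟨ht, h⟩).mono_of_mem_nhdsWithin ?_
    filter_upwards [self_mem_nhdsWithin, mem_nhdsWithin_of_mem_nhds (Iio_mem_nhds h)] with s hs hs'
    exact ⟨hs, hs'⟩

end

/-- The Bessel potential of order `-r` on real `L²` functions. -/
def bes (r : ℝ) : L2 →L[ℝ] L2 := rmul (W 0 (-r))

lemma bes_injective {r : ℝ} (hr : 0 ≤ r) : Function.Injective (bes r) :=
  rmul_injective (herm_W _ _) (W_ne_zero (by linarith))

lemma toC_bes (r : ℝ) (f : L2) : toC (bes r f) = fmul (W 0 (-r)) (toC f) := toC_rmul (herm_W _ _) f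

lemma exists_bilinear_product {r : ℝ} (hr : 1 / 2 < r) : ∃ β : L2 →L[ℝ] L2 →L[ℝ] L2,
    ∀ U V : L2, bes r (β U V) =ᵐ[volume] fun x => bes r U x * bes r V x := by
  obtain ⟨C, hC0, hC⟩ := exists_product hr
  choose h hn hae using hC
  set b : L2 → L2 → L2 := fun U V => reL (h (toC U) (toC V)) with hb
  have key : ∀ U V : L2, bes r (b U V) =ᵐ[volume] fun x => bes r U x * bes r V x := by
    intro U V
    have e1 : bes r (b U V) = reL (fmul (W 0 (-r)) (h (toC U) (toC V))) :=
      (reL_fmul (herm_W _ _) _).symm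
    rw [e1]
    filter_upwards [coeFn_reL (fmul (W 0 (-r)) (h (toC U) (toC V))), hae (toC U) (toC V),
      coeFn_toC (bes r U), coeFn_toC (bes r V)] with x h1 h2 h3 h4
    rw [h1, h2, ← toC_bes, ← toC_bes, h3, h4]
    simp
  have hinj : ∀ {f g : L2}, bes r f =ᵐ[volume] bes r g → f = g := fun hfg =>
    bes_injective (by linarith) (Lp.ext hfg)
  refine ⟨LinearMap.mkContinuous₂ (LinearMap.mk₂ ℝ b ?_ ?_ ?_ ?_) C ?_, key⟩
  · intro U U' V
    apply hinj
    rw [map_add]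
    filter_upwards [key (U + U') V, key U V, key U' V, Lp.coeFn_add (bes r (b U V)) (bes r (b U' V)),
      Lp.coeFn_add (bes r U) (bes r U')] with x h1 h2 h3 h4 h5
    rw [h1, h4, Pi.add_apply, h2, h3, map_add, h5, Pi.add_apply]; ring
  · intro k U V
    apply hinj
    rw [map_smul]
    filter_upwards [key (k • U) V, key U V, Lp.coeFn_smul k (bes r (b U V)),
      Lp.coeFn_smul k (bes r U)] with x h1 h2 h4 h5
    rw [h1, h4, Pi.smul_apply, h2, map_smul, h5, Pi.smul_apply, smul_eq_mul, smul_eq_mul]; ring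
  · intro U V V'
    apply hinj
    rw [map_add]
    filter_upwards [key U (V + V'), key U V, key U V', Lp.coeFn_add (bes r (b U V)) (bes r (b U V')),
      Lp.coeFn_add (bes r V) (bes r V')] with x h1 h2 h3 h4 h5
    rw [h1, h4, Pi.add_apply, h2, h3, map_add, h5, Pi.add_apply]; ring
  · intro k U V
    apply hinj
    rw [map_smul]
    filter_upwards [key U (k • V), key U V, Lp.coeFn_smul k (bes r (b U V)),
      Lp.coeFn_smul k (bes r V)] with x h1 h2 h4 h5
    rw [h1, h4, Pi.smul_apply, h2, map_smul, h5, Pi.smul_apply, smul_eq_mul, smul_eq_mul]; ring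
  · intro U V
    refine (norm_reL_le _).trans ((hn _ _).trans_eq ?_)
    rw [norm_toC, norm_toC]

/-- The pointwise product, conjugated by the Bessel potential of order `-r`. -/
def prodB (r : ℝ) : L2 →L[ℝ] L2 →L[ℝ] L2 := by
  classical
  exact if hr : 1 / 2 < r then (exists_bilinear_product hr).choose else 0

lemma bes_prodB {r : ℝ} (hr : 1 / 2 < r) (U V : L2) :
    bes r (prodB r U V) =ᵐ[volume] fun x => bes r U x * bes r V x := by
  rw [prodB, dif_pos hr]
  exact (exists_bilinear_product hr).choose_spec U V

/-- The quadratic form `a u² + 2 b u v + d v²`, conjugated by the Bessel potential. -/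
def quad (r a b d : ℝ) (U V : L2) : L2 :=
  a • prodB r U U + (2 * b) • prodB r U V + d • prodB r V V

lemma bes_quad {r : ℝ} (hr : 1 / 2 < r) (a b d : ℝ) (U V : L2) :
    bes r (quad r a b d U V) =ᵐ[volume] fun x =>
      a * (bes r U x * bes r U x) + 2 * b * (bes r U x * bes r V x)
        + d * (bes r V x * bes r V x) := by
  rw [quad, map_add, map_add, map_smul, map_smul, map_smul]
  filter_upwards [bes_prodB hr U U, bes_prodB hr U V, bes_prodB hr V V,
    Lp.coeFn_add (a • bes r (prodB r U U) + (2 * b) • bes r (prodB r U V))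
      (d • bes r (prodB r V V)),
    Lp.coeFn_add (a • bes r (prodB r U U)) ((2 * b) • bes r (prodB r U V)),
    Lp.coeFn_smul a (bes r (prodB r U U)), Lp.coeFn_smul (2 * b) (bes r (prodB r U V)),
    Lp.coeFn_smul d (bes r (prodB r V V))] with x h1 h2 h3 h4 h5 h6 h7 h8
  rw [h4, Pi.add_apply, h5, Pi.add_apply, h6, h7, h8]
  simp only [Pi.smul_apply, smul_eq_mul, h1, h2, h3]

lemma norm_bilin_sub_le (β : L2 →L[ℝ] L2 →L[ℝ] L2) {R δ : ℝ} {U V U' V' : L2} (hU : ‖U‖ ≤ R)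
    (hV' : ‖V'‖ ≤ R) (h1 : ‖U - U'‖ ≤ δ) (h2 : ‖V - V'‖ ≤ δ) :
    ‖β U V - β U' V'‖ ≤ ‖β‖ * (2 * R) * δ := by
  have hδ : 0 ≤ δ := (norm_nonneg _).trans h1
  have hR : 0 ≤ R := (norm_nonneg _).trans hU
  have e : β U V - β U' V' = β U (V - V') + β (U - U') V' := by simp
  rw [e]
  calc _ ≤ ‖β U (V - V')‖ + ‖β (U - U') V'‖ := norm_add_le _ _
    _ ≤ ‖β‖ * ‖U‖ * ‖V - V'‖ + ‖β‖ * ‖U - U'‖ * ‖V'‖ :=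
      add_le_add (β.le_opNorm₂ _ _) (β.le_opNorm₂ _ _)
    _ ≤ ‖β‖ * R * δ + ‖β‖ * δ * R := by gcongr
    _ = _ := by ring

lemma norm_quad_sub_le (r a b d : ℝ) {R δ : ℝ} {U V U' V' : L2} (hU : ‖U‖ ≤ R) (hV : ‖V‖ ≤ R)
    (hU' : ‖U'‖ ≤ R) (hV' : ‖V'‖ ≤ R) (h1 : ‖U - U'‖ ≤ δ) (h2 : ‖V - V'‖ ≤ δ) :
    ‖quad r a b d U V - quad r a b d U' V'‖ ≤
      (|a| + |2 * b| + |d|) * (‖prodB r‖ * (2 * R)) * δ := by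
  have e : quad r a b d U V - quad r a b d U' V' = a • (prodB r U U - prodB r U' U') +
      (2 * b) • (prodB r U V - prodB r U' V') + d • (prodB r V V - prodB r V' V') := by
    simp only [quad, smul_sub]; abel
  rw [e]
  refine (norm_add₃_le).trans ?_
  simp only [norm_smul, Real.norm_eq_abs]
  have b1 := norm_bilin_sub_le (prodB r) hU hU' h1 h1
  have b2 := norm_bilin_sub_le (prodB r) hU hV' h1 h2
  have b3 := norm_bilin_sub_le (prodB r) hV hV' h2 h2
  calc _ ≤ |a| * (‖prodB r‖ * (2 * R) * δ) + |2 * b| * (‖prodB r‖ * (2 * R) * δ) +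
      |d| * (‖prodB r‖ * (2 * R) * δ) := by gcongr
    _ = _ := by ring

lemma tendsto_bilin {X : Type*} {l : Filter X} (β : L2 →L[ℝ] L2 →L[ℝ] L2) {f g : X → L2}
    {U V : L2} (hf : Tendsto f l (𝓝 U)) (hg : Tendsto g l (𝓝 V)) :
    Tendsto (fun x => β (f x) (g x)) l (𝓝 (β U V)) :=
  (β.continuous₂.tendsto (U, V)).comp (hf.prodMk_nhds hg)

lemma tendsto_quad {X : Type*} {l : Filter X} (r a b d : ℝ) {f g : X → L2}
    {U V : L2} (hf : Tendsto f l (𝓝 U)) (hg : Tendsto g l (𝓝 V)) :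
    Tendsto (fun x => quad r a b d (f x) (g x)) l (𝓝 (quad r a b d U V)) :=
  (((tendsto_bilin _ hf hf).const_smul a).add ((tendsto_bilin _ hf hg).const_smul (2 * b))).add
    ((tendsto_bilin _ hg hg).const_smul d)

/-- The nonlinearity of the first equation, conjugated by the Bessel potential. -/
def nl₁ (c : Coeffs) (r : ℝ) (U V : L2) : L2 := quad r c.auu c.auv c.avv U V

/-- The nonlinearity of the second equation, conjugated by the Bessel potential. -/
def nl₂ (c : Coeffs) (r : ℝ) (U V : L2) : L2 := quad r c.buu c.buv c.bvv U V

lemma toDist_congr {p q : ℝ≥0∞} [Fact (1 ≤ p)] [Fact (1 ≤ q)] {f : Lp ℝ p (volume : Measure ℝ)}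
    {g : Lp ℝ q (volume : Measure ℝ)} (h : f =ᵐ[volume] g) : toDist f = toDist g := by
  ext φ
  simp only [toDist, Lp.toTemperedDistribution_apply]
  apply integral_congr_ae
  filter_upwards [h, ContinuousLinearMap.coeFn_compLp Complex.ofRealCLM f,
    ContinuousLinearMap.coeFn_compLp Complex.ofRealCLM g] with x h1 h2 h3
  rw [toComplex, toComplex, h2, h3, h1]

lemma coeFn_mul (f g : L2) : mul f g =ᵐ[volume] fun x => f x * g x := by
  filter_upwards [Lp.coeFn_lpSMul (r := 1) f g] with x h
  exact h

lemma coeFn_quad_mul (a b d : ℝ) (u v : L2) :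
    (a • mul u u + (2 * b) • mul u v + d • mul v v : Lp ℝ 1 (volume : Measure ℝ)) =ᵐ[volume]
      fun x => a * (u x * u x) + 2 * b * (u x * v x) + d * (v x * v x) := by
  filter_upwards [coeFn_mul u u, coeFn_mul u v, coeFn_mul v v,
    Lp.coeFn_add (a • mul u u + (2 * b) • mul u v) (d • mul v v),
    Lp.coeFn_add (a • mul u u) ((2 * b) • mul u v), Lp.coeFn_smul a (mul u u),
    Lp.coeFn_smul (2 * b) (mul u v), Lp.coeFn_smul d (mul v v)] with x h1 h2 h3 h4 h5 h6 h7 h8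
  rw [h4, Pi.add_apply, h5, Pi.add_apply, h6, h7, h8]
  simp only [Pi.smul_apply, smul_eq_mul, h1, h2, h3]

lemma toDist_f₁ {r : ℝ} (hr : 1 / 2 < r) (c : Coeffs) (U V : L2) :
    toDist (f₁ c (bes r U) (bes r V)) = toDist (bes r (nl₁ c r U V)) :=
  toDist_congr ((coeFn_quad_mul _ _ _ _ _).trans (bes_quad hr _ _ _ U V).symm)

lemma toDist_f₂ {r : ℝ} (hr : 1 / 2 < r) (c : Coeffs) (U V : L2) :
    toDist (f₂ c (bes r U) (bes r V)) = toDist (bes r (nl₂ c r U V)) :=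
  toDist_congr ((coeFn_quad_mul _ _ _ _ _).trans (bes_quad hr _ _ _ U V).symm)

/-- The state space of the evolution: `u`, `u_t` and the half-wave profile of `v`. -/
abbrev State : Type := L2 × L2 × L2C

/-- The (conjugated) second component `v` of a state. -/
def vOf (t : ℝ) (Y : L2C) : L2 := reL (fmul (wave (-t)) Y)

lemma norm_vOf_le (t : ℝ) (Y : L2C) : ‖vOf t Y‖ ≤ ‖Y‖ :=
  (norm_reL_le _).trans_eq (norm_fmul_wave _ _)

lemma vOf_sub (t : ℝ) (Y Y' : L2C) : vOf t (Y - Y') = vOf t Y - vOf t Y' := by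
  simp [vOf]

lemma continuous_vOf (Y : L2C) : Continuous fun t => vOf t Y := by
  refine reL.continuous.comp (continuous_iff_continuousAt.2 fun t => ?_)
  exact tendsto_fmul_wave (continuous_neg.tendsto t) tendsto_const_nhds

/-- The system as an ordinary differential equation: `u`, `u_t` and the profile `e^{itJ} Z` of
`Z = v + i J⁻¹ v_t`, all conjugated by a Bessel potential. -/
def field (c : Coeffs) (r t : ℝ) (y : State) : State :=
  (y.2.1, rmul D2 (c.α ^ 2 • y.1 + nl₁ c r y.1 (vOf t y.2.2)),
    Complex.I • fmul (wave t) (fmul (W (-1) 0) (toC (nl₂ c r y.1 (vOf t y.2.2)))))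

lemma norm_halfwave_forcing_le (t : ℝ) (F : L2) :
    ‖Complex.I • fmul (wave t) (fmul (W (-1) 0) (toC F))‖ ≤ weightBound (-1) * ‖F‖ := by
  rw [norm_smul, Complex.norm_I, one_mul, norm_fmul_wave, ← norm_toC F]
  exact norm_fmul_le_of_bound _ (norm_W_le (by norm_num)) _

lemma weightBound_nonneg (p : ℝ) : 0 ≤ weightBound p := by unfold weightBound; positivity

lemma norm_field_sub_le (c : Coeffs) (r : ℝ) {R : ℝ} : ∃ K : ℝ≥0, ∀ t, ∀ y y' : State,
    ‖y‖ ≤ R → ‖y'‖ ≤ R → ‖field c r t y - field c r t y'‖ ≤ K * ‖y - y'‖ := by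
  rcases lt_or_ge R 0 with hR | hR
  · exact ⟨0, fun t y y' hy => absurd hy (hR.trans_le (norm_nonneg _)).not_ge⟩
  set K₁ := (|c.auu| + |2 * c.auv| + |c.avv|) * (‖prodB r‖ * (2 * R))
  set K₂ := (|c.buu| + |2 * c.buv| + |c.bvv|) * (‖prodB r‖ * (2 * R))
  have hw := weightBound_nonneg (-1)
  have hK₁ : 0 ≤ K₁ := by positivity
  have hK₂ : 0 ≤ K₂ := by positivity
  refine ⟨⟨1 + (c.α ^ 2 + K₁) + weightBound (-1) * K₂, by positivity⟩, fun t y y' hy hy' => ?_⟩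
  change _ ≤ (1 + (c.α ^ 2 + K₁) + weightBound (-1) * K₂) * _
  obtain ⟨U, U1, Y⟩ := y
  obtain ⟨U', U1', Y'⟩ := y'
  set δ := ‖(U, U1, Y) - (U', U1', Y')‖ with hδ
  have hδ0 : 0 ≤ δ := norm_nonneg _
  have dU : ‖U - U'‖ ≤ δ := norm_fst_le ((U, U1, Y) - (U', U1', Y'))
  have dR : ‖(U1 - U1', Y - Y')‖ ≤ δ := norm_snd_le ((U, U1, Y) - (U', U1', Y'))
  have dU1 : ‖U1 - U1'‖ ≤ δ := (norm_fst_le _).trans dR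
  have dY : ‖Y - Y'‖ ≤ δ := (norm_snd_le _).trans dR
  have dV : ‖vOf t Y - vOf t Y'‖ ≤ δ := by
    rw [← vOf_sub]; exact (norm_vOf_le _ _).trans dY
  have bU : ‖U‖ ≤ R := (norm_fst_le (U, U1, Y)).trans hy
  have bU' : ‖U'‖ ≤ R := (norm_fst_le (U', U1', Y')).trans hy'
  have bV : ‖vOf t Y‖ ≤ R := (norm_vOf_le _ _).trans
    ((norm_snd_le (U1, Y)).trans ((norm_snd_le (U, U1, Y)).trans hy))
  have bV' : ‖vOf t Y'‖ ≤ R := (norm_vOf_le _ _).trans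
    ((norm_snd_le (U1', Y')).trans ((norm_snd_le (U', U1', Y')).trans hy'))
  have n1 := norm_quad_sub_le r c.auu c.auv c.avv bU bV bU' bV' dU dV
  have n2 := norm_quad_sub_le r c.buu c.buv c.bvv bU bV bU' bV' dU dV
  have c2 : ‖rmul D2 (c.α ^ 2 • U + nl₁ c r U (vOf t Y)) -
      rmul D2 (c.α ^ 2 • U' + nl₁ c r U' (vOf t Y'))‖ ≤ (c.α ^ 2 + K₁) * δ := by
    rw [← map_sub]
    refine (norm_rmul_le_of_bound D2 norm_D2_le _).trans ?_
    rw [one_mul]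
    have e : c.α ^ 2 • U + nl₁ c r U (vOf t Y) - (c.α ^ 2 • U' + nl₁ c r U' (vOf t Y')) =
        c.α ^ 2 • (U - U') + (nl₁ c r U (vOf t Y) - nl₁ c r U' (vOf t Y')) := by
      rw [smul_sub]; abel
    rw [e]
    refine (norm_add_le _ _).trans ?_
    rw [norm_smul, Real.norm_of_nonneg (sq_nonneg _), add_mul]
    exact add_le_add (by gcongr) n1
  have c3 : ‖Complex.I • fmul (wave t) (fmul (W (-1) 0) (toC (nl₂ c r U (vOf t Y)))) -
      Complex.I • fmul (wave t) (fmul (W (-1) 0) (toC (nl₂ c r U' (vOf t Y'))))‖ ≤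
        weightBound (-1) * K₂ * δ := by
    rw [← smul_sub, ← map_sub, ← map_sub, ← map_sub, mul_assoc]
    refine (norm_halfwave_forcing_le _ _).trans ?_
    gcongr
    exact n2
  have hK3 : 0 ≤ weightBound (-1) * K₂ := by positivity
  have hα := sq_nonneg c.α
  simp only [field, Prod.mk_sub_mk]
  refine norm_prod_le_iff.2 ⟨?_, norm_prod_le_iff.2 ⟨?_, ?_⟩⟩
  · refine dU1.trans ?_
    nlinarith [mul_nonneg hα hδ0, mul_nonneg hK₁ hδ0, mul_nonneg hK3 hδ0]
  · refine c2.trans ?_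
    nlinarith [mul_nonneg hα hδ0, mul_nonneg hK₁ hδ0, mul_nonneg hK3 hδ0]
  · refine c3.trans ?_
    nlinarith [mul_nonneg hα hδ0, mul_nonneg hK₁ hδ0, mul_nonneg hK3 hδ0]

lemma quad_zero (r a b d : ℝ) : quad r a b d 0 0 = 0 := by simp [quad]

lemma field_zero (c : Coeffs) (r t : ℝ) : field c r t 0 = 0 := by
  simp [field, vOf, nl₁, nl₂, quad_zero]

lemma continuous_quad_vOf (r a b d : ℝ) (U : L2) (Y : L2C) :
    Continuous fun t => quad r a b d U (vOf t Y) := by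
  refine continuous_iff_continuousAt.2 fun t => ?_
  exact tendsto_quad r a b d tendsto_const_nhds ((continuous_vOf Y).tendsto t)

lemma continuous_field_snd (c : Coeffs) (r : ℝ) (U : L2) (Y : L2C) :
    Continuous fun t => rmul D2 (c.α ^ 2 • U + nl₁ c r U (vOf t Y)) := by
  have h : Continuous fun t => nl₁ c r U (vOf t Y) := continuous_quad_vOf r _ _ _ U Y
  exact (rmul D2).continuous.comp (continuous_const.add h)

lemma continuous_field_trd (c : Coeffs) (r : ℝ) (U : L2) (Y : L2C) :
    Continuous fun t =>
      Complex.I • fmul (wave t) (fmul (W (-1) 0) (toC (nl₂ c r U (vOf t Y)))) := by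
  have h : Continuous fun t => nl₂ c r U (vOf t Y) := continuous_quad_vOf r _ _ _ U Y
  have h' : Continuous fun t => fmul (W (-1) 0) (toC (nl₂ c r U (vOf t Y))) :=
    (fmul (W (-1) 0)).continuous.comp (toC.continuous.comp h)
  have h2 : Continuous fun t => fmul (wave t) (fmul (W (-1) 0) (toC (nl₂ c r U (vOf t Y)))) :=
    continuous_iff_continuousAt.2 fun t => tendsto_fmul_wave tendsto_id (h'.tendsto t)
  exact h2.const_smul Complex.I

lemma locLip_field (c : Coeffs) (r : ℝ) : LocLip (field c r) where
  cont := fun y => by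
    obtain ⟨U, U1, Y⟩ := y
    exact continuous_const.prodMk ((continuous_field_snd c r U Y).prodMk
      (continuous_field_trd c r U Y))
  lip := fun R => by
    obtain ⟨K, hK⟩ := norm_field_sub_le c r (R := R)
    refine ⟨K, fun t => LipschitzOnWith.of_dist_le_mul fun x hx y hy => ?_⟩
    rw [dist_eq_norm, dist_eq_norm]
    exact hK t x y (by simpa using hx) (by simpa using hy)
  bdd := fun R => by
    obtain ⟨K, hK⟩ := norm_field_sub_le c r (R := max R 0)
    refine ⟨⟨K * max R 0, by positivity⟩, fun t x hx => ?_⟩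
    have hx' : ‖x‖ ≤ max R 0 := le_max_of_le_left (by simpa using hx)
    have h := hK t x 0 hx' (by simp)
    rw [field_zero, sub_zero, sub_zero] at h
    exact h.trans (by change (K : ℝ) * ‖x‖ ≤ K * max R 0; gcongr)

/-- A weak time derivative that is continuous in time is a strong one. -/
lemma hasDerivWithinAt_of_hasTimeDeriv {I : Set ℝ} (hI : TimeInterval I) {f g : ℝ → L2C}
    (hg : ContinuousOn g I) (a : Sym) (ha : ∀ ξ, a ξ ≠ 0)
    (h : ∀ t ∈ I, HasTimeDeriv I (fun τ => tdist (fmul a (f τ))) (tdist (fmul a (g t))) t)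
    {t : ℝ} (ht : t ∈ I) : HasDerivWithinAt f (g t) I t := by
  set G : ℝ → L2C := fun t => f 0 + ∫ s in (0 : ℝ)..t, g s with hG
  have hGd : ∀ t ∈ I, HasDerivWithinAt G (g t) I t := fun t ht =>
    (hI.hasDerivWithinAt_primitive hg ht).const_add (f 0)
  have e : ∀ t ∈ I, f t = G t := fun t ht => by
    apply fmul_injective a ha
    apply tdist_injective
    ext φ
    refine hI.eq_of_hasDerivWithinAt_eq (f := fun τ => tdist (fmul a (f τ)) φ)
      (g := fun τ => tdist (fmul a (G τ)) φ) (f' := fun τ => tdist (fmul a (g τ)) φ)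
      (fun τ hτ => h τ hτ φ) (fun τ hτ => ?_) (by simp [hG]) ht
    exact hasTimeDeriv_tdist (((fmul a).restrictScalars ℝ).hasFDerivAt.comp_hasDerivWithinAt τ
      (hGd τ hτ)) φ
  exact (hGd t ht).congr e (e t ht)

lemma hasDerivWithinAt_clm {I : Set ℝ} {E F : Type*} [NormedAddCommGroup E] [NormedSpace ℝ E]
    [NormedAddCommGroup F] [NormedSpace ℝ F] (L : E →L[ℝ] F) {f : ℝ → E} {f' : E} {t : ℝ}
    (h : HasDerivWithinAt f f' I t) : HasDerivWithinAt (fun τ => L (f τ)) (L f') I t :=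
  L.hasFDerivAt.comp_hasDerivWithinAt t h

lemma hasDerivWithinAt_fmul {I : Set ℝ} (a : Sym) {f : ℝ → L2C} {f' : L2C} {t : ℝ}
    (h : HasDerivWithinAt f f' I t) : HasDerivWithinAt (fun τ => fmul a (f τ)) (fmul a f') I t :=
  hasDerivWithinAt_clm ((fmul a).restrictScalars ℝ) h

lemma hasDerivWithinAt_of_hasTimeDeriv_toDist {I : Set ℝ} (hI : TimeInterval I) {f g : ℝ → L2}
    (hg : ContinuousOn g I) {a : Sym} (ha' : a.Herm) (ha : ∀ ξ, a ξ ≠ 0)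
    (h : ∀ t ∈ I, HasTimeDeriv I (fun τ => toDist (rmul a (f τ))) (toDist (rmul a (g t))) t)
    {t : ℝ} (ht : t ∈ I) : HasDerivWithinAt f (g t) I t := by
  have h1 : HasDerivWithinAt (fun τ => toC (f τ)) (toC (g t)) I t :=
    hasDerivWithinAt_of_hasTimeDeriv hI (f := fun τ => toC (f τ)) (g := fun τ => toC (g τ))
      (toC.continuous.comp_continuousOn hg) a ha
      (fun t ht => by simpa only [toDist_eq, toC_rmul ha'] using h t ht) ht
  simpa only [reL_toC] using hasDerivWithinAt_clm reL h1

lemma toDist_bes (r : ℝ) (hr : 0 ≤ r) (U : L2) :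
    toDist (bes r U) = dmul (weightC 0 (-r)) (toDist U) := by
  rw [toDist_eq, toDist_eq, toC_bes, dmul_weightC_tdist (by linarith)]

lemma bes_eq_of_bessel {r : ℝ} (hr : 0 ≤ r) {u : L2} {g : L2C}
    (h : TemperedDistribution.besselPotential ℝ ℂ r (toDist u) = tdist g) :
    u = bes r (reL g) := by
  rw [besselPotential_eq_iff, toDist_eq, dmul_weightC_tdist (by linarith)] at h
  have h1 : toC u = fmul (W 0 (-r)) g := tdist_injective h
  rw [bes, ← reL_fmul (herm_W _ _), ← h1, reL_toC]

lemma SobolevContinuousOn.exists_bes {σ : ℝ} (hσ : 0 ≤ σ) {I : Set ℝ} {u : ℝ → L2}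
    (h : SobolevContinuousOn σ I (fun t => toDist (u t))) : ∃ U : ℝ → L2, ContinuousOn U I ∧
      ∀ t ∈ I, u t = bes σ (U t) := by
  obtain ⟨g, hg, e⟩ := h.exists_continuousOn
  exact ⟨fun t => reL (g t), reL.continuous.comp_continuousOn hg,
    fun t ht => bes_eq_of_bessel hσ (e t ht)⟩

lemma bes_rmul_W {r s : ℝ} (hr : 0 ≤ r) (hrs : r ≤ s) (V : L2) :
    bes r (rmul (W 0 (r - s)) V) = bes s V := by
  rw [bes, bes, ← rmul_mul _ (herm_W _ _), W_mul (by linarith) (by linarith)]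
  congr 2; ring_nf

lemma one_sub_dsym_sq (ξ : ℝ) : 1 - dsym ξ ^ 2 = weightC 2 0 ξ := by
  rw [dsym_sq, weightC, weight]
  simp [japSq_eq]

lemma dx_dx_eq (f : 𝓢'(ℝ, ℂ)) : dx (dx f) = dmul (fun ξ => dsym ξ ^ 2) f := by
  rw [dx_eq, dx_eq, dmul_dmul hasTemperateGrowth_dsym hasTemperateGrowth_dsym]
  exact dmul_congr (fun ξ => (sq _).symm) f

lemma hasTemperateGrowth_dsym_sq : (fun ξ => dsym ξ ^ 2).HasTemperateGrowth := by
  unfold dsym; fun_prop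

lemma hasTemperateGrowth_D2 : (D2 : ℝ → ℂ).HasTemperateGrowth :=
  hasTemperateGrowth_dsym_sq.mul (hasTemperateGrowth_weightC _ _)

lemma hasTemperateGrowth_D1 : (D1 : ℝ → ℂ).HasTemperateGrowth :=
  hasTemperateGrowth_dsym.mul (hasTemperateGrowth_weightC _ _)

lemma weightC_mul (p q p' q' ξ : ℝ) :
    weightC p q ξ * weightC p' q' ξ = weightC (p + p') (q + q') ξ := by
  simp only [weightC]; rw [← Complex.ofReal_mul, weight_mul]

lemma dx_dx_sub_self (f : 𝓢'(ℝ, ℂ)) : dx (dx f) - f = -dmul (weightC 2 0) f := by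
  have h : dmul (fun ξ => weightC 2 0 ξ + dsym ξ ^ 2) f = f := by
    rw [dmul_congr (h := fun _ => 1) (fun ξ => by rw [← one_sub_dsym_sq]; ring), dmul_one]
  rw [dmul_add (hasTemperateGrowth_weightC _ _) hasTemperateGrowth_dsym_sq] at h
  rw [dx_dx_eq]
  nth_rw 2 [← h]
  abel

/-- Solving `w = ∂ₓ² (X + w)` for `w`. -/
lemma eq_dx_dx_add_iff (w X : 𝓢'(ℝ, ℂ)) :
    w = dx (dx X) + dx (dx w) ↔ w = dmul D2 X := by
  constructor
  · intro h
    have h1 : dmul (weightC 2 0) w = dmul (fun ξ => dsym ξ ^ 2) X := by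
      rw [← dx_dx_eq, ← neg_inj, ← dx_dx_sub_self]
      nth_rw 2 [h]; abel
    have h2 : w = dmul (weightC (-2) 0) (dmul (weightC 2 0) w) := by
      rw [dmul_weightC_dmul_weightC]; simp [dmul_weightC_zero_zero]
    rw [h2, h1, dmul_dmul (hasTemperateGrowth_weightC _ _) hasTemperateGrowth_dsym_sq]
    exact dmul_congr (fun ξ => mul_comm _ _) X
  · intro h
    rw [h, dx_dx_eq, dx_dx_eq, dmul_dmul hasTemperateGrowth_dsym_sq hasTemperateGrowth_D2,
      ← dmul_add (h := fun ξ => dsym ξ ^ 2 * D2 ξ) hasTemperateGrowth_dsym_sq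
        (hasTemperateGrowth_dsym_sq.mul hasTemperateGrowth_D2)]
    refine dmul_congr (fun ξ => ?_) X
    rw [coe_D2]
    have h1 : weightC 2 0 ξ * weightC (-2) 0 ξ = 1 := by
      rw [weightC_mul]; simp [weightC_zero_zero]
    rw [← one_sub_dsym_sq] at h1
    linear_combination (dsym ξ ^ 2) * h1

lemma dmul_D2_toDist (h : L2) : dmul D2 (toDist h) = toDist (rmul D2 h) := by
  rw [toDist_eq, toDist_eq, dmul_tdist _ hasTemperateGrowth_D2, toC_rmul herm_D2]

lemma rmul_comm {a b : Sym} (ha : a.Herm) (hb : b.Herm) (f : L2) :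
    rmul a (rmul b f) = rmul b (rmul a f) := by
  rw [← rmul_mul a hb, ← rmul_mul b ha, mul_comm]

lemma toDist_smul {p : ℝ≥0∞} [Fact (1 ≤ p)] (k : ℝ) (f : Lp ℝ p (volume : Measure ℝ)) :
    toDist (k • f) = k • toDist f := by
  ext φ
  change toDist (k • f) φ = k • toDist f φ
  simp only [toDist, Lp.toTemperedDistribution_apply]
  rw [← integral_smul]
  apply integral_congr_ae
  filter_upwards [ContinuousLinearMap.coeFn_compLp Complex.ofRealCLM (k • f),
    ContinuousLinearMap.coeFn_compLp Complex.ofRealCLM f, Lp.coeFn_smul k f] with x h1 h2 h3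
  rw [toComplex, toComplex, h1, h2, h3]
  simp only [Pi.smul_apply, smul_eq_mul, Complex.ofRealCLM_apply, Complex.real_smul,
    Complex.ofReal_mul]
  ring

lemma toDist_add (f g : L2) : toDist (f + g) = toDist f + toDist g := by
  simp only [toDist_eq, map_add]

/-- The right-hand side of the first equation, solved for `u_tt`. -/
lemma utt_eq_iff {r : ℝ} (hr : 1 / 2 < r) (c : Coeffs) (U V : L2) (utt : 𝓢'(ℝ, ℂ)) :
    utt = (c.α ^ 2 : ℝ) • dx (dx (toDist (bes r U))) + dx (dx utt)
        + dx (dx (toDist (f₁ c (bes r U) (bes r V)))) ↔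
      utt = toDist (bes r (rmul D2 (c.α ^ 2 • U + nl₁ c r U V))) := by
  have e1 : bes r (rmul D2 (c.α ^ 2 • U + nl₁ c r U V)) =
      rmul D2 (c.α ^ 2 • bes r U + bes r (nl₁ c r U V)) := by
    rw [bes, rmul_comm (herm_W _ _) herm_D2, map_add, map_smul]
  rw [e1, ← dmul_D2_toDist, ← eq_dx_dx_add_iff, toDist_f₁ hr, toDist_add, toDist_smul]
  have e2 : ∀ X Y : 𝓢'(ℝ, ℂ), dx (dx ((c.α ^ 2) • X + Y)) =
      (c.α ^ 2) • dx (dx X) + dx (dx Y) := fun X Y => by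
    simp only [dx, map_add]
    congr 1
  rw [e2, add_right_comm]

lemma tendsto_vOf {X : Type*} {l : Filter X} [l.IsCountablyGenerated] {τ : X → ℝ} {t : ℝ}
    {Y : X → L2C} {Y₀ : L2C}
    (hτ : Tendsto τ l (𝓝 t)) (hY : Tendsto Y l (𝓝 Y₀)) :
    Tendsto (fun x => vOf (τ x) (Y x)) l (𝓝 (vOf t Y₀)) :=
  (reL.continuous.tendsto _).comp (tendsto_fmul_wave hτ.neg hY)

lemma continuousOn_quad {I : Set ℝ} (r a b d : ℝ) {U V : ℝ → L2} (hU : ContinuousOn U I)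
    (hV : ContinuousOn V I) : ContinuousOn (fun t => quad r a b d (U t) (V t)) I :=
  fun t ht => tendsto_quad r a b d (hU t ht) (hV t ht)

lemma continuousOn_fmul {I : Set ℝ} (a : Sym) {f : ℝ → L2C} (hf : ContinuousOn f I) :
    ContinuousOn (fun t => fmul a (f t)) I := (fmul a).continuous.comp_continuousOn hf

lemma continuousOn_rmul {I : Set ℝ} (a : Sym) {f : ℝ → L2} (hf : ContinuousOn f I) :
    ContinuousOn (fun t => rmul a (f t)) I := (rmul a).continuous.comp_continuousOn hf

lemma continuousOn_nl₁ {I : Set ℝ} (c : Coeffs) (r : ℝ) {U V : ℝ → L2} (hU : ContinuousOn U I)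
    (hV : ContinuousOn V I) : ContinuousOn (fun t => nl₁ c r (U t) (V t)) I :=
  continuousOn_quad r _ _ _ hU hV

lemma continuousOn_nl₂ {I : Set ℝ} (c : Coeffs) (r : ℝ) {U V : ℝ → L2} (hU : ContinuousOn U I)
    (hV : ContinuousOn V I) : ContinuousOn (fun t => nl₂ c r (U t) (V t)) I :=
  continuousOn_quad r _ _ _ hU hV

/-- The potential `α² u + f₁(u, v)` of the first equation, conjugated by the Bessel potential. -/
def pot (c : Coeffs) (r : ℝ) (U V : L2) : L2 := c.α ^ 2 • U + nl₁ c r U V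

lemma continuousOn_pot {I : Set ℝ} (c : Coeffs) (r : ℝ) {U V : ℝ → L2} (hU : ContinuousOn U I)
    (hV : ContinuousOn V I) : ContinuousOn (fun t => pot c r (U t) (V t)) I :=
  fun t ht => (Tendsto.const_smul (hU t ht) (c.α ^ 2)).add (continuousOn_nl₁ c r hU hV t ht)

lemma continuousOn_toC {I : Set ℝ} {f : ℝ → L2} (hf : ContinuousOn f I) :
    ContinuousOn (fun t => toC (f t)) I := toC.continuous.comp_continuousOn hf

lemma continuousOn_fmul_wave {I : Set ℝ} (k : ℝ) {f : ℝ → L2C} (hf : ContinuousOn f I) :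
    ContinuousOn (fun t => fmul (wave (k * t)) (f t)) I := fun t ht =>
  tendsto_fmul_wave (((continuous_const.mul continuous_id).tendsto t).mono_left
    nhdsWithin_le_nhds) (hf t ht)

/-- `V` solves the (conjugated) Klein-Gordon equation with velocity `J Q` in the sense of
distributions; then `Q` is real and the profile `e^{itJ} (V + i Q)` is continuously
differentiable. -/
lemma hasDerivWithinAt_profile {I : Set ℝ} (hI : TimeInterval I) {V F : ℝ → L2} {Q : ℝ → L2C}
    (hV : ContinuousOn V I) (hQ : ContinuousOn Q I) (hF : ContinuousOn F I)
    (h1 : ∀ t ∈ I, HasTimeDeriv I (fun τ => tdist (fmul (W (-1) 0) (toC (V τ)))) (tdist (Q t)) t)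
    (h2 : ∀ t ∈ I, HasTimeDeriv I (fun τ => tdist (fmul (W (-1) 0) (Q τ)))
      (tdist (-toC (V t) + fmul (W (-2) 0) (toC (F t)))) t) {t : ℝ} (ht : t ∈ I) :
    imL (Q t) = 0 ∧
    HasDerivWithinAt (fun τ => fmul (wave τ) (toC (V τ) + Complex.I • Q τ))
      (Complex.I • fmul (wave t) (fmul (W (-1) 0) (toC (F t)))) I t := by
  have d1 : ∀ t ∈ I, HasDerivWithinAt (fun τ => fmul (W (-1) 0) (toC (V τ))) (Q t) I t :=
    fun t ht => hasDerivWithinAt_of_hasTimeDeriv hI hQ 1 (by simp)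
      (fun t ht => by simpa only [fmul_one] using h1 t ht) ht
  have d2 : ∀ t ∈ I, HasDerivWithinAt (fun τ => fmul (W (-1) 0) (Q τ))
      (-toC (V t) + fmul (W (-2) 0) (toC (F t))) I t :=
    fun t ht => hasDerivWithinAt_of_hasTimeDeriv hI
      (g := fun t => -toC (V t) + fmul (W (-2) 0) (toC (F t)))
      ((continuousOn_toC hV).neg.add (continuousOn_fmul _ (continuousOn_toC hF))) 1 (by simp)
      (fun t ht => by simpa only [fmul_one] using h2 t ht) ht
  constructor
  · have d3 := hasDerivWithinAt_clm imL (d1 t ht)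
    have e : (fun τ => imL (fmul (W (-1) 0) (toC (V τ)))) = fun _ => 0 := by
      ext1 τ; rw [imL_fmul (herm_W _ _), imL_toC, map_zero]
    rw [e] at d3
    exact (hI.uniqueDiffWithinAt ht).eq_deriv _ d3 (hasDerivWithinAt_const t I (0 : L2))
  have d4 : ∀ t ∈ I, HasDerivWithinAt
      (fun τ => fmul (W (-1) 0) (fmul (wave τ) (toC (V τ) + Complex.I • Q τ)))
      (fmul (W (-1) 0) (Complex.I • fmul (wave t) (fmul (W (-1) 0) (toC (F t))))) I t := by
    intro t ht
    have d5 := hasDerivWithinAt_fmul_wave (Z := toC (V t) + Complex.I • Q t) 1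
      ((d1 t ht).add ((d2 t ht).const_smul Complex.I)) (by simp [map_add])
    refine (d5.congr_deriv ?_).congr (fun τ _ => ?_) ?_
    · have e1 : Q t + Complex.I • (-toC (V t) + fmul (W (-2) 0) (toC (F t))) +
          ((1 : ℝ) * Complex.I) • (toC (V t) + Complex.I • Q t) =
            Complex.I • fmul (W (-1) 0) (fmul (W (-1) 0) (toC (F t))) := by
        rw [← fmul_mul, W_mul (by norm_num) (by norm_num), Complex.ofReal_one, one_mul, smul_add,
          smul_add, smul_smul, Complex.I_mul_I]
        norm_num
        abel
      rw [e1, one_mul, map_smul, map_smul, fmul_comm (W (-1) 0) (wave t)]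
    · simp only [one_mul, map_add, map_smul, Pi.add_apply, Pi.smul_apply, fmul_comm (W (-1) 0)]
    · simp only [one_mul, map_add, map_smul, Pi.add_apply, Pi.smul_apply, fmul_comm (W (-1) 0)]
  refine hasDerivWithinAt_of_hasTimeDeriv hI (g := fun t =>
    Complex.I • fmul (wave t) (fmul (W (-1) 0) (toC (F t)))) ?_ (W (-1) 0)
    (W_ne_zero (by norm_num)) (fun t ht => hasTimeDeriv_tdist (d4 t ht)) ht
  have hc := continuousOn_fmul_wave 1 (continuousOn_fmul (W (-1) 0) (continuousOn_toC hF))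
  simp only [one_mul] at hc
  exact hc.const_smul Complex.I

/-- The relation between the initial data and the initial state. -/
structure IsData (r : ℝ) (u₀ u₁ v₀ v₁ : L2) (y₀ : State) : Prop where
  u : u₀ = bes r y₀.1
  ut : u₁ = bes r y₀.2.1
  v : v₀ = bes r (reL y₀.2.2)
  vt : toDist v₁ = dmul (weightC 1 (-r)) (toDist (imL y₀.2.2))

lemma dmul_weightC_injective (p q : ℝ) : Function.Injective (dmul (weightC p q)) := fun f g h => by
  have := congrArg (dmul (weightC (-p) (-q))) h
  simpa only [dmul_weightC_dmul_weightC, neg_add_cancel, dmul_weightC_zero_zero] using this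

lemma toDist_injective {f g : L2} (h : toDist f = toDist g) : f = g :=
  toC_injective (tdist_injective h)

lemma IsData.eq {r : ℝ} (hr : 0 ≤ r) {u₀ u₁ v₀ v₁ : L2} {y y' : State}
    (h : IsData r u₀ u₁ v₀ v₁ y) (h' : IsData r u₀ u₁ v₀ v₁ y') : y = y' := by
  have e1 := bes_injective hr (h.u.symm.trans h'.u)
  have e2 := bes_injective hr (h.ut.symm.trans h'.ut)
  have e3 := bes_injective hr (h.v.symm.trans h'.v)
  have e4 := toDist_injective (dmul_weightC_injective _ _ (h.vt.symm.trans h'.vt))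
  refine Prod.ext e1 (Prod.ext e2 ?_)
  rw [← toC_re_add_im y.2.2, e3, e4, toC_re_add_im]

lemma hasDerivWithinAt_of_hasTimeDeriv_bes {I : Set ℝ} (hI : TimeInterval I) {r : ℝ} (hr : 0 ≤ r)
    {u f g : ℝ → L2} (hg : ContinuousOn g I) (hu : ∀ t ∈ I, u t = bes r (f t))
    (h : ∀ t ∈ I, HasTimeDeriv I (fun τ => toDist (u τ)) (toDist (bes r (g t))) t)
    {t : ℝ} (ht : t ∈ I) : HasDerivWithinAt f (g t) I t :=
  hasDerivWithinAt_of_hasTimeDeriv_toDist hI hg (herm_W 0 (-r)) (W_ne_zero (by linarith))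
    (fun t ht => (h t ht).congr ht (fun τ hτ => by rw [hu τ hτ]; rfl)) ht

/-- Every solution of the system comes from a solution of the ordinary differential equation. -/
theorem IsSolution.exists_isODESol {c : Coeffs} {r s T : ℝ} (hr : 1 / 2 < r) (hrs : r ≤ s)
    (hT : 0 < T) {u₀ u₁ v₀ v₁ : L2} {u ut v : ℝ → L2} {vt : ℝ → 𝓢'(ℝ, ℂ)}
    (h : IsSolution c r s T u₀ u₁ v₀ v₁ u ut v vt) :
    ∃ y : ℝ → State, IsODESol (field c r) (Ico 0 T) y ∧ IsData r u₀ u₁ v₀ v₁ (y 0) ∧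
      ∀ t ∈ Ico 0 T, u t = bes r (y t).1 ∧ v t = bes r (vOf t (y t).2.2) := by
  have hr0 : 0 ≤ r := by linarith
  have hI := timeInterval_Ico hT
  obtain ⟨U, hU, eU⟩ := h.u_mem.exists_bes hr0
  obtain ⟨U1, hU1, eU1⟩ := h.ut_mem.exists_bes hr0
  obtain ⟨V', hV', eV'⟩ := h.v_mem.exists_bes (hr0.trans hrs)
  obtain ⟨Q', hQ', eQ'⟩ := h.vt_mem.exists_continuousOn
  set V : ℝ → L2 := fun t => rmul (W 0 (r - s)) (V' t) with hVdef
  have hV : ContinuousOn V (Ico 0 T) := continuousOn_rmul _ hV'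
  have eV : ∀ t ∈ Ico 0 T, v t = bes r (V t) := fun t ht => by
    rw [eV' t ht, hVdef, bes_rmul_W hr0 hrs]
  set Q : ℝ → L2C := fun t => fmul (W (-1) (r - s + 1)) (Q' t) with hQdef
  have hQ : ContinuousOn Q (Ico 0 T) := continuousOn_fmul _ hQ'
  have eQ : ∀ t ∈ Ico 0 T, vt t = dmul (weightC 1 (-r)) (tdist (Q t)) := fun t ht => by
    rw [besselPotential_eq_iff.1 (eQ' t ht), hQdef, ← dmul_weightC_tdist (by linarith),
      dmul_weightC_dmul_weightC, show (1 : ℝ) + -1 = 0 by norm_num,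
      show -r + (r - s + 1) = -(s - 1) by ring]
  have dU : ∀ t ∈ Ico 0 T, HasDerivWithinAt U (U1 t) (Ico 0 T) t := fun t ht =>
    hasDerivWithinAt_of_hasTimeDeriv_bes hI hr0 hU1 eU
      (fun t ht => by simpa only [eU1 t ht] using h.deriv_u t ht) ht
  have dU1 : ∀ t ∈ Ico 0 T, HasDerivWithinAt U1
      (rmul D2 (pot c r (U t) (V t))) (Ico 0 T) t := fun t ht => by
    refine hasDerivWithinAt_of_hasTimeDeriv_bes hI hr0
      (g := fun t => rmul D2 (pot c r (U t) (V t)))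
      (continuousOn_rmul _ (continuousOn_pot c r hU hV)) eU1 (fun t ht => ?_) ht
    obtain ⟨utt, h1, h2⟩ := h.eq_u t ht
    rw [eU t ht, eV t ht, utt_eq_iff hr] at h2
    rwa [h2] at h1
  have hprof := fun t ht => hasDerivWithinAt_profile (t := t) hI hV hQ
    (F := fun t => nl₂ c r (U t) (V t)) (continuousOn_nl₂ c r hU hV)
    (fun t ht => by
      have h1 := ((h.deriv_v t ht).dmul (weightC (-1) r)).congr ht
        (g := fun τ => tdist (fmul (W (-1) 0) (toC (V τ)))) (fun τ hτ => by
          rw [eV τ hτ, toDist_bes _ hr0, dmul_weightC_dmul_weightC,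
            ← dmul_weightC_tdist (by norm_num)]
          simp only [toDist_eq, add_zero, add_neg_cancel])
      rw [eQ t ht, dmul_weightC_dmul_weightC] at h1
      simpa only [add_neg_cancel, neg_add_cancel, dmul_weightC_zero_zero] using h1)
    (fun t ht => by
      have h1 := ((h.eq_v t ht).dmul (weightC (-2) r)).congr ht
        (g := fun τ => tdist (fmul (W (-1) 0) (Q τ))) (fun τ hτ => by
          rw [eQ τ hτ, dmul_weightC_dmul_weightC, ← dmul_weightC_tdist (by norm_num)]
          rw [show (-2 : ℝ) + 1 = -1 by norm_num, add_neg_cancel])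
      rw [dx_dx_sub_self, eU t ht, eV t ht, toDist_f₂ hr, toDist_bes _ hr0, toDist_bes _ hr0,
        map_add, map_neg, dmul_weightC_dmul_weightC, dmul_weightC_dmul_weightC,
        dmul_weightC_dmul_weightC] at h1
      rw [map_add, map_neg, ← dmul_weightC_tdist (by norm_num)]
      have e1 : (-2 + 2 + 0 : ℝ) = 0 := by norm_num
      have e2 : r + 0 + -r = 0 := by ring
      have e3 : (-2 + 0 : ℝ) = -2 := by norm_num
      have e4 : r + -r = 0 := by ring
      rwa [e1, e2, e3, e4, dmul_weightC_zero_zero] at h1) ht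
  have eVof : ∀ t ∈ Ico 0 T, vOf t (fmul (wave t) (toC (V t) + Complex.I • Q t)) = V t :=
    fun t ht => by
      rw [vOf, fmul_wave_neg_wave, map_add, reL_toC, reL_I_smul, (hprof t ht).1]; simp
  refine ⟨fun t => (U t, U1 t, fmul (wave t) (toC (V t) + Complex.I • Q t)), fun t ht => ?_, ?_,
    fun t ht => ⟨eU t ht, ?_⟩⟩
  · have := (dU t ht).prodMk ((dU1 t ht).prodMk (hprof t ht).2)
    rw [field, eVof t ht]
    exact this
  · have h0 : (0 : ℝ) ∈ Ico 0 T := hI.zero_mem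
    have e0 : fmul (wave 0) (toC (V 0) + Complex.I • Q 0) = toC (V 0) + Complex.I • Q 0 := by
      rw [wave_zero, fmul_one]
    refine ⟨by rw [← h.init_u, eU 0 h0], by rw [← h.init_ut, eU1 0 h0], ?_, ?_⟩
    · dsimp only
      rw [← h.init_v, eV 0 h0, e0, map_add, reL_toC, reL_I_smul, (hprof 0 h0).1, neg_zero, add_zero]
    · dsimp only
      rw [← h.init_vt, eQ 0 h0, e0, map_add, imL_toC, imL_I_smul, zero_add, toDist_eq,
        ← eq_toC_of_imL_eq_zero (hprof 0 h0).1]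
  · rw [eV t ht, eVof t ht]

/-- The second component `v` along a curve of states. -/
def vAt (y : ℝ → State) (t : ℝ) : L2 := vOf t (y t).2.2

section Components

variable {I : Set ℝ} {c : Coeffs} {r : ℝ} {y : ℝ → State}

lemma IsODESol.hasDerivWithinAt_U (hy : IsODESol (field c r) I y) {t : ℝ} (ht : t ∈ I) :
    HasDerivWithinAt (fun t => (y t).1) (y t).2.1 I t :=
  hasDerivWithinAt_clm (ContinuousLinearMap.fst ℝ L2 (L2 × L2C)) (hy t ht)

lemma IsODESol.hasDerivWithinAt_U1 (hy : IsODESol (field c r) I y) {t : ℝ} (ht : t ∈ I) :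
    HasDerivWithinAt (fun t => (y t).2.1) (rmul D2 (pot c r (y t).1 (vAt y t))) I t :=
  hasDerivWithinAt_clm ((ContinuousLinearMap.fst ℝ L2 L2C) ∘L
    (ContinuousLinearMap.snd ℝ L2 (L2 × L2C))) (hy t ht)

lemma IsODESol.hasDerivWithinAt_Y (hy : IsODESol (field c r) I y) {t : ℝ} (ht : t ∈ I) :
    HasDerivWithinAt (fun t => (y t).2.2)
      (Complex.I • fmul (wave t) (fmul (W (-1) 0) (toC (nl₂ c r (y t).1 (vAt y t))))) I t :=
  hasDerivWithinAt_clm ((ContinuousLinearMap.snd ℝ L2 L2C) ∘L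
    (ContinuousLinearMap.snd ℝ L2 (L2 × L2C))) (hy t ht)

lemma IsODESol.continuousOn_U (hy : IsODESol (field c r) I y) :
    ContinuousOn (fun t => (y t).1) I := fun _ ht => (hy.hasDerivWithinAt_U ht).continuousWithinAt

lemma IsODESol.continuousOn_U1 (hy : IsODESol (field c r) I y) :
    ContinuousOn (fun t => (y t).2.1) I :=
  fun _ ht => (hy.hasDerivWithinAt_U1 ht).continuousWithinAt

lemma IsODESol.continuousOn_vAt (hy : IsODESol (field c r) I y) : ContinuousOn (vAt y) I :=
  fun _ ht => tendsto_vOf (tendsto_id.mono_left nhdsWithin_le_nhds)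
    (hy.hasDerivWithinAt_Y ht).continuousWithinAt

end Components

lemma W_add_mul {p q p' q' p'' q'' : ℝ} (h : p + q ≤ 0) (h' : p' + q' ≤ 0) (hp : p + p' = p'')
    (hq : q + q' = q'') (f : L2C) : fmul (W p q) (fmul (W p' q') f) = fmul (W p'' q'') f := by
  rw [← fmul_mul, W_mul h h', hp, hq]

lemma rW_add_mul {p q p' q' p'' q'' : ℝ} (h : p + q ≤ 0) (h' : p' + q' ≤ 0) (hp : p + p' = p'')
    (hq : q + q' = q'') (f : L2) : rmul (W p q) (rmul (W p' q') f) = rmul (W p'' q'') f := by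
  rw [← rmul_mul _ (herm_W _ _), W_mul h h', hp, hq]

lemma dmul_weightC_toDist {p q : ℝ} (h : p + q ≤ 0) (f : L2) :
    dmul (weightC p q) (toDist f) = toDist (rmul (W p q) f) := by
  rw [toDist_eq, toDist_eq, dmul_weightC_tdist h, toC_rmul (herm_W _ _)]

/-- Additional regularity: if the initial profile has `σ - r ≤ 1` more derivatives, so has the
profile at later times. -/
structure IsRegularProfile (c : Coeffs) (r σ : ℝ) (I : Set ℝ) (y : ℝ → State) (Y : ℝ → L2C) :
    Prop where
  deriv : ∀ t ∈ I, HasDerivWithinAt Y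
    (Complex.I • fmul (wave t) (fmul (W (-1) (σ - r)) (toC (nl₂ c r (y t).1 (vAt y t))))) I t
  eq : ∀ t ∈ I, (y t).2.2 = fmul (W 0 (r - σ)) (Y t)

lemma continuousOn_I_smul {I : Set ℝ} {f : ℝ → L2C} (hf : ContinuousOn f I) :
    ContinuousOn (fun t => Complex.I • f t) I := fun t ht => Tendsto.const_smul (hf t ht) Complex.I

lemma IsODESol.exists_isRegularProfile {c : Coeffs} {r σ : ℝ} (hrσ : r ≤ σ) (hσr : σ ≤ r + 1)
    {I : Set ℝ} (hI : TimeInterval I) {y : ℝ → State} (hy : IsODESol (field c r) I y) {Y₀ : L2C}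
    (h0 : (y 0).2.2 = fmul (W 0 (r - σ)) Y₀) :
    ∃ Y : ℝ → L2C, Y 0 = Y₀ ∧ IsRegularProfile c r σ I y Y := by
  have hc : ContinuousOn (fun t => Complex.I • fmul (wave t) (fmul (W (-1) (σ - r))
      (toC (nl₂ c r (y t).1 (vAt y t))))) I := by
    have := continuousOn_fmul_wave 1 (continuousOn_fmul (W (-1) (σ - r))
      (continuousOn_toC (continuousOn_nl₂ c r hy.continuousOn_U hy.continuousOn_vAt)))
    simp only [one_mul] at this
    exact continuousOn_I_smul this
  set Y : ℝ → L2C := fun t => Y₀ + ∫ τ in (0 : ℝ)..t, Complex.I • fmul (wave τ)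
    (fmul (W (-1) (σ - r)) (toC (nl₂ c r (y τ).1 (vAt y τ)))) with hY
  have hd : ∀ t ∈ I, HasDerivWithinAt Y (Complex.I • fmul (wave t) (fmul (W (-1) (σ - r))
      (toC (nl₂ c r (y t).1 (vAt y t))))) I t := fun t ht =>
    (hI.hasDerivWithinAt_primitive hc ht).const_add Y₀
  have hY0 : Y 0 = Y₀ := by simp [hY]
  refine ⟨Y, hY0, hd, fun t ht => ?_⟩
  refine hI.eq_of_hasDerivWithinAt_eq (fun t ht => hy.hasDerivWithinAt_Y ht)
    (g := fun t => fmul (W 0 (r - σ)) (Y t)) (fun t ht => ?_) (by rw [h0, hY0]) ht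
  refine (hasDerivWithinAt_fmul _ (hd t ht)).congr_deriv ?_
  rw [map_smul, fmul_comm, W_add_mul (q'' := 0) (by linarith) (by linarith) (zero_add _) (by ring)]

/-- The half-wave `v + i J⁻¹ v_t` belonging to a profile. -/
def halfWave (Y : ℝ → L2C) (t : ℝ) : L2C := fmul (wave (-t)) (Y t)

section Regular

variable {I : Set ℝ} {c : Coeffs} {r σ : ℝ} {y : ℝ → State} {Y : ℝ → L2C}

lemma IsRegularProfile.continuousOn_halfWave (h : IsRegularProfile c r σ I y Y) :
    ContinuousOn (halfWave Y) I := by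
  have := continuousOn_fmul_wave (-1) (f := Y) (I := I)
    (fun t ht => (h.deriv t ht).continuousWithinAt)
  simp only [neg_one_mul] at this
  exact this

lemma IsRegularProfile.vAt_eq (h : IsRegularProfile c r σ I y Y) {t : ℝ} (ht : t ∈ I) :
    vAt y t = rmul (W 0 (r - σ)) (reL (halfWave Y t)) := by
  rw [vAt, vOf, h.eq t ht, fmul_comm, reL_fmul (herm_W _ _)]; rfl

lemma IsRegularProfile.hasDerivWithinAt_halfWave (hσr : σ ≤ r + 1)
    (h : IsRegularProfile c r σ I y Y) {t : ℝ} (ht : t ∈ I) :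
    HasDerivWithinAt (fun t => fmul (W (-1) 0) (halfWave Y t))
      (-(Complex.I • halfWave Y t) +
        Complex.I • toC (rmul (W (-2) (σ - r)) (nl₂ c r (y t).1 (vAt y t)))) I t := by
  have h1 := hasDerivWithinAt_fmul_wave (Z := Y t) (-1)
    (hasDerivWithinAt_fmul (W (-1) 0) (h.deriv t ht)) rfl
  simp only [neg_one_mul] at h1
  refine (h1.congr_deriv ?_).congr (fun τ _ => fmul_comm _ _ _) (fmul_comm _ _ _)
  rw [map_smul, fmul_comm _ (wave t), W_add_mul (p'' := -2) (q'' := σ - r) (by norm_num)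
    (by linarith) (by norm_num) (by ring), map_add, map_smul, fmul_wave_neg_wave, map_smul,
    toC_rmul (herm_W _ _), halfWave, add_comm]
  simp

lemma IsRegularProfile.hasDerivWithinAt_re (hσr : σ ≤ r + 1)
    (h : IsRegularProfile c r σ I y Y) {t : ℝ} (ht : t ∈ I) :
    HasDerivWithinAt (fun t => rmul (W (-1) 0) (reL (halfWave Y t))) (imL (halfWave Y t)) I t := by
  have h1 := hasDerivWithinAt_clm reL (h.hasDerivWithinAt_halfWave hσr ht)
  simp only [reL_fmul (herm_W _ _), map_add, map_neg, reL_I_smul, imL_toC] at h1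
  simpa using h1

lemma IsRegularProfile.hasDerivWithinAt_im (hσr : σ ≤ r + 1)
    (h : IsRegularProfile c r σ I y Y) {t : ℝ} (ht : t ∈ I) :
    HasDerivWithinAt (fun t => rmul (W (-1) 0) (imL (halfWave Y t))) (-reL (halfWave Y t) +
      rmul (W (-2) (σ - r)) (nl₂ c r (y t).1 (vAt y t))) I t := by
  have h1 := hasDerivWithinAt_clm imL (h.hasDerivWithinAt_halfWave hσr ht)
  simpa only [imL_fmul (herm_W _ _), map_add, map_neg, imL_I_smul, reL_toC] using h1

end Regular

lemma hasTimeDeriv_toDist {I : Set ℝ} {f : ℝ → L2} {f' : L2} {t : ℝ}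
    (h : HasDerivWithinAt f f' I t) : HasTimeDeriv I (fun τ => toDist (f τ)) (toDist f') t :=
  hasTimeDeriv_tdist (hasDerivWithinAt_clm toC h)

/-- `IsWeakDeriv` in terms of bounded multipliers. -/
lemma isWeakDeriv_iff (w g : L2) : IsWeakDeriv w g ↔ rmul (W (-2) 0) g = rmul D1 w := by
  have e1 : dmul (weightC (-2) 0) (dx (toDist w)) = toDist (rmul D1 w) := by
    rw [dx_eq, dmul_dmul (hasTemperateGrowth_weightC _ _) hasTemperateGrowth_dsym, toDist_eq,
      toDist_eq, toC_rmul herm_D1, ← dmul_tdist _ hasTemperateGrowth_D1]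
    exact dmul_congr (fun ξ => mul_comm _ _) _
  have e2 : dmul (weightC (-2) 0) (toDist g) = toDist (rmul (W (-2) 0) g) :=
    dmul_weightC_toDist (by norm_num) g
  rw [IsWeakDeriv, ← (dmul_weightC_injective (-2) 0).eq_iff, e1, e2]
  exact ⟨fun h => (toDist_injective h).symm, fun h => by rw [h]⟩

lemma W_mul_D2 : W (-2) 0 * D2 = D1 * D1 := by
  ext ξ
  rw [BoundedContinuousFunction.mul_apply, BoundedContinuousFunction.mul_apply, coe_D1, coe_D2,
    coe_W (by norm_num)]
  ring

lemma rmul_W_bes_rmul_D2 (r : ℝ) (h : L2) :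
    rmul (W (-2) 0) (bes r (rmul D2 h)) = rmul D1 (rmul D1 (bes r h)) := by
  rw [bes, rmul_comm (herm_W 0 (-r)) herm_D2, ← rmul_mul _ herm_D2, W_mul_D2, rmul_mul _ herm_D1]

/-- The antiderivative `∂ₓ⁻¹ u_t` along a solution. -/
lemma IsODESol.exists_wt {c : Coeffs} {r : ℝ} {I : Set ℝ} (hI : TimeInterval I) {y : ℝ → State}
    (hy : IsODESol (field c r) I y) {w₁ : L2} (h0 : IsWeakDeriv w₁ (bes r (y 0).2.1)) :
    ∃ w : ℝ → L2, w 0 = w₁ ∧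
      (∀ t ∈ I, HasDerivWithinAt w (rmul D1 (bes r (pot c r (y t).1 (vAt y t)))) I t) ∧
      ∀ t ∈ I, IsWeakDeriv (w t) (bes r (y t).2.1) := by
  have hc : ContinuousOn (fun t => rmul D1 (bes r (pot c r (y t).1 (vAt y t)))) I :=
    continuousOn_rmul _ (continuousOn_rmul _
      (continuousOn_pot c r hy.continuousOn_U hy.continuousOn_vAt))
  set w : ℝ → L2 := fun t => w₁ + ∫ τ in (0 : ℝ)..t, rmul D1 (bes r (pot c r (y τ).1 (vAt y τ)))
    with hw
  have hd : ∀ t ∈ I, HasDerivWithinAt w (rmul D1 (bes r (pot c r (y t).1 (vAt y t)))) I t :=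
    fun t ht => (hI.hasDerivWithinAt_primitive hc ht).const_add w₁
  have hw0 : w 0 = w₁ := by simp [hw]
  refine ⟨w, hw0, hd, fun t ht => ?_⟩
  rw [isWeakDeriv_iff] at h0 ⊢
  have d1 : ∀ t ∈ I, HasDerivWithinAt (fun t => rmul (W (-2) 0) (bes r (y t).2.1))
      (rmul (W (-2) 0) (bes r (rmul D2 (pot c r (y t).1 (vAt y t))))) I t := fun t ht =>
    hasDerivWithinAt_clm (rmul (W (-2) 0))
      (hasDerivWithinAt_clm (bes r) (hy.hasDerivWithinAt_U1 ht))
  have d2 : ∀ t ∈ I, HasDerivWithinAt (fun t => rmul D1 (w t))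
      (rmul (W (-2) 0) (bes r (rmul D2 (pot c r (y t).1 (vAt y t))))) I t := fun t ht => by
    refine (hasDerivWithinAt_clm (rmul D1) (hd t ht)).congr_deriv ?_
    rw [rmul_W_bes_rmul_D2]
  exact hI.eq_of_hasDerivWithinAt_eq d1 d2 (by rw [h0, hw0]) ht

lemma weight_zero_sq (r ξ : ℝ) : weight 0 (-r) ξ ^ 2 * (1 + ξ ^ 2) ^ r = 1 := by
  have h : 0 < 1 + ξ ^ 2 := by positivity
  rw [weight, Real.norm_eq_abs, sq_abs, zero_div, Real.rpow_zero, one_mul, ← Real.rpow_natCast,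
    ← Real.rpow_mul h.le, ← Real.rpow_add h]
  simp

lemma hom_weight_le {r : ℝ} (hr : 1 / 2 < r) {ξ : ℝ} (hξ : ξ ≠ 0) {a b d : ℝ} (hd : 0 ≤ d)
    (hb : 0 ≤ b)
    (h1 : a = (2 * Real.pi * |ξ|) ^ 2 * b) (h2 : a = weight 0 (-r) ξ ^ 2 * d) :
    (2 * Real.pi * |ξ|) ^ (2 * (r - 1)) * a ≤ b + (2 * Real.pi) ^ (2 * r) * d := by
  have hx : 0 < 2 * Real.pi * |ξ| := by positivity
  rcases le_total (2 * Real.pi * |ξ|) 1 with h | h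
  · have e1 : (2 * Real.pi * |ξ|) ^ (2 * (r - 1)) * a = (2 * Real.pi * |ξ|) ^ (2 * r) * b := by
      rw [h1, ← mul_assoc, ← Real.rpow_natCast, ← Real.rpow_add hx]
      congr 2; push_cast; ring
    rw [e1]
    have : (2 * Real.pi * |ξ|) ^ (2 * r) ≤ 1 := Real.rpow_le_one hx.le h (by linarith)
    have h3 : 0 ≤ (2 * Real.pi) ^ (2 * r) * d := by positivity
    nlinarith
  · have e1 : (2 * Real.pi * |ξ|) ^ (2 * (r - 1)) ≤ (2 * Real.pi) ^ (2 * r) * (1 + ξ ^ 2) ^ r := by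
      calc _ ≤ (2 * Real.pi * |ξ|) ^ (2 * r) := Real.rpow_le_rpow_of_exponent_le h (by linarith)
        _ = (2 * Real.pi) ^ (2 * r) * (ξ ^ 2) ^ r := by
          rw [Real.mul_rpow (by positivity) (abs_nonneg _), Real.rpow_mul (abs_nonneg ξ)]
          norm_num
        _ ≤ _ := by
          gcongr
          linarith
    have hw : 0 ≤ weight 0 (-r) ξ ^ 2 * d := by positivity
    calc _ ≤ (2 * Real.pi) ^ (2 * r) * (1 + ξ ^ 2) ^ r * a := by rw [h2]; gcongr
      _ = (2 * Real.pi) ^ (2 * r) * d * (weight 0 (-r) ξ ^ 2 * (1 + ξ ^ 2) ^ r) := by rw [h2]; ring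
      _ = (2 * Real.pi) ^ (2 * r) * d := by rw [weight_zero_sq, mul_one]
      _ ≤ _ := by linarith

lemma norm_dsym (ξ : ℝ) : ‖dsym ξ‖ = 2 * Real.pi * |ξ| := by
  simp [dsym, abs_of_pos Real.pi_pos]

/-- Low frequencies are controlled by the antiderivative and high frequencies by the `H^r` norm. -/
lemma homSobolevNorm_le {r : ℝ} (hr : 1 / 2 < r) {w G : L2} (h : IsWeakDeriv w (bes r G)) :
    homSobolevNorm (r - 1) (bes r G) ≤
      (‖w‖ₑ ^ 2 + ENNReal.ofReal ((2 * Real.pi) ^ (2 * r)) * ‖G‖ₑ ^ 2) ^ (1 / 2 : ℝ) := by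
  rw [homSobolevNorm]
  gcongr
  rw [← (show ‖toC w‖ₑ = ‖w‖ₑ by rw [enorm_eq_iff_norm_eq, norm_toC]),
    ← (show ‖toC G‖ₑ = ‖G‖ₑ by rw [enorm_eq_iff_norm_eq, norm_toC])]
  have hf (f : L2C) : ‖f‖ₑ = ‖(𝓕 f : L2C)‖ₑ := by rw [enorm_eq_iff_norm_eq, Lp.norm_fourier_eq]
  rw [hf (toC w), hf (toC G), L2C_enorm_sq, L2C_enorm_sq,
    ← lintegral_const_mul' _ _ ENNReal.ofReal_ne_top,
    ← lintegral_add_left' ((Lp.aestronglyMeasurable _).enorm.pow_const 2)]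
  refine lintegral_mono_ae ?_
  have e1 : mulSym (W (-2) 0) (𝓕 (toC (bes r G)) : L2C) = mulSym D1 (𝓕 (toC w) : L2C) := by
    rw [← fourier_fmul, ← fourier_fmul, ← toC_rmul (herm_W _ _), ← toC_rmul herm_D1,
      (isWeakDeriv_iff _ _).1 h]
  have e2 : (𝓕 (toC (bes r G)) : L2C) = mulSym (W 0 (-r)) (𝓕 (toC G) : L2C) := by
    rw [← fourier_fmul, toC_bes]
  have a1 := coeFn_mulSym (W (-2) 0) (𝓕 (toC (bes r G)) : L2C)
  rw [e1] at a1
  have a2 := coeFn_mulSym (W 0 (-r)) (𝓕 (toC G) : L2C)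
  rw [← e2] at a2
  have hne : ∀ᵐ ξ : ℝ, ξ ≠ 0 := by simp [ae_iff]
  filter_upwards [a1, a2, coeFn_mulSym D1 (𝓕 (toC w) : L2C), hne] with ξ h1 h2 h3 h4
  rw [h3, coe_D1, W_apply (by norm_num)] at h1
  rw [W_apply (by linarith)] at h2
  rw [toComplex_eq]
  set A : ℂ := (𝓕 (toC (bes r G)) : L2C) ξ
  set B : ℂ := (𝓕 (toC w) : L2C) ξ
  set D : ℂ := (𝓕 (toC G) : L2C) ξ
  have hA : A = dsym ξ * B := by
    have hw : (weight (-2) 0 ξ : ℂ) ≠ 0 := by exact_mod_cast (weight_pos _ _ _).ne'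
    apply mul_left_cancel₀ hw
    rw [← h1]; change dsym ξ * (weight (-2) 0 ξ : ℂ) * B = _; ring
  have k1 : ‖A‖ ^ 2 = (2 * Real.pi * |ξ|) ^ 2 * ‖B‖ ^ 2 := by
    rw [hA, norm_mul, norm_dsym, mul_pow]
  have k2 : ‖A‖ ^ 2 = weight 0 (-r) ξ ^ 2 * ‖D‖ ^ 2 := by
    rw [h2, norm_mul, Complex.norm_real, Real.norm_of_nonneg (weight_pos _ _ _).le, mul_pow]
  have key := hom_weight_le hr h4 (sq_nonneg ‖D‖) (sq_nonneg ‖B‖) k1 k2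
  have en (z : ℂ) : ‖z‖ₑ ^ 2 = ENNReal.ofReal (‖z‖ ^ 2) := by
    rw [← ofReal_norm, ENNReal.ofReal_pow (norm_nonneg _)]
  rw [en, en, en, ← ENNReal.ofReal_mul (by positivity), ← ENNReal.ofReal_mul (by positivity),
    ← ENNReal.ofReal_add (by positivity) (by positivity)]
  exact ENNReal.ofReal_le_ofReal key

lemma IsWeakDeriv.sub {w g w' g' : L2} (h : IsWeakDeriv w g) (h' : IsWeakDeriv w' g') :
    IsWeakDeriv (w - w') (g - g') := by
  rw [isWeakDeriv_iff] at *
  rw [map_sub, map_sub, h, h']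

lemma homSobolevContinuousOn_of {r : ℝ} (hr : 1 / 2 < r) {I : Set ℝ} {w G : ℝ → L2}
    (hw : ContinuousOn w I) (hG : ContinuousOn G I) (h : ∀ t ∈ I, IsWeakDeriv (w t) (bes r (G t))) :
    HomSobolevContinuousOn (r - 1) I (fun t => bes r (G t)) := by
  refine ⟨fun t ht => (homSobolevNorm_le hr (h t ht)).trans_lt ?_, fun t₀ ht₀ => ?_⟩
  · refine ENNReal.rpow_lt_top_of_nonneg (by norm_num) (ENNReal.add_ne_top.2 ⟨?_, ?_⟩)
    · exact ENNReal.pow_ne_top enorm_ne_top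
    · exact ENNReal.mul_ne_top ENNReal.ofReal_ne_top (ENNReal.pow_ne_top enorm_ne_top)
  · have lim : ∀ {f : ℝ → L2}, ContinuousOn f I →
        Tendsto (fun t => ‖f t - f t₀‖ₑ ^ 2) (𝓝[I] t₀) (𝓝 0) := fun {f} hf => by
      have h2 : Tendsto (fun t => f t - f t₀) (𝓝[I] t₀) (𝓝 0) := by
        simpa using (hf t₀ ht₀).tendsto.sub_const (f t₀)
      have h3 : Tendsto (fun t => ‖f t - f t₀‖ₑ) (𝓝[I] t₀) (𝓝 0) := by simpa using h2.enorm
      simpa using ENNReal.Tendsto.pow (n := 2) h3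
    have h4 : Tendsto (fun t => (‖w t - w t₀‖ₑ ^ 2 +
        ENNReal.ofReal ((2 * Real.pi) ^ (2 * r)) * ‖G t - G t₀‖ₑ ^ 2) ^ (1 / 2 : ℝ))
        (𝓝[I] t₀) (𝓝 0) := by
      have h5 := (lim hw).add (ENNReal.Tendsto.const_mul (a := ENNReal.ofReal
        ((2 * Real.pi) ^ (2 * r))) (lim hG) (Or.inr ENNReal.ofReal_ne_top))
      have h6 := h5.ennrpow_const (1 / 2 : ℝ)
      simpa using h6
    refine tendsto_of_tendsto_of_tendsto_of_le_of_le' tendsto_const_nhds h4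
      (Eventually.of_forall fun _ => zero_le) ?_
    filter_upwards [self_mem_nhdsWithin] with t ht
    have h7 := (h t ht).sub (h t₀ ht₀)
    rw [← map_sub] at h7 ⊢
    exact homSobolevNorm_le hr h7

/-- Initial data of regularity `σ`, with the antiderivative of `u₁`. -/
structure IsRegularData (r σ : ℝ) (u₀ u₁ v₀ v₁ w₁ : L2) (y₀ : State) (Y₀ : L2C) : Prop where
  data : IsData r u₀ u₁ v₀ v₁ y₀
  profile : y₀.2.2 = fmul (W 0 (r - σ)) Y₀
  weak : IsWeakDeriv w₁ u₁

/-- `v_t` in terms of the profile. -/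
def vtOf (σ : ℝ) (Y : ℝ → L2C) (t : ℝ) : L2 := rmul (W 1 (-σ)) (imL (halfWave Y t))

lemma IsRegularData.vtOf_eq {r σ : ℝ} (hrσ : r ≤ σ) (hσ : 1 ≤ σ) {u₀ u₁ v₀ v₁ w₁ : L2} {y₀ : State}
    {Y₀ : L2C} (hd : IsRegularData r σ u₀ u₁ v₀ v₁ w₁ y₀ Y₀) {Y : ℝ → L2C} (hY : Y 0 = Y₀) :
    vtOf σ Y 0 = v₁ := by
  apply toDist_injective
  rw [hd.data.vt, vtOf, halfWave, neg_zero, wave_zero, fmul_one, hY, hd.profile,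
    imL_fmul (herm_W _ _), ← dmul_weightC_toDist (by linarith),
    ← dmul_weightC_toDist (by linarith), dmul_weightC_dmul_weightC]
  rw [show -r + (r - σ) = -σ by ring, add_zero]

lemma vAt_zero (y : ℝ → State) : vAt y 0 = reL (y 0).2.2 := by
  rw [vAt, vOf, neg_zero, wave_zero, fmul_one]

lemma continuousOn_reL {I : Set ℝ} {f : ℝ → L2C} (hf : ContinuousOn f I) :
    ContinuousOn (fun t => reL (f t)) I := reL.continuous.comp_continuousOn hf

lemma continuousOn_imL {I : Set ℝ} {f : ℝ → L2C} (hf : ContinuousOn f I) :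
    ContinuousOn (fun t => imL (f t)) I := imL.continuous.comp_continuousOn hf

lemma bessel_toDist_bes {s σ : ℝ} (hσ : 0 ≤ σ) (hsσ : s ≤ σ) (f : L2) :
    TemperedDistribution.besselPotential ℝ ℂ s (toDist (bes σ f)) =
      tdist (toC (rmul (W 0 (s - σ)) f)) := by
  rw [besselPotential_eq, toDist_bes _ hσ, dmul_weightC_dmul_weightC,
    show s + -σ = s - σ by ring, add_zero, dmul_weightC_toDist (by linarith), toDist_eq]

lemma bessel_toDist_vt {s σ : ℝ} (hσ : 1 ≤ σ) (hsσ : s ≤ σ) (f : L2) :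
    TemperedDistribution.besselPotential ℝ ℂ (s - 1) (toDist (rmul (W 1 (-σ)) f)) =
      tdist (toC (rmul (W 1 (s - 1 - σ)) f)) := by
  rw [besselPotential_eq, ← dmul_weightC_toDist (by linarith), dmul_weightC_dmul_weightC,
    show s - 1 + -σ = s - 1 - σ by ring, zero_add, dmul_weightC_toDist (by linarith), toDist_eq]

lemma bessel_toDist_bes_self {r : ℝ} (hr : 0 ≤ r) (f : L2) :
    TemperedDistribution.besselPotential ℝ ℂ r (toDist (bes r f)) = tdist (toC f) := by
  rw [besselPotential_eq, toDist_bes _ hr, dmul_weightC_dmul_weightC]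
  simp [dmul_weightC_zero_zero, toDist_eq]

section

variable {I : Set ℝ} {c : Coeffs} {r s σ T : ℝ} {y : ℝ → State} {Y : ℝ → L2C}

lemma IsRegularProfile.bes_vAt (hr : 0 ≤ r) (hrσ : r ≤ σ) (h : IsRegularProfile c r σ I y Y) {t : ℝ}
    (ht : t ∈ I) : bes r (vAt y t) = bes σ (reL (halfWave Y t)) := by
  rw [h.vAt_eq ht, bes_rmul_W hr hrσ]

lemma IsRegularProfile.hasTimeDeriv_v (hr : 0 ≤ r) (hrσ : r ≤ σ) (hσr : σ ≤ r + 1) (hσ : 1 ≤ σ)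
    (h : IsRegularProfile c r σ I y Y) {t : ℝ} (ht : t ∈ I) :
    HasTimeDeriv I (fun τ => toDist (bes r (vAt y τ))) (toDist (vtOf σ Y t)) t := by
  have h1 := (hasTimeDeriv_toDist (h.hasDerivWithinAt_re hσr ht)).dmul (weightC 1 (-σ))
  rw [dmul_weightC_toDist (by linarith)] at h1
  refine h1.congr ht fun τ hτ => ?_
  rw [h.bes_vAt hr hrσ hτ, ← dmul_weightC_toDist (by norm_num), dmul_weightC_dmul_weightC,
    toDist_bes _ (by linarith)]
  norm_num

lemma IsRegularProfile.hasTimeDeriv_vt (hr : 1 / 2 < r) (hrσ : r ≤ σ) (hσr : σ ≤ r + 1)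
    (hσ : 1 ≤ σ) (h : IsRegularProfile c r σ I y Y) {t : ℝ} (ht : t ∈ I) :
    HasTimeDeriv I (fun τ => toDist (vtOf σ Y τ))
      (dx (dx (toDist (bes r (vAt y t)))) - toDist (bes r (vAt y t)) +
        toDist (f₂ c (bes r (y t).1) (bes r (vAt y t)))) t := by
  have h1 := (hasTimeDeriv_toDist (h.hasDerivWithinAt_im hσr ht)).dmul (weightC 2 (-σ))
  have e1 : dmul (weightC 2 (-σ)) (toDist (-reL (halfWave Y t) +
      rmul (W (-2) (σ - r)) (nl₂ c r (y t).1 (vAt y t)))) =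
      dx (dx (toDist (bes r (vAt y t)))) - toDist (bes r (vAt y t)) +
        toDist (f₂ c (bes r (y t).1) (bes r (vAt y t))) := by
    rw [dx_dx_sub_self, toDist_f₂ hr, h.bes_vAt (by linarith) hrσ ht, toDist_add, map_add,
      toDist_bes _ (by linarith), toDist_bes _ (by linarith), dmul_weightC_dmul_weightC,
      ← dmul_weightC_toDist (by linarith), dmul_weightC_dmul_weightC]
    have e2 : toDist (-reL (halfWave Y t)) = -toDist (reL (halfWave Y t)) := by
      rw [toDist_eq, map_neg, map_neg, toDist_eq]
    rw [e2, map_neg, show (2 : ℝ) + -2 = 0 by norm_num, show -σ + (σ - r) = -r by ring, add_zero, zero_add]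
  rw [e1] at h1
  refine h1.congr ht fun τ hτ => ?_
  rw [vtOf, ← dmul_weightC_toDist (by linarith), ← dmul_weightC_toDist (by norm_num),
    dmul_weightC_dmul_weightC]
  norm_num

lemma IsODESol.isSolution {u₀ u₁ v₀ v₁ w₁ : L2} {Y₀ : L2C} (hr : 1 / 2 < r) (hrs : r ≤ s)
    (hsσ : s ≤ σ) (hσr : σ ≤ r + 1) (hσ : 1 ≤ σ) (hT : 0 < T)
    (hy : IsODESol (field c r) (Ico 0 T) y)
    (hd : IsRegularData r σ u₀ u₁ v₀ v₁ w₁ (y 0) Y₀) (hY : IsRegularProfile c r σ (Ico 0 T) y Y)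
    (hY0 : Y 0 = Y₀) :
    IsSolution c r s T u₀ u₁ v₀ v₁ (fun t => bes r (y t).1) (fun t => bes r (y t).2.1)
      (fun t => bes r (vAt y t)) (fun t => toDist (vtOf σ Y t)) := by
  have hr0 : 0 ≤ r := by linarith
  have hI := timeInterval_Ico hT
  have hZ := hY.continuousOn_halfWave
  have hrσ : r ≤ σ := hrs.trans hsσ
  obtain ⟨w, -, hw, hw'⟩ := hy.exists_wt hI (w₁ := w₁) (by rw [← hd.data.ut]; exact hd.weak)
  refine ⟨?_, ?_, ?_, ?_, ?_, ?_, ?_, ?_, ?_, ?_, ?_, ?_, ?_⟩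
  · exact sobolevContinuousOn_of (fun t _ => bessel_toDist_bes_self hr0 _)
      (continuousOn_toC hy.continuousOn_U)
  · exact sobolevContinuousOn_of (fun t _ => bessel_toDist_bes_self hr0 _)
      (continuousOn_toC hy.continuousOn_U1)
  · exact homSobolevContinuousOn_of hr (fun t ht => (hw t ht).continuousWithinAt)
      hy.continuousOn_U1 hw'
  · exact sobolevContinuousOn_of (fun t ht => by
      rw [hY.bes_vAt hr0 hrσ ht, bessel_toDist_bes (by linarith) hsσ])
      (continuousOn_toC (continuousOn_rmul _ (continuousOn_reL hZ)))
  · exact sobolevContinuousOn_of (fun t ht => bessel_toDist_vt hσ hsσ _)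
      (continuousOn_toC (continuousOn_rmul _ (continuousOn_imL hZ)))
  · exact fun t ht => hasTimeDeriv_toDist (hasDerivWithinAt_clm (bes r) (hy.hasDerivWithinAt_U ht))
  · exact fun t ht => hY.hasTimeDeriv_v hr0 hrσ hσr hσ ht
  · exact fun t ht => ⟨_, hasTimeDeriv_toDist
      (hasDerivWithinAt_clm (bes r) (hy.hasDerivWithinAt_U1 ht)), (utt_eq_iff hr c _ _ _).2 rfl⟩
  · exact fun t ht => hY.hasTimeDeriv_vt hr hrσ hσr hσ ht
  · exact hd.data.u.symm
  · exact hd.data.ut.symm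
  · rw [hd.data.v, vAt_zero]
  · rw [hd.vtOf_eq hrσ hσ hY0]

lemma norm_state_le (hrs : r ≤ s) (hsσ : s ≤ σ)
    (h : IsRegularProfile c r σ I y Y) {t : ℝ} (ht : t ∈ I) :
    ‖y t‖ ≤ ‖(y t).1‖ + ‖(y t).2.1‖ + ‖rmul (W 0 (s - σ)) (reL (halfWave Y t))‖ +
      weightBound (-1) * ‖rmul (W 1 (s - 1 - σ)) (imL (halfWave Y t))‖ := by
  have hw := weightBound_nonneg (-1)
  have e : fmul (wave (-t)) (y t).2.2 = fmul (W 0 (r - σ)) (halfWave Y t) := by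
    rw [h.eq t ht, fmul_comm]; rfl
  have h1 : ‖(y t).2.2‖ ≤ ‖rmul (W 0 (s - σ)) (reL (halfWave Y t))‖ +
      weightBound (-1) * ‖rmul (W 1 (s - 1 - σ)) (imL (halfWave Y t))‖ := by
    rw [← norm_fmul_wave (-t), e, fmul_eq_re_im (herm_W _ _)]
    refine (norm_add_le _ _).trans (add_le_add ?_ ?_)
    · rw [norm_toC, ← rW_add_mul (p := 0) (q := r - s) (p' := 0) (q' := s - σ) (by linarith)
        (by linarith) (zero_add _) (by ring)]
      simpa using norm_rmul_le_of_bound (W 0 (r - s)) (norm_W_zero_le (by linarith)) _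
    · rw [norm_smul, Complex.norm_I, one_mul, norm_toC,
        ← rW_add_mul (p := -1) (q := r - s + 1) (p' := 1) (q' := s - 1 - σ) (by linarith)
        (by linarith) (by norm_num) (by ring)]
      exact norm_rmul_le_of_bound _ (norm_W_le (by linarith)) _
  have h2 : ‖y t‖ ≤ ‖(y t).1‖ + (‖(y t).2.1‖ + ‖(y t).2.2‖) := by
    refine norm_prod_le_iff.2 ⟨by linarith [norm_nonneg (y t).2.1, norm_nonneg (y t).2.2],
      norm_prod_le_iff.2 ⟨?_, ?_⟩⟩ <;>
      linarith [norm_nonneg (y t).1, norm_nonneg (y t).2.1, norm_nonneg (y t).2.2]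
  linarith

/-- If the state blows up, so do the Sobolev norms of the solution. -/
lemma tendsto_solNorm (hr : 0 ≤ r) (hrs : r ≤ s) (hsσ : s ≤ σ) (hσ : 1 ≤ σ)
    (hT : 0 < T) (hY : IsRegularProfile c r σ (Ico 0 T) y Y)
    (hlim : Tendsto (fun t => ‖y t‖) (𝓝[<] T) atTop) :
    Tendsto (fun t => solNorm r s (bes r (y t).1) (bes r (y t).2.1) (bes r (vAt y t))
      (toDist (vtOf σ Y t))) (𝓝[<] T) (𝓝 ∞) := by
  have hw := weightBound_nonneg (-1)
  set K : ℝ := 1 + weightBound (-1) with hK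
  have hK0 : 0 < K := by positivity
  have h1 : Tendsto (fun t => ENNReal.ofReal (‖y t‖ / K)) (𝓝[<] T) (𝓝 ∞) :=
    ENNReal.tendsto_ofReal_atTop.comp (hlim.atTop_div_const hK0)
  refine tendsto_of_tendsto_of_tendsto_of_le_of_le' h1 tendsto_const_nhds ?_
    (Eventually.of_forall fun _ => le_top)
  have hmem : Ico 0 T ∈ 𝓝[<] T := Ico_mem_nhdsLT hT
  filter_upwards [hmem] with t ht
  have h2 := norm_state_le hrs hsσ hY ht
  rw [solNorm, sobolevNorm_eq (bessel_toDist_bes_self hr _),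
    sobolevNorm_eq (bessel_toDist_bes_self hr _), hY.bes_vAt hr (hrs.trans hsσ) ht,
    sobolevNorm_eq (bessel_toDist_bes (by linarith) hsσ _), vtOf,
    sobolevNorm_eq (bessel_toDist_vt hσ hsσ _)]
  simp only [← ofReal_norm, norm_toC]
  refine le_trans (b := ENNReal.ofReal (‖(y t).1‖) + (ENNReal.ofReal (‖(y t).2.1‖)) +
    (ENNReal.ofReal ‖rmul (W 0 (s - σ)) (reL (halfWave Y t))‖ +
      ENNReal.ofReal ‖rmul (W 1 (s - 1 - σ)) (imL (halfWave Y t))‖)) ?_ ?_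
  · rw [← ENNReal.ofReal_add (norm_nonneg _) (norm_nonneg _),
      ← ENNReal.ofReal_add (norm_nonneg _) (norm_nonneg _),
      ← ENNReal.ofReal_add (by positivity) (by positivity)]
    apply ENNReal.ofReal_le_ofReal
    rw [div_le_iff₀ hK0, hK]
    refine h2.trans ?_
    have n1 := norm_nonneg (y t).1
    have n2 := norm_nonneg (y t).2.1
    have n3 := norm_nonneg (rmul (W 0 (s - σ)) (reL (halfWave Y t)))
    have n4 := norm_nonneg (rmul (W 1 (s - 1 - σ)) (imL (halfWave Y t)))
    nlinarith [mul_nonneg hw n1, mul_nonneg hw n2, mul_nonneg hw n3]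
  · gcongr
    exact le_self_add

end

/-- The blow-up alternative: if the maximal solution of the differential equation is not global,
then the local solution of the system blows up in finite time. -/
theorem blowsUpInFiniteTime_of_not_global {c : Coeffs} {r s σ : ℝ} (hr : 1 / 2 < r) (hrs : r ≤ s)
    (hsσ : s ≤ σ) (hσr : σ ≤ r + 1) (hσ : 1 ≤ σ) {u₀ u₁ v₀ v₁ w₁ : L2} {y₀ : State} {Y₀ : L2C}
    (hd : IsRegularData r σ u₀ u₁ v₀ v₁ w₁ y₀ Y₀)
    (hg : ∀ y : ℝ → State, y 0 = y₀ → ¬ IsODESol (field c r) (Ici 0) y) :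
    BlowsUpInFiniteTime c r s u₀ u₁ v₀ v₁ := by
  obtain ⟨y, hy0, hy | ⟨T, hT, hy, hlim⟩⟩ := (locLip_field c r).exists_maximal y₀
  · exact absurd hy (hg y hy0)
  have hr0 : 0 ≤ r := by linarith
  subst hy0
  obtain ⟨Y, hY0, hY⟩ := hy.exists_isRegularProfile (hrs.trans hsσ) hσr (timeInterval_Ico hT)
    hd.profile
  refine ⟨T, fun t => bes r (y t).1, fun t => bes r (y t).2.1, fun t => bes r (vAt y t),
    fun t => toDist (vtOf σ Y t), hT, hy.isSolution hr hrs hsσ hσr hσ hT hd hY hY0, ?_,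
    tendsto_solNorm hr0 hrs hsσ hσ hT hY hlim⟩
  intro T' u' ut' v' vt' hT' hsol
  obtain ⟨z, hz, hzd, hzuv⟩ := hsol.exists_isODESol hr hrs hT'
  have hz0 : z 0 = y 0 := hzd.eq hr0 hd.data
  have hTT : T' ≤ T := by
    by_contra! hlt
    have hmem : T ∈ Ico 0 T' := ⟨hT.le, hlt⟩
    have h1 : Tendsto (fun t => ‖z t‖) (𝓝[<] T) (𝓝 ‖z T‖) := by
      refine ((hz.continuousOn T hmem).norm).mono_left ?_
      exact nhdsWithin_le_iff.2 (mem_of_superset (Ico_mem_nhdsLT hT)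
        (Ico_subset_Ico_right hlt.le))
    have h2 : Tendsto (fun t => ‖z t‖) (𝓝[<] T) atTop := by
      refine hlim.congr' ?_
      filter_upwards [Ico_mem_nhdsLT hT] with t ht
      rw [hy.unique (locLip_field c r) (timeInterval_Ico hT)
        (hz.mono (Ico_subset_Ico_right hlt.le)) hz0.symm ht]
    exact not_tendsto_nhds_of_tendsto_atTop h2 _ h1
  refine ⟨hTT, fun t ht => ?_⟩
  have e : z t = y t := hz.unique (locLip_field c r) (timeInterval_Ico hT')
    (hy.mono (Ico_subset_Ico_right hTT)) hz0 ht
  rw [(hzuv t ht).1, (hzuv t ht).2, e]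
  exact ⟨rfl, rfl⟩

section Concavity

variable {f f' f'' k : ℝ → ℝ} {E a : ℝ}

lemma monotoneOn_of_hasDerivAt {g g' : ℝ → ℝ} {a b : ℝ} (hc : ContinuousOn g (Icc a b))
    (hd : ∀ t ∈ Ioo a b, HasDerivAt g (g' t) t) (h : ∀ t ∈ Ioo a b, 0 ≤ g' t) :
    MonotoneOn g (Icc a b) := by
  refine monotoneOn_of_deriv_nonneg (convex_Icc a b) hc ?_ ?_
  · rw [interior_Icc]
    exact fun t ht => (hd t ht).differentiableAt.differentiableWithinAt
  · rw [interior_Icc]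
    exact fun t ht => by rw [(hd t ht).deriv]; exact h t ht

/-- As long as `f` increases, the quantity `(f'² - 8 E f) f^(-5/2)` does not decrease. -/
lemma virial_monotone {b : ℝ} (hfc : ContinuousOn f (Icc a b))
    (hfc' : ContinuousOn f' (Icc a b))
    (hf : ∀ t ∈ Ioo a b, HasDerivAt f (f' t) t) (hf' : ∀ t ∈ Ioo a b, HasDerivAt f' (f'' t) t)
    (hk : ∀ t ∈ Ioo a b, f' t ^ 2 ≤ 4 * f t * k t)
    (hconv : ∀ t ∈ Ioo a b, 5 * k t - 6 * E ≤ f'' t) (hpos : ∀ t ∈ Icc a b, 0 < f t)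
    (hpos' : ∀ t ∈ Ioo a b, 0 < f' t) :
    MonotoneOn (fun t => (f' t ^ 2 - 8 * E * f t) * f t ^ (-(5 / 2) : ℝ)) (Icc a b) := by
  refine monotoneOn_of_hasDerivAt (g' := fun t =>
    (2 * f' t * f'' t - 8 * E * f' t) * f t ^ (-(5 / 2) : ℝ) +
      (f' t ^ 2 - 8 * E * f t) * (f' t * (-(5 / 2)) * f t ^ (-(5 / 2) - 1 : ℝ))) ?_ ?_ ?_
  · exact ((hfc'.pow 2).sub (continuousOn_const.mul hfc)).mul
      (hfc.rpow_const fun t ht => Or.inl (hpos t ht).ne')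
  · intro t ht
    have h1 := ((hf' t ht).pow 2).sub ((hf t ht).const_mul (8 * E))
    have h2 := (hf t ht).rpow_const (p := -(5 / 2)) (Or.inl (hpos t (Ioo_subset_Icc_self ht)).ne')
    refine (h1.mul h2).congr_deriv ?_
    simp
  · intro t ht
    have h0 := hpos t (Ioo_subset_Icc_self ht)
    have h1 := hpos' t ht
    have e : f t ^ (-(5 / 2) : ℝ) = f t ^ (-(5 / 2) - 1 : ℝ) * f t := by
      rw [← Real.rpow_add_one h0.ne']; norm_num
    have h2 : 0 ≤ f t ^ (-(5 / 2) - 1 : ℝ) := by positivity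
    have h3 : 0 ≤ 2 * f t * f'' t + 12 * E * f t - 5 / 2 * f' t ^ 2 := by
      nlinarith [hk t ht, mul_le_mul_of_nonneg_left (hconv t ht) h0.le]
    rw [e]
    have : (2 * f' t * f'' t - 8 * E * f' t) * (f t ^ (-(5 / 2) - 1 : ℝ) * f t) +
      (f' t ^ 2 - 8 * E * f t) * (f' t * (-(5 / 2)) * f t ^ (-(5 / 2) - 1 : ℝ)) =
      f' t * f t ^ (-(5 / 2) - 1 : ℝ) * (2 * f t * f'' t + 12 * E * f t - 5 / 2 * f' t ^ 2) := by
      ring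
    rw [this]
    positivity

/-- Levine's concavity argument, in the form that allows positive energy. -/
lemma false_of_virial_of_nonneg (hE : 0 ≤ E)
    (hfc : ContinuousOn f (Ici a)) (hfc' : ContinuousOn f' (Ici a))
    (hf : ∀ t ∈ Ioi a, HasDerivAt f (f' t) t) (hf' : ∀ t ∈ Ioi a, HasDerivAt f' (f'' t) t)
    (hk : ∀ t ∈ Ioi a, f' t ^ 2 ≤ 4 * f t * k t)
    (hconv : ∀ t ∈ Ioi a, 5 * k t - 6 * E ≤ f'' t) (h0 : 0 < f a) (h0' : 0 < f' a)
    (h1 : 8 * E * f a < f' a ^ 2) : False := by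
  set G : ℝ → ℝ := fun t => (f' t ^ 2 - 8 * E * f t) * f t ^ (-(5 / 2) : ℝ) with hG
  have hGa : 0 < G a := mul_pos (by linarith) (Real.rpow_pos_of_pos h0 _)
  have main : ∀ b, a ≤ b → (∀ t ∈ Ico a b, 0 < f' t) →
      (∀ t ∈ Icc a b, f a ≤ f t) ∧ G a ≤ G b := by
    intro b hab hb
    have hmono : MonotoneOn f (Icc a b) := monotoneOn_of_hasDerivAt
      (hfc.mono Icc_subset_Ici_self) (fun t ht => hf t ht.1)
      (fun t ht => (hb t (Ioo_subset_Ico_self ht)).le)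
    have hge : ∀ t ∈ Icc a b, f a ≤ f t := fun t ht => hmono ⟨le_rfl, hab⟩ ht ht.1
    refine ⟨hge, ?_⟩
    exact virial_monotone (hfc.mono Icc_subset_Ici_self) (hfc'.mono Icc_subset_Ici_self)
      (fun t ht => hf t ht.1) (fun t ht => hf' t ht.1) (fun t ht => hk t ht.1)
      (fun t ht => hconv t ht.1) (fun t ht => h0.trans_le (hge t ht))
      (fun t ht => hb t (Ioo_subset_Ico_self ht)) ⟨le_rfl, hab⟩ ⟨hab, le_rfl⟩ hab
  have hfG : ∀ b, a ≤ b → (∀ t ∈ Ico a b, 0 < f' t) →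
      0 < f b ∧ G a * f b ^ (5 / 2 : ℝ) ≤ f' b ^ 2 := by
    intro b hab hb
    obtain ⟨h2, h3⟩ := main b hab hb
    have h4 : 0 < f b := h0.trans_le (h2 b ⟨hab, le_rfl⟩)
    refine ⟨h4, ?_⟩
    calc G a * f b ^ (5 / 2 : ℝ) ≤ G b * f b ^ (5 / 2 : ℝ) := by gcongr
      _ = f' b ^ 2 - 8 * E * f b := by
        rw [hG, mul_assoc, ← Real.rpow_add h4]; simp
      _ ≤ _ := by have := mul_nonneg hE h4.le; linarith
  have hpos' : ∀ t, a ≤ t → 0 < f' t := by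
    by_contra! hneg
    obtain ⟨t₂, hat₂, ht₂⟩ := hneg
    set S : Set ℝ := Icc a t₂ ∩ f' ⁻¹' Iic 0 with hS
    have hScl : IsClosed S := (hfc'.mono Icc_subset_Ici_self).preimage_isClosed_of_isClosed
      isClosed_Icc isClosed_Iic
    have hSne : S.Nonempty := ⟨t₂, ⟨hat₂, le_rfl⟩, ht₂⟩
    have hSb : BddBelow S := ⟨a, fun t ht => ht.1.1⟩
    set t₁ := sInf S
    have ht₁ : t₁ ∈ S := hScl.csInf_mem hSne hSb
    have hlt : ∀ t ∈ Ico a t₁, 0 < f' t := by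
      intro t ht
      by_contra! hle
      exact absurd (csInf_le hSb ⟨⟨ht.1, ht.2.le.trans ht₁.1.2⟩, hle⟩) (not_le.2 ht.2)
    have hat₁ : a < t₁ := by
      refine lt_of_le_of_ne ht₁.1.1 fun h => ?_
      have : f' t₁ ≤ 0 := ht₁.2
      rw [← h] at this; linarith
    have hge : 0 ≤ f' t₁ := by
      have hcont : Tendsto f' (𝓝[Ico a t₁] t₁) (𝓝 (f' t₁)) :=
        (hfc' t₁ hat₁.le).mono_left (nhdsWithin_mono _ Ico_subset_Ici_self)
      have : (𝓝[Ico a t₁] t₁).NeBot := by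
        rw [nhdsWithin_Ico_eq_nhdsLT hat₁]; infer_instance
      exact ge_of_tendsto hcont (by
        filter_upwards [self_mem_nhdsWithin] with t ht using (hlt t ht).le)
    obtain ⟨h2, h3⟩ := hfG t₁ hat₁.le hlt
    have h4 : f' t₁ = 0 := le_antisymm ht₁.2 hge
    rw [h4] at h3
    have : 0 < G a * f t₁ ^ (5 / 2 : ℝ) := by positivity
    linarith
  have hall : ∀ t, a ≤ t → 0 < f t ∧ √(G a) * f t ^ (5 / 4 : ℝ) ≤ f' t := by
    intro t ht
    obtain ⟨h2, h3⟩ := hfG t ht (fun s hs => hpos' s hs.1)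
    refine ⟨h2, ?_⟩
    refine le_of_sq_le_sq ?_ (hpos' t ht).le
    rw [mul_pow, Real.sq_sqrt hGa.le, ← Real.rpow_natCast, ← Real.rpow_mul h2.le]
    norm_num
    exact h3
  set K := √(G a) / 4
  have hK : 0 < K := by positivity
  have hanti : ∀ b, a ≤ b → f b ^ (-(1 / 4) : ℝ) ≤ f a ^ (-(1 / 4) : ℝ) - K * (b - a) := by
    intro b hab
    have hm := monotoneOn_of_hasDerivAt (a := a) (b := b)
      (g := fun t => -f t ^ (-(1 / 4) : ℝ) - K * (t - a))
      (g' := fun t => -(f' t * (-(1 / 4)) * f t ^ (-(1 / 4) - 1 : ℝ)) - K) ?_ ?_ ?_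
      ⟨le_rfl, hab⟩ ⟨hab, le_rfl⟩ hab
    · simp only [sub_self, mul_zero, sub_zero] at hm
      linarith
    · refine ((hfc.mono Icc_subset_Ici_self).rpow_const
        fun t ht => Or.inl (hall t ht.1).1.ne').neg.sub ?_
      fun_prop
    · intro t ht
      have h2 := (hf t ht.1).rpow_const (p := -(1 / 4)) (Or.inl (hall t ht.1.le).1.ne')
      refine (h2.neg.sub (((hasDerivAt_id t).sub_const a).const_mul K)).congr_deriv ?_
      simp
    · intro t ht
      obtain ⟨h2, h3⟩ := hall t ht.1.le
      have e : f t ^ (5 / 4 : ℝ) * f t ^ (-(1 / 4) - 1 : ℝ) = 1 := by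
        rw [← Real.rpow_add h2]; norm_num
      have h4 : 0 < f t ^ (-(1 / 4) - 1 : ℝ) := by positivity
      have h5 := mul_le_mul_of_nonneg_right h3 h4.le
      rw [mul_assoc, e] at h5
      simp only [K]
      linarith
  set b := a + f a ^ (-(1 / 4) : ℝ) / K with hb
  have hfa : 0 < f a ^ (-(1 / 4) : ℝ) := by positivity
  have hab : a ≤ b := by rw [hb]; linarith [div_pos hfa hK]
  have h2 := hanti b hab
  have h3 : 0 < f b ^ (-(1 / 4) : ℝ) := Real.rpow_pos_of_pos (hall b hab).1 _
  rw [hb, add_sub_cancel_left, mul_div_cancel₀ _ hK.ne'] at h2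
  rw [hb] at h3
  linarith

/-- Levine's concavity argument. -/
theorem false_of_virial (hf : ∀ t ∈ Ici (0 : ℝ), HasDerivWithinAt f (f' t) (Ici 0) t)
    (hf' : ∀ t ∈ Ici (0 : ℝ), HasDerivWithinAt f' (f'' t) (Ici 0) t)
    (hf0 : ∀ t ∈ Ici (0 : ℝ), 0 ≤ f t) (hk0 : ∀ t ∈ Ici (0 : ℝ), 0 ≤ k t)
    (hk : ∀ t ∈ Ici (0 : ℝ), f' t ^ 2 ≤ 4 * f t * k t)
    (hconv : ∀ t ∈ Ici (0 : ℝ), 5 * k t - 6 * E ≤ f'' t)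
    (h : E < 0 ∨ (0 ≤ E ∧ √(2 * E) < f' 0 / 2 / √(f 0))) : False := by
  have hc : ContinuousOn f (Ici 0) := fun t ht => (hf t ht).continuousWithinAt
  have hc' : ContinuousOn f' (Ici 0) := fun t ht => (hf' t ht).continuousWithinAt
  have d : ∀ t, 0 < t → HasDerivAt f (f' t) t := fun t ht =>
    (hf t ht.le).hasDerivAt (Ici_mem_nhds ht)
  have d' : ∀ t, 0 < t → HasDerivAt f' (f'' t) t := fun t ht =>
    (hf' t ht.le).hasDerivAt (Ici_mem_nhds ht)
  rcases h with hE | ⟨hE, h⟩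
  · obtain ⟨b, hb0, hb⟩ : ∃ b, 0 ≤ b ∧ 0 < f' b := by
      by_contra! hneg
      set b : ℝ := (1 - f' 0) / (-(6 * E)) with hb
      have hb0 : 0 ≤ b := div_nonneg (by linarith [hneg 0 le_rfl]) (by linarith)
      have hm := monotoneOn_of_hasDerivAt (a := 0) (b := b) (g := fun t => f' t - -(6 * E) * t)
        (g' := fun t => f'' t - -(6 * E)) ?_ ?_ ?_ ⟨le_rfl, hb0⟩ ⟨hb0, le_rfl⟩ hb0
      · have h2 := hneg b hb0
        have h3 : -(6 * E) * b = 1 - f' 0 := mul_div_cancel₀ _ (by linarith)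
        simp only [h3, mul_zero, sub_zero] at hm
        linarith
      · exact (hc'.mono Icc_subset_Ici_self).sub (by fun_prop)
      · intro t ht
        refine ((d' t ht.1).sub ((hasDerivAt_id t).const_mul (-(6 * E)))).congr_deriv ?_
        simp
      · intro t ht
        have := hconv t ht.1.le
        have := hk0 t ht.1.le
        linarith
    have hfb : 0 < f b := by
      refine lt_of_le_of_ne (hf0 b hb0) fun h => ?_
      have := hk b hb0
      rw [← h] at this
      nlinarith
    have hsub : ∀ t ∈ Ioi b, 0 < t := fun t ht => hb0.trans_lt ht
    exact false_of_virial_of_nonneg (E := 0) le_rfl (hc.mono (Ici_subset_Ici.2 hb0))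
      (hc'.mono (Ici_subset_Ici.2 hb0)) (fun t ht => d t (hsub t ht)) (fun t ht => d' t (hsub t ht))
      (fun t ht => hk t (hsub t ht).le) (fun t ht => by linarith [hconv t (hsub t ht).le])
      hfb hb (by nlinarith)
  · have h0 : 0 < f 0 := by
      refine lt_of_le_of_ne (hf0 0 self_mem_Ici) fun h2 => ?_
      rw [← h2, Real.sqrt_zero, div_zero] at h
      exact absurd h (not_lt.2 (Real.sqrt_nonneg _))
    have hs : 0 < √(f 0) := Real.sqrt_pos.2 h0
    rw [lt_div_iff₀ hs] at h
    have h3 : 0 ≤ √(2 * E) * √(f 0) := by positivity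
    have h4 : (√(2 * E) * √(f 0)) ^ 2 < (f' 0 / 2) ^ 2 := by gcongr
    rw [mul_pow, Real.sq_sqrt (by positivity), Real.sq_sqrt h0.le] at h4
    exact false_of_virial_of_nonneg hE hc hc' (fun t ht => d t ht) (fun t ht => d' t ht)
      (fun t ht => hk t (Ioi_subset_Ici_self ht))
      (fun t ht => hconv t (Ioi_subset_Ici_self ht)) h0 (by linarith)
      (by linarith)

end Concavity

lemma hasDerivWithinAt_inner_sub {I : Set ℝ} {a X : ℝ → L2} {a' : L2} {t : ℝ}
    (ha : HasDerivWithinAt a a' I t) (hX : ContinuousWithinAt X I t) :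
    HasDerivWithinAt (fun τ => inner ℝ (a τ - a t) (X τ)) (inner ℝ a' (X t)) I t := by
  rw [hasDerivWithinAt_iff_tendsto_slope] at ha ⊢
  have h := ha.inner (𝕜 := ℝ) (hX.mono_left (nhdsWithin_mono t sdiff_subset))
  refine h.congr fun τ => ?_
  simp only [slope, vsub_eq_sub, sub_self, inner_zero_left, sub_zero, real_inner_smul_left,
    smul_eq_mul]

/-- Product rule for `⟪a, X⟫` when only `τ ↦ ⟪a t, X τ⟫` is known to be differentiable at `t`. -/
lemma hasDerivWithinAt_inner_of {I : Set ℝ} {a X : ℝ → L2} {a' : L2} {b t : ℝ}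
    (ha : HasDerivWithinAt a a' I t) (hX : ContinuousWithinAt X I t)
    (hb : HasDerivWithinAt (fun τ => inner ℝ (a t) (X τ)) b I t) :
    HasDerivWithinAt (fun τ => inner ℝ (a τ) (X τ)) (inner ℝ a' (X t) + b) I t := by
  have h := (hasDerivWithinAt_inner_sub ha hX).add hb
  refine h.congr_of_eventuallyEq (Eventually.of_forall fun τ => ?_) ?_ <;>
    simp [inner_sub_left]

lemma prodB_comm {r : ℝ} (hr : 1 / 2 < r) (A B : L2) : prodB r A B = prodB r B A := by
  apply bes_injective (r := r) (by linarith)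
  apply Lp.ext
  filter_upwards [bes_prodB hr A B, bes_prodB hr B A] with x h1 h2
  rw [h1, h2, mul_comm]

/-- The trilinear form `∫ A B C`. -/
def tri (r : ℝ) (A B C : L2) : ℝ := inner ℝ (bes r A) (bes r (prodB r B C))

lemma tri_eq_integral {r : ℝ} (hr : 1 / 2 < r) (A B C : L2) :
    tri r A B C = ∫ x, bes r A x * (bes r B x * bes r C x) := by
  rw [tri, L2.inner_def]
  apply integral_congr_ae
  filter_upwards [bes_prodB hr B C] with x h1
  rw [h1]; simp [mul_comm]

lemma integrable_tri {r : ℝ} (hr : 1 / 2 < r) (A B C : L2) :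
    Integrable (fun x => bes r A x * (bes r B x * bes r C x)) := by
  have h := L2.integrable_inner (𝕜 := ℝ) (bes r A) (bes r (prodB r B C))
  refine h.congr ?_
  filter_upwards [bes_prodB hr B C] with x h1
  rw [h1]; simp [mul_comm]

lemma tri_swap {r : ℝ} (hr : 1 / 2 < r) (A B C : L2) : tri r A B C = tri r A C B := by
  rw [tri, prodB_comm hr]; rfl

lemma tri_rot {r : ℝ} (hr : 1 / 2 < r) (A B C : L2) : tri r A B C = tri r B A C := by
  rw [tri_eq_integral hr, tri_eq_integral hr]
  congr 1; ext x; ring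

lemma continuousWithinAt_bes_prodB {I : Set ℝ} {t : ℝ} (r : ℝ) {B C : ℝ → L2}
    (hB : ContinuousWithinAt B I t) (hC : ContinuousWithinAt C I t) :
    ContinuousWithinAt (fun τ => bes r (prodB r (B τ) (C τ))) I t :=
  ((bes r).continuous.tendsto _).comp (tendsto_bilin (prodB r) hB hC)

/-- The derivative of the trilinear form along curves that are continuous in `H^r` and
differentiable in `L²`. -/
lemma hasDerivWithinAt_tri {r : ℝ} (hr : 1 / 2 < r) {I : Set ℝ} {A B C : ℝ → L2} {a b d : L2} {t : ℝ}
    (hB : ContinuousWithinAt B I t) (hC : ContinuousWithinAt C I t)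
    (ha : HasDerivWithinAt (fun τ => bes r (A τ)) a I t)
    (hb : HasDerivWithinAt (fun τ => bes r (B τ)) b I t)
    (hd : HasDerivWithinAt (fun τ => bes r (C τ)) d I t) :
    HasDerivWithinAt (fun τ => tri r (A τ) (B τ) (C τ))
      (inner ℝ a (bes r (prodB r (B t) (C t))) + inner ℝ b (bes r (prodB r (A t) (C t))) +
        inner ℝ d (bes r (prodB r (A t) (B t)))) I t := by
  have h1 := hasDerivWithinAt_inner_sub ha (continuousWithinAt_bes_prodB r hB hC)
  have h2 := hasDerivWithinAt_inner_sub hb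
    (continuousWithinAt_bes_prodB r (continuousWithinAt_const (b := A t)) hC)
  have h3 := hasDerivWithinAt_inner_sub hd
    (continuousWithinAt_const (b := bes r (prodB r (A t) (B t))))
  have h4 := ((h1.add h2).add h3).add_const (tri r (A t) (B t) (C t))
  have e : ∀ τ, tri r (A τ) (B τ) (C τ) =
      inner ℝ (bes r (A τ) - bes r (A t)) (bes r (prodB r (B τ) (C τ))) +
      inner ℝ (bes r (B τ) - bes r (B t)) (bes r (prodB r (A t) (C τ))) +
      inner ℝ (bes r (C τ) - bes r (C t)) (bes r (prodB r (A t) (B t))) +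
        tri r (A t) (B t) (C t) := by
    intro τ
    simp only [inner_sub_left]
    change _ = tri r (A τ) (B τ) (C τ) - tri r (A t) (B τ) (C τ) +
      (tri r (B τ) (A t) (C τ) - tri r (B t) (A t) (C τ)) +
      (tri r (C τ) (A t) (B t) - tri r (C t) (A t) (B t)) + tri r (A t) (B t) (C t)
    rw [tri_rot hr (B τ), tri_rot hr (B t), tri_rot hr (C τ), tri_rot hr (C t),
      tri_swap hr (A t) (C τ), tri_swap hr (A t) (C t)]
    ring
  exact h4.congr (fun τ _ => e τ) (e t)

/-- The integral of the cubic potential. -/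
def cubic (c : Coeffs) (r : ℝ) (U V : L2) : ℝ :=
  -(c.auu / 3) * tri r U U U - c.auv * tri r V U U - c.avv * tri r U V V + c.bvv / 3 * tri r V V V

lemma cubic_eq_integral {c : Coeffs} (hc : c.Hamiltonian) {r : ℝ} (hr : 1 / 2 < r) (U V : L2) :
    cubic c r U V = ∫ x, potential c (bes r U x) (bes r V x) := by
  have i1 := integrable_tri hr U U U
  have i2 := integrable_tri hr V U U
  have i3 := integrable_tri hr U V V
  have i4 := integrable_tri hr V V V
  rw [cubic, tri_eq_integral hr, tri_eq_integral hr, tri_eq_integral hr, tri_eq_integral hr,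
    ← integral_const_mul, ← integral_const_mul, ← integral_const_mul, ← integral_const_mul,
    ← integral_sub, ← integral_sub, ← integral_add]
  · congr 1; ext x
    simp only [potential, hc.1, hc.2]
    ring
  · exact ((i1.const_mul _).sub (i2.const_mul _)).sub (i3.const_mul _)
  · exact i4.const_mul _
  · exact (i1.const_mul _).sub (i2.const_mul _)
  · exact i3.const_mul _
  · exact i1.const_mul _
  · exact i2.const_mul _

lemma inner_bes_quad (r a b d : ℝ) (u U V : L2) : inner ℝ u (bes r (quad r a b d U V)) =
    a * inner ℝ u (bes r (prodB r U U)) + 2 * b * inner ℝ u (bes r (prodB r U V)) +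
      d * inner ℝ u (bes r (prodB r V V)) := by
  simp only [quad, map_add, map_smul, inner_add_right, real_inner_smul_right]

/-- The cubic potential is homogeneous. -/
lemma three_mul_cubic {c : Coeffs} (hc : c.Hamiltonian) {r : ℝ} (hr : 1 / 2 < r) (U V : L2) :
    3 * cubic c r U V = -inner ℝ (bes r U) (bes r (nl₁ c r U V)) +
      inner ℝ (bes r V) (bes r (nl₂ c r U V)) := by
  rw [nl₁, nl₂, inner_bes_quad, inner_bes_quad, hc.1, hc.2]
  change _ = -(c.auu * tri r U U U + 2 * c.auv * tri r U U V + c.avv * tri r U V V) +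
    (-c.auv * tri r V U U + 2 * -c.avv * tri r V U V + c.bvv * tri r V V V)
  rw [tri_swap hr U U V, tri_rot hr U V U, tri_rot hr V U V, cubic]
  ring

lemma hasDerivWithinAt_cubic {c : Coeffs} (hc : c.Hamiltonian) {r : ℝ} (hr : 1 / 2 < r) {I : Set ℝ}
    {U V : ℝ → L2} {u' v' : L2} {t : ℝ}
    (hU : ContinuousWithinAt U I t) (hV : ContinuousWithinAt V I t)
    (du : HasDerivWithinAt (fun τ => bes r (U τ)) u' I t)
    (dv : HasDerivWithinAt (fun τ => bes r (V τ)) v' I t) :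
    HasDerivWithinAt (fun τ => cubic c r (U τ) (V τ))
      (-inner ℝ u' (bes r (nl₁ c r (U t) (V t))) + inner ℝ v' (bes r (nl₂ c r (U t) (V t)))) I t := by
  have h1 := hasDerivWithinAt_tri hr hU hU du du du
  have h2 := hasDerivWithinAt_tri hr hU hU dv du du
  have h3 := hasDerivWithinAt_tri hr hV hV du dv dv
  have h4 := hasDerivWithinAt_tri hr hV hV dv dv dv
  have h5 := (((h1.const_mul (-(c.auu / 3))).sub (h2.const_mul c.auv)).sub
    (h3.const_mul c.avv)).add (h4.const_mul (c.bvv / 3))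
  refine (h5.congr_deriv ?_)
  rw [nl₁, nl₂, inner_bes_quad, inner_bes_quad, hc.1, hc.2, prodB_comm hr (V t) (U t)]
  ring

lemma conj_W (p q ξ : ℝ) : conj (W p q ξ) = W p q ξ := by
  by_cases h : p + q ≤ 0
  · rw [W_apply h, Complex.conj_ofReal]
  · rw [W, dif_neg h]; simp

lemma inner_rmul_W (p q : ℝ) (f g : L2) : inner ℝ (rmul (W p q) f) g = inner ℝ f (rmul (W p q) g) :=
  inner_rmul_left (herm_W _ _) (herm_W _ _) (conj_W p q) f g

lemma Sym.Herm.neg {a : Sym} (ha : a.Herm) : (-a).Herm := fun ξ => by simp [ha ξ]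

lemma rmul_neg_sym (a : Sym) (f : L2) : rmul (-a) f = -rmul a f := by
  have : fmul (-a) (toC f) = -fmul a (toC f) := by
    have h : -a = (-1 : ℂ) • a := by ext; simp
    rw [h, fmul_smul]; simp
  rw [rmul_apply, this, map_neg, rmul_apply]

lemma rmul_sub_sym (a b : Sym) (f : L2) : rmul (a - b) f = rmul a f - rmul b f := by
  rw [rmul_apply, fmul_sub, map_sub, rmul_apply, rmul_apply]

lemma rmul_one (f : L2) : rmul 1 f = f := by rw [rmul_apply, fmul_one, reL_toC]

lemma inner_rmul_D1 (f g : L2) : inner ℝ (rmul D1 f) g = -inner ℝ f (rmul D1 g) := by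
  rw [inner_rmul_left herm_D1 herm_D1.neg
    (fun ξ => by simp [coe_D1, conj_dsym, conj_weightC]) f g, rmul_neg_sym, inner_neg_right]

lemma D2_eq : D2 = W (-2) 0 - 1 := by
  ext ξ
  have h1 : weightC 2 0 ξ * weightC (-2) 0 ξ = 1 := by
    rw [weightC_mul]; simp [weightC_zero_zero]
  rw [← one_sub_dsym_sq] at h1
  rw [BoundedContinuousFunction.sub_apply, coe_D2, coe_W (by norm_num)]
  simp only [BoundedContinuousFunction.coe_one, Pi.one_apply]
  linear_combination -h1

/-- Integration by parts for `g = ∂ₓ w`. -/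
lemma IsWeakDeriv.inner_add_inner {w g : L2} (hw : IsWeakDeriv w g) (h : L2) :
    inner ℝ w (rmul D1 h) + inner ℝ g (rmul D2 h) = -inner ℝ g h := by
  rw [isWeakDeriv_iff] at hw
  have e1 : inner ℝ w (rmul D1 h) = -inner ℝ (rmul (W (-2) 0) g) h := by
    rw [hw, inner_rmul_D1, neg_neg]
  rw [e1, D2_eq, rmul_sub_sym, rmul_one, inner_sub_right, inner_rmul_W]
  ring

/-- A flow with the energy structure of the system: `w = ∂ₓ⁻¹ u`, `wt = ∂ₓ⁻¹ u_t`, `p` stands for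
`(1 - ∂ₓ²)^(1/2) v`, `F₁` and `F₂` for the nonlinearities and `Φ` for the integral of their
potential. -/
structure IsEnergyFlow (α : ℝ) (I : Set ℝ) (u ut w wt v vt p F₁ F₂ : ℝ → L2) (Φ : ℝ → ℝ) :
    Prop where
  deriv_u : ∀ t ∈ I, HasDerivWithinAt u (ut t) I t
  deriv_ut : ∀ t ∈ I, HasDerivWithinAt ut (rmul D2 (α ^ 2 • u t + F₁ t)) I t
  deriv_w : ∀ t ∈ I, HasDerivWithinAt w (wt t) I t
  deriv_wt : ∀ t ∈ I, HasDerivWithinAt wt (rmul D1 (α ^ 2 • u t + F₁ t)) I t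
  weak_w : ∀ t ∈ I, IsWeakDeriv (w t) (u t)
  weak_wt : ∀ t ∈ I, IsWeakDeriv (wt t) (ut t)
  deriv_v : ∀ t ∈ I, HasDerivWithinAt v (vt t) I t
  deriv_kinetic : ∀ t ∈ I,
    HasDerivWithinAt (fun τ => ‖p τ‖ ^ 2 + ‖vt τ‖ ^ 2) (2 * inner ℝ (vt t) (F₂ t)) I t
  deriv_inner : ∀ t ∈ I, HasDerivWithinAt (fun τ => inner ℝ (v τ) (vt τ))
    (‖vt t‖ ^ 2 - ‖p t‖ ^ 2 + inner ℝ (v t) (F₂ t)) I t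
  deriv_pot : ∀ t ∈ I,
    HasDerivWithinAt Φ (-inner ℝ (ut t) (F₁ t) + inner ℝ (vt t) (F₂ t)) I t
  pot_eq : ∀ t ∈ I, 3 * Φ t = -inner ℝ (u t) (F₁ t) + inner ℝ (v t) (F₂ t)

namespace IsEnergyFlow

variable {α : ℝ} {I : Set ℝ} {u ut w wt v vt p F₁ F₂ : ℝ → L2} {Φ : ℝ → ℝ}

lemma energy_eq (hI : TimeInterval I) (h : IsEnergyFlow α I u ut w wt v vt p F₁ F₂ Φ) {t : ℝ}
    (ht : t ∈ I) :
    1 / 2 * (‖ut t‖ ^ 2 + α ^ 2 * ‖u t‖ ^ 2 + ‖wt t‖ ^ 2 + (‖p t‖ ^ 2 + ‖vt t‖ ^ 2)) - Φ t =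
    1 / 2 * (‖ut 0‖ ^ 2 + α ^ 2 * ‖u 0‖ ^ 2 + ‖wt 0‖ ^ 2 + (‖p 0‖ ^ 2 + ‖vt 0‖ ^ 2)) - Φ 0 := by
  refine hI.eq_zero_of_hasDerivWithinAt_zero (f := fun t => 1 / 2 * (‖ut t‖ ^ 2 + α ^ 2 * ‖u t‖ ^ 2
    + ‖wt t‖ ^ 2 + (‖p t‖ ^ 2 + ‖vt t‖ ^ 2)) - Φ t) (fun t ht => ?_) ht
  have h1 := (((((h.deriv_ut t ht).norm_sq).add ((h.deriv_u t ht).norm_sq.const_mul (α ^ 2))).add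
    (h.deriv_wt t ht).norm_sq).add (h.deriv_kinetic t ht)).const_mul (1 / 2)
  refine (h1.sub (h.deriv_pot t ht)).congr_deriv ?_
  have h2 := (h.weak_wt t ht).inner_add_inner (α ^ 2 • u t + F₁ t)
  rw [inner_add_right (ut t), real_inner_smul_right] at h2
  have h3 : (inner ℝ (u t) (ut t) : ℝ) = inner ℝ (ut t) (u t) := real_inner_comm _ _
  rw [h3]
  linarith

/-- The first derivative of the virial `‖w‖² + ‖u‖² + ‖v‖²`. -/
lemma deriv_virial (h : IsEnergyFlow α I u ut w wt v vt p F₁ F₂ Φ) {t : ℝ} (ht : t ∈ I) :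
    HasDerivWithinAt (fun t => ‖w t‖ ^ 2 + ‖u t‖ ^ 2 + ‖v t‖ ^ 2)
      (2 * (inner ℝ (w t) (wt t) + inner ℝ (u t) (ut t) + inner ℝ (v t) (vt t))) I t := by
  refine (((h.deriv_w t ht).norm_sq.add (h.deriv_u t ht).norm_sq).add
    (h.deriv_v t ht).norm_sq).congr_deriv ?_
  ring

/-- The second derivative of the virial. -/
lemma deriv_deriv_virial (hI : TimeInterval I) (h : IsEnergyFlow α I u ut w wt v vt p F₁ F₂ Φ)
    {E : ℝ} (hE : E = 1 / 2 * (‖ut 0‖ ^ 2 + α ^ 2 * ‖u 0‖ ^ 2 + ‖wt 0‖ ^ 2 +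
      (‖p 0‖ ^ 2 + ‖vt 0‖ ^ 2)) - Φ 0) {t : ℝ} (ht : t ∈ I) :
    HasDerivWithinAt (fun t =>
      2 * (inner ℝ (w t) (wt t) + inner ℝ (u t) (ut t) + inner ℝ (v t) (vt t)))
      (5 * (‖wt t‖ ^ 2 + ‖ut t‖ ^ 2 + ‖vt t‖ ^ 2) + α ^ 2 * ‖u t‖ ^ 2 + ‖p t‖ ^ 2 - 6 * E) I t := by
  have h1 := (((h.deriv_w t ht).inner ℝ (h.deriv_wt t ht)).add
    ((h.deriv_u t ht).inner ℝ (h.deriv_ut t ht))).add (h.deriv_inner t ht)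
  refine (h1.const_mul 2).congr_deriv ?_
  have h2 := (h.weak_w t ht).inner_add_inner (α ^ 2 • u t + F₁ t)
  have e : (inner ℝ (u t) (α ^ 2 • u t + F₁ t) : ℝ) = α ^ 2 * ‖u t‖ ^ 2 + inner ℝ (u t) (F₁ t) := by
    rw [inner_add_right, real_inner_smul_right, real_inner_self_eq_norm_sq]
  rw [e] at h2
  have h3 := h.energy_eq hI ht
  rw [← hE] at h3
  have h4 := h.pot_eq t ht
  simp only [real_inner_self_eq_norm_sq]
  linarith

lemma sq_inner_le (a a' b b' d d' : L2) :
    (2 * (inner ℝ a a' + inner ℝ b b' + inner ℝ d d' : ℝ)) ^ 2 ≤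
      4 * (‖a‖ ^ 2 + ‖b‖ ^ 2 + ‖d‖ ^ 2) * (‖a'‖ ^ 2 + ‖b'‖ ^ 2 + ‖d'‖ ^ 2) := by
  have h1 := abs_real_inner_le_norm a a'
  have h2 := abs_real_inner_le_norm b b'
  have h3 := abs_real_inner_le_norm d d'
  have h4 : |(inner ℝ a a' + inner ℝ b b' + inner ℝ d d' : ℝ)| ≤
      ‖a‖ * ‖a'‖ + ‖b‖ * ‖b'‖ + ‖d‖ * ‖d'‖ :=
    (abs_add_three _ _ _).trans (add_le_add (add_le_add h1 h2) h3)
  rw [mul_pow, ← sq_abs (inner ℝ a a' + inner ℝ b b' + inner ℝ d d' : ℝ)]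
  have h5 : |(inner ℝ a a' + inner ℝ b b' + inner ℝ d d' : ℝ)| ^ 2 ≤
      (‖a‖ * ‖a'‖ + ‖b‖ * ‖b'‖ + ‖d‖ * ‖d'‖) ^ 2 := by gcongr
  nlinarith [sq_nonneg (‖a‖ * ‖b'‖ - ‖b‖ * ‖a'‖), sq_nonneg (‖a‖ * ‖d'‖ - ‖d‖ * ‖a'‖),
    sq_nonneg (‖b‖ * ‖d'‖ - ‖d‖ * ‖b'‖)]

/-- There is no global flow with negative energy, or with large enough initial velocity. -/
theorem false_of_global (h : IsEnergyFlow α (Ici 0) u ut w wt v vt p F₁ F₂ Φ)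
    {E : ℝ} (hE : E = 1 / 2 * (‖ut 0‖ ^ 2 + α ^ 2 * ‖u 0‖ ^ 2 + ‖wt 0‖ ^ 2 +
      (‖p 0‖ ^ 2 + ‖vt 0‖ ^ 2)) - Φ 0)
    (hdata : E < 0 ∨ (0 ≤ E ∧ √(2 * E) <
      (inner ℝ (w 0) (wt 0) + inner ℝ (u 0) (ut 0) + inner ℝ (v 0) (vt 0)) /
        √(‖w 0‖ ^ 2 + ‖u 0‖ ^ 2 + ‖v 0‖ ^ 2))) : False := by
  refine false_of_virial (E := E) (k := fun t => ‖wt t‖ ^ 2 + ‖ut t‖ ^ 2 + ‖vt t‖ ^ 2)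
    (fun t ht => h.deriv_virial ht) (fun t ht => h.deriv_deriv_virial timeInterval_Ici hE ht)
    (fun t _ => by positivity) (fun t _ => by positivity)
    (fun t _ => sq_inner_le _ _ _ _ _ _) (fun t _ => ?_) ?_
  · have h1 : 0 ≤ α ^ 2 * ‖u t‖ ^ 2 := by positivity
    have h2 := sq_nonneg ‖p t‖
    linarith
  · refine hdata.imp_right fun hd => ⟨hd.1, ?_⟩
    rw [mul_div_cancel_left₀ _ two_ne_zero]
    exact hd.2

end IsEnergyFlow

lemma re_inner_L2C (f g : L2C) : (inner ℂ f g : ℂ).re =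
    inner ℝ (reL f) (reL g) + inner ℝ (imL f) (imL g) := by
  conv_lhs => rw [← toC_re_add_im f, ← toC_re_add_im g]
  simp only [inner_add_left, inner_add_right, inner_smul_left, inner_smul_right, inner_toC]
  simp

lemma norm_sq_L2C (f : L2C) : ‖f‖ ^ 2 = ‖reL f‖ ^ 2 + ‖imL f‖ ^ 2 := by
  have h1 := re_inner_L2C f f
  rw [inner_self_eq_norm_sq_to_K, real_inner_self_eq_norm_sq, real_inner_self_eq_norm_sq] at h1
  rw [← h1]
  norm_cast

lemma hasDerivWithinAt_norm_sq_L2C {I : Set ℝ} {f : ℝ → L2C} {f' : L2C} {t : ℝ}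
    (h : HasDerivWithinAt f f' I t) :
    HasDerivWithinAt (fun τ => ‖f τ‖ ^ 2) (2 * (inner ℂ (f t) f' : ℂ).re) I t := by
  have h1 := (hasDerivWithinAt_clm reL h).norm_sq.add (hasDerivWithinAt_clm imL h).norm_sq
  refine (h1.congr (fun τ _ => norm_sq_L2C _) (norm_sq_L2C _)).congr_deriv ?_
  rw [re_inner_L2C]; ring

lemma conj_wave (t ξ : ℝ) : conj (wave t ξ) = wave (-t) ξ := by
  rw [wave_apply, wave_apply, ← Complex.exp_conj, map_mul, Complex.conj_ofReal, Complex.conj_I]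
  congr 1; push_cast; ring

lemma hasDerivWithinAt_primitive_add {I : Set ℝ} (hI : TimeInterval I) {g : ℝ → L2}
    (hg : ContinuousOn g I) (a : L2) : ∃ f : ℝ → L2, f 0 = a ∧
      ∀ t ∈ I, HasDerivWithinAt f (g t) I t :=
  ⟨fun t => a + ∫ s in (0 : ℝ)..t, g s, by simp,
    fun _ ht => (hI.hasDerivWithinAt_primitive hg ht).const_add a⟩

section

variable {I : Set ℝ} {c : Coeffs} {r σ : ℝ} {y : ℝ → State} {Y : ℝ → L2C}

/-- `(1 - ∂ₓ²)^(1/2) v` in terms of the profile. -/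
def pOf (σ : ℝ) (Y : ℝ → L2C) (t : ℝ) : L2 := rmul (W 1 (-σ)) (reL (halfWave Y t))

lemma bes_pot (c : Coeffs) (r : ℝ) (U V : L2) :
    bes r (pot c r U V) = c.α ^ 2 • bes r U + bes r (nl₁ c r U V) := by
  rw [pot, map_add, map_smul]

lemma bes_rmul_D2 (r : ℝ) (h : L2) : bes r (rmul D2 h) = rmul D2 (bes r h) :=
  rmul_comm (herm_W _ _) herm_D2 h

lemma IsRegularProfile.bes_vAt_eq_pOf (hr : 0 ≤ r) (hrσ : r ≤ σ) (hσ : 1 ≤ σ)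
    (h : IsRegularProfile c r σ I y Y) {t : ℝ} (ht : t ∈ I) :
    bes r (vAt y t) = rmul (W (-1) 0) (pOf σ Y t) := by
  rw [h.bes_vAt hr hrσ ht, pOf, rW_add_mul (p'' := 0) (q'' := -σ) (by norm_num) (by linarith)
    (by norm_num) (by ring), bes]

lemma IsRegularProfile.deriv_v (hr : 0 ≤ r) (hrσ : r ≤ σ) (hσr : σ ≤ r + 1) (hσ : 1 ≤ σ)
    (h : IsRegularProfile c r σ I y Y) {t : ℝ} (ht : t ∈ I) :
    HasDerivWithinAt (fun τ => bes r (vAt y τ)) (vtOf σ Y t) I t := by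
  have e : ∀ τ ∈ I, bes r (vAt y τ) = rmul (W 1 (-σ)) (rmul (W (-1) 0) (reL (halfWave Y τ))) :=
    fun τ hτ => by rw [h.bes_vAt_eq_pOf hr hrσ hσ hτ, pOf, rmul_comm (herm_W _ _) (herm_W _ _)]
  exact (hasDerivWithinAt_clm _ (h.hasDerivWithinAt_re hσr ht)).congr e (e t ht)

lemma IsRegularProfile.deriv_kinetic (hσr : σ ≤ r + 1) (hσ : 1 ≤ σ)
    (h : IsRegularProfile c r σ I y Y) {t : ℝ} (ht : t ∈ I) :
    HasDerivWithinAt (fun τ => ‖pOf σ Y τ‖ ^ 2 + ‖vtOf σ Y τ‖ ^ 2)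
      (2 * inner ℝ (vtOf σ Y t) (bes r (nl₂ c r (y t).1 (vAt y t)))) I t := by
  have h1 := hasDerivWithinAt_norm_sq_L2C (hasDerivWithinAt_fmul (W 1 (-σ)) (h.deriv t ht))
  have e : ∀ τ, ‖pOf σ Y τ‖ ^ 2 + ‖vtOf σ Y τ‖ ^ 2 = ‖fmul (W 1 (-σ)) (Y τ)‖ ^ 2 := fun τ => by
    rw [← norm_fmul_wave (-τ), fmul_comm, norm_sq_L2C, reL_fmul (herm_W _ _),
      imL_fmul (herm_W _ _)]
    rfl
  refine (h1.congr_deriv ?_).congr (fun τ _ => e τ) (e t)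
  have e1 : fmul (W 1 (-σ)) (Y t) = fmul (wave t) (fmul (W 1 (-σ)) (halfWave Y t)) := by
    rw [halfWave, fmul_comm (wave t), fmul_wave_wave_neg]
  rw [e1, inner_fmul_left _ _ (conj_wave t), map_smul, map_smul, fmul_comm (W 1 (-σ)),
    fmul_wave_neg_wave, W_add_mul (p'' := 0) (q'' := -r) (by linarith) (by linarith) (by norm_num)
    (by ring), ← toC_rmul (herm_W _ _), re_inner_L2C, reL_I_smul, imL_I_smul, imL_toC, reL_toC,
    imL_fmul (herm_W _ _)]
  simp [vtOf, bes]

lemma IsRegularProfile.deriv_inner (hr : 0 ≤ r) (hrσ : r ≤ σ) (hσr : σ ≤ r + 1) (hσ : 1 ≤ σ)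
    (h : IsRegularProfile c r σ I y Y) {t : ℝ} (ht : t ∈ I) :
    HasDerivWithinAt (fun τ => inner ℝ (bes r (vAt y τ)) (vtOf σ Y τ))
      (‖vtOf σ Y t‖ ^ 2 - ‖pOf σ Y t‖ ^ 2 +
        inner ℝ (bes r (vAt y t)) (bes r (nl₂ c r (y t).1 (vAt y t)))) I t := by
  have hc : ContinuousOn (vtOf σ Y) I := continuousOn_rmul _ (continuousOn_imL h.continuousOn_halfWave)
  have d1 : HasDerivWithinAt (fun τ => rmul (W (-1) 0) (vtOf σ Y τ))
      (-pOf σ Y t + rmul (W (-1) 0) (bes r (nl₂ c r (y t).1 (vAt y t)))) I t := by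
    refine ((hasDerivWithinAt_clm (rmul (W 1 (-σ))) (h.hasDerivWithinAt_im hσr ht)).congr_deriv
      ?_).congr (fun τ _ => rmul_comm (herm_W _ _) (herm_W _ _) _)
      (rmul_comm (herm_W _ _) (herm_W _ _) _)
    rw [map_add, map_neg, rW_add_mul (p'' := -1) (q'' := -r) (by linarith) (by linarith)
      (by norm_num) (by ring), bes, rW_add_mul (p'' := -1) (q'' := -r) (by norm_num) (by linarith)
      (by norm_num) (by ring)]
    rfl
  have d2 : HasDerivWithinAt (fun τ => inner ℝ (pOf σ Y t) (rmul (W (-1) 0) (vtOf σ Y τ)))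
      (inner ℝ (pOf σ Y t) (-pOf σ Y t + rmul (W (-1) 0) (bes r (nl₂ c r (y t).1 (vAt y t))))) I t :=
    hasDerivWithinAt_clm (innerSL ℝ (pOf σ Y t)) d1
  simp only [← inner_rmul_W] at d2
  rw [← h.bes_vAt_eq_pOf hr hrσ hσ ht] at d2
  refine (hasDerivWithinAt_inner_of (h.deriv_v hr hrσ hσr hσ ht) (hc t ht) d2).congr_deriv ?_
  rw [inner_add_right, inner_neg_right, ← inner_rmul_W, ← h.bes_vAt_eq_pOf hr hrσ hσ ht,
    real_inner_self_eq_norm_sq, real_inner_self_eq_norm_sq]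
  ring

/-- Solutions of the differential equation have the energy structure. -/
theorem IsODESol.exists_isEnergyFlow (hc : c.Hamiltonian) (hr : 1 / 2 < r) (hrσ : r ≤ σ)
    (hσr : σ ≤ r + 1) (hσ : 1 ≤ σ) (hI : TimeInterval I) (hy : IsODESol (field c r) I y)
    (hY : IsRegularProfile c r σ I y Y) {w₀ w₁ : L2} (hw₀ : IsWeakDeriv w₀ (bes r (y 0).1))
    (hw₁ : IsWeakDeriv w₁ (bes r (y 0).2.1)) :
    ∃ w wt : ℝ → L2, w 0 = w₀ ∧ wt 0 = w₁ ∧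
      IsEnergyFlow c.α I (fun t => bes r (y t).1) (fun t => bes r (y t).2.1) w wt
        (fun t => bes r (vAt y t)) (vtOf σ Y) (pOf σ Y)
        (fun t => bes r (nl₁ c r (y t).1 (vAt y t))) (fun t => bes r (nl₂ c r (y t).1 (vAt y t)))
        (fun t => cubic c r (y t).1 (vAt y t)) := by
  have hr0 : 0 ≤ r := by linarith
  obtain ⟨wt, hwt0, hwt, hwt'⟩ := hy.exists_wt hI hw₁
  obtain ⟨w, hw0, hw⟩ := hasDerivWithinAt_primitive_add hI (g := wt)
    (fun t ht => (hwt t ht).continuousWithinAt) w₀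
  have du : ∀ t ∈ I, HasDerivWithinAt (fun t => bes r (y t).1) (bes r (y t).2.1) I t :=
    fun t ht => hasDerivWithinAt_clm (bes r) (hy.hasDerivWithinAt_U ht)
  have dv : ∀ t ∈ I, HasDerivWithinAt (fun τ => bes r (vAt y τ)) (vtOf σ Y t) I t :=
    fun t ht => hY.deriv_v hr0 hrσ hσr hσ ht
  refine ⟨w, wt, hw0, hwt0, du, fun t ht => ?_, hw, fun t ht => ?_, fun t ht => ?_, hwt', dv,
    fun t ht => hY.deriv_kinetic hσr hσ ht, fun t ht => hY.deriv_inner hr0 hrσ hσr hσ ht,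
    fun t ht => hasDerivWithinAt_cubic hc hr (hy.continuousOn_U t ht) (hy.continuousOn_vAt t ht)
      (du t ht) (dv t ht), fun t _ => three_mul_cubic hc hr _ _⟩
  · rw [← bes_pot, ← bes_rmul_D2]
    exact hasDerivWithinAt_clm (bes r) (hy.hasDerivWithinAt_U1 ht)
  · rw [← bes_pot]
    exact hwt t ht
  · rw [isWeakDeriv_iff] at hw₀ ⊢
    have d1 : ∀ t ∈ I, HasDerivWithinAt (fun t => rmul (W (-2) 0) (bes r (y t).1))
        (rmul D1 (wt t)) I t := fun t ht =>
      (hasDerivWithinAt_clm (rmul (W (-2) 0)) (du t ht)).congr_deriv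
        ((isWeakDeriv_iff _ _).1 (hwt' t ht))
    have d2 : ∀ t ∈ I, HasDerivWithinAt (fun t => rmul D1 (w t)) (rmul D1 (wt t)) I t :=
      fun t ht => hasDerivWithinAt_clm (rmul D1) (hw t ht)
    exact hI.eq_of_hasDerivWithinAt_eq d1 d2 (by rw [hw₀, hw0]) ht

end

/-- The symbol of `∂ₓ (1 - ∂ₓ²)^(-1/2)`. -/
def S1 : Sym := BoundedContinuousFunction.ofNormedAddCommGroup (fun ξ => dsym ξ * weightC (-1) 0 ξ)
  (hasTemperateGrowth_dsym.1.continuous.mul (hasTemperateGrowth_weightC _ _).1.continuous) 1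
  (fun ξ => by
    have h := norm_dsym_sq_mul_le ξ
    have e : dsym ξ ^ 2 * weightC (-2) 0 ξ = (dsym ξ * weightC (-1) 0 ξ) ^ 2 := by
      rw [mul_pow, sq (weightC (-1) 0 ξ), weightC_mul]; norm_num
    rw [e, norm_pow] at h
    exact (sq_le_one_iff₀ (norm_nonneg _)).1 h)

lemma coe_S1 : (S1 : ℝ → ℂ) = fun ξ => dsym ξ * weightC (-1) 0 ξ := rfl

lemma herm_S1 : S1.Herm := fun ξ => by
  simp [coe_S1, conj_dsym, dsym_neg, conj_weightC, weightC_neg_arg]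

lemma W_mul_S1 : W (-1) 0 * S1 = D1 := by
  ext ξ
  rw [BoundedContinuousFunction.mul_apply, coe_S1, coe_D1, coe_W (by norm_num), mul_left_comm,
    weightC_mul]
  norm_num

lemma S1_mul_S1 : S1 * S1 = D2 := by
  ext ξ
  rw [BoundedContinuousFunction.mul_apply, coe_S1, coe_D2, mul_mul_mul_comm, weightC_mul, ← sq]
  norm_num

lemma inner_rmul_S1 (f g : L2) : inner ℝ (rmul S1 f) g = -inner ℝ f (rmul S1 g) := by
  rw [inner_rmul_left herm_S1 herm_S1.neg
    (fun ξ => by simp [coe_S1, conj_dsym, conj_weightC]) f g, rmul_neg_sym, inner_neg_right]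

/-- The two expressions for the `H¹` norm. -/
lemma IsWeakDeriv.norm_sq_eq {v vx p : L2} (h : IsWeakDeriv v vx) (hp : v = rmul (W (-1) 0) p) :
    ‖p‖ ^ 2 = ‖v‖ ^ 2 + ‖vx‖ ^ 2 := by
  have hinj : Function.Injective (rmul (W (-2) 0)) :=
    rmul_injective (herm_W _ _) (W_ne_zero (by norm_num))
  have e : vx = rmul S1 p := by
    apply hinj
    rw [(isWeakDeriv_iff _ _).1 h, hp, ← W_mul_S1, rmul_mul _ herm_S1,
      rmul_comm herm_S1 (herm_W _ _), rW_add_mul (p'' := -2) (q'' := 0) (by norm_num)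
      (by norm_num) (by norm_num) (by norm_num)]
  have e1 : ‖vx‖ ^ 2 = -inner ℝ p (rmul D2 p) := by
    rw [← S1_mul_S1, rmul_mul _ herm_S1, ← inner_rmul_S1, ← e, real_inner_self_eq_norm_sq]
  have e2 : ‖v‖ ^ 2 = inner ℝ p (rmul (W (-2) 0) p) := by
    rw [← real_inner_self_eq_norm_sq, hp, inner_rmul_W, rW_add_mul (p'' := -2) (q'' := 0)
      (by norm_num) (by norm_num) (by norm_num) (by norm_num)]
  rw [e1, e2, D2_eq, rmul_sub_sym, rmul_one, inner_sub_right, real_inner_self_eq_norm_sq]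
  ring

/-- A function in `L²` with weak derivative in `L²` belongs to `H¹`. -/
lemma IsWeakDeriv.exists_bes_one {v vx : L2} (h : IsWeakDeriv v vx) : ∃ G, v = bes 1 G := by
  have hinj : Function.Injective (rmul (W (-2) 0)) :=
    rmul_injective (herm_W _ _) (W_ne_zero (by norm_num))
  have e1 : rmul D1 vx = rmul D2 v := by
    apply hinj
    rw [rmul_comm (herm_W _ _) herm_D1, (isWeakDeriv_iff _ _).1 h, ← rmul_mul _ herm_D1,
      ← W_mul_D2, rmul_mul _ herm_D2]
  refine ⟨rmul (W (-1) 1) (rmul (W (-1) 0) v - rmul S1 vx), ?_⟩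
  rw [bes, rW_add_mul (p'' := -1) (q'' := 0) (by norm_num) (by norm_num) (by norm_num)
    (by norm_num), map_sub, ← rmul_mul _ herm_S1, W_mul_S1, e1, rW_add_mul (p'' := -2) (q'' := 0)
    (by norm_num) (by norm_num) (by norm_num) (by norm_num), D2_eq, rmul_sub_sym, rmul_one]
  abel

lemma exists_bes_of_memSobolev {σ : ℝ} (hσ : 0 ≤ σ) {f : L2}
    (h : TemperedDistribution.MemSobolev σ 2 (toDist f)) : ∃ G, f = bes σ G := by
  obtain ⟨g, hg⟩ := memSobolev_iff.1 h
  exact ⟨reL g, bes_eq_of_bessel hσ hg⟩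

lemma bes_zero (f : L2) : bes 0 f = f := by
  rw [bes, neg_zero, W_zero_zero, rmul_one]

/-- The initial data lie in `H^σ × H^(σ-1)` for `σ = max s 1`. -/
lemma exists_regularity {r s : ℝ} (hr : 1 / 2 < r) (hsr : s ≤ r + 1) {v₀ v₁ v₀x : L2}
    (hv₀ : TemperedDistribution.MemSobolev s 2 (toDist v₀))
    (hv₁ : TemperedDistribution.MemSobolev (s - 1) 2 (toDist v₁)) (hv₀x : IsWeakDeriv v₀ v₀x) :
    ∃ σ, s ≤ σ ∧ σ ≤ r + 1 ∧ 1 ≤ σ ∧ (∃ G, v₀ = bes σ G) ∧ ∃ Q, v₁ = bes (σ - 1) Q := by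
  rcases le_total 1 s with h | h
  · exact ⟨s, le_rfl, hsr, h, exists_bes_of_memSobolev (by linarith) hv₀,
      exists_bes_of_memSobolev (by linarith) hv₁⟩
  · refine ⟨1, h, by linarith, le_rfl, hv₀x.exists_bes_one, v₁, ?_⟩
    rw [sub_self, bes_zero]

lemma exists_isRegularData {r s σ : ℝ} (hr : 1 / 2 < r) (hrs : r ≤ s) (hsσ : s ≤ σ)
    (hσ : 1 ≤ σ) {u₀ u₁ v₀ v₁ w₁ : L2}
    (hu₀ : TemperedDistribution.MemSobolev r 2 (toDist u₀))
    (hu₁ : TemperedDistribution.MemSobolev r 2 (toDist u₁)) (hw₁ : IsWeakDeriv w₁ u₁)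
    (hv₀ : ∃ G, v₀ = bes σ G) (hv₁ : ∃ Q, v₁ = bes (σ - 1) Q) :
    ∃ (y₀ : State) (Y₀ : L2C), IsRegularData r σ u₀ u₁ v₀ v₁ w₁ y₀ Y₀ := by
  have hr0 : 0 ≤ r := by linarith
  obtain ⟨U, hU⟩ := exists_bes_of_memSobolev hr0 hu₀
  obtain ⟨U1, hU1⟩ := exists_bes_of_memSobolev hr0 hu₁
  obtain ⟨G, hG⟩ := hv₀
  obtain ⟨Q, hQ⟩ := hv₁
  set Y₀ : L2C := toC G + Complex.I • toC (rmul (W (-1) 1) Q) with hY₀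
  have e1 : reL Y₀ = G := by rw [hY₀, map_add, reL_toC, reL_I_smul, imL_toC, neg_zero, add_zero]
  have e2 : imL Y₀ = rmul (W (-1) 1) Q := by
    rw [hY₀, map_add, imL_toC, imL_I_smul, reL_toC, zero_add]
  refine ⟨(U, U1, fmul (W 0 (r - σ)) Y₀), Y₀, ⟨hU, hU1, ?_, ?_⟩, rfl, hw₁⟩
  · dsimp only
    rw [reL_fmul (herm_W _ _), e1, bes_rmul_W hr0 (hrs.trans hsσ), hG]
  · dsimp only
    rw [imL_fmul (herm_W _ _), e2, ← dmul_weightC_toDist (by linarith),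
      ← dmul_weightC_toDist (by norm_num), dmul_weightC_dmul_weightC, dmul_weightC_dmul_weightC, hQ,
      toDist_bes _ (by linarith)]
    congr 2
    rw [show (1 : ℝ) + 0 + -1 = 0 by norm_num, show -r + (r - σ) + 1 = -(σ - 1) by ring]

end KGB

end

theorem theorem2p5 (c : KGB.Coeffs) (hc : c.Admissible) (hham : c.Hamiltonian)
    (r s : ℝ) (hr : 1 / 2 < r) (hrs : r ≤ s) (hsr : s ≤ r + 1)
    (u₀ u₁ v₀ v₁ w₀ w₁ v₀x : KGB.L2)
    (hu₀ : TemperedDistribution.MemSobolev r 2 (KGB.toDist u₀))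
    (hu₁ : TemperedDistribution.MemSobolev r 2 (KGB.toDist u₁))
    (hu₁' : KGB.homSobolevNorm (r - 1) u₁ < ∞)
    (hv₀ : TemperedDistribution.MemSobolev s 2 (KGB.toDist v₀))
    (hv₁ : TemperedDistribution.MemSobolev (s - 1) 2 (KGB.toDist v₁))
    (hw₀ : KGB.IsWeakDeriv w₀ u₀)
    (hw₁ : KGB.IsWeakDeriv w₁ u₁)
    (hv₀x : KGB.IsWeakDeriv v₀ v₀x)
    (hE : KGB.energy c u₀ u₁ w₁ v₀ v₀x v₁ < 0 ∨
      (0 ≤ KGB.energy c u₀ u₁ w₁ v₀ v₀x v₁ ∧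
        √(2 * KGB.energy c u₀ u₁ w₁ v₀ v₀x v₁) <
          (inner ℝ w₀ w₁ + inner ℝ u₀ u₁ + inner ℝ v₀ v₁) /
            √(‖w₀‖ ^ 2 + ‖u₀‖ ^ 2 + ‖v₀‖ ^ 2))) :
    KGB.BlowsUpInFiniteTime c r s u₀ u₁ v₀ v₁ := by
  open KGB in
  obtain ⟨σ, hsσ, hσr, hσ, hG, hQ⟩ := exists_regularity hr hsr hv₀ hv₁ hv₀x
  obtain ⟨y₀, Y₀, hd⟩ := exists_isRegularData hr hrs hsσ hσ hu₀ hu₁ hw₁ hG hQ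
  refine blowsUpInFiniteTime_of_not_global hr hrs hsσ hσr hσ hd fun y hy0 hy => ?_
  have hr0 : 0 ≤ r := by linarith
  have hrσ := hrs.trans hsσ
  subst hy0
  obtain ⟨Y, hY0, hY⟩ := hy.exists_isRegularProfile hrσ hσr timeInterval_Ici hd.profile
  obtain ⟨w, wt, hw, hwt, hflow⟩ := hy.exists_isEnergyFlow hham hr hrσ hσr hσ timeInterval_Ici hY
    (w₀ := w₀) (w₁ := w₁) (by rwa [← hd.data.u]) (by rwa [← hd.data.ut])
  have ev : bes r (vAt y 0) = v₀ := by rw [vAt_zero, hd.data.v]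
  have evt : vtOf σ Y 0 = v₁ := hd.vtOf_eq hrσ hσ hY0
  have ep : ‖pOf σ Y 0‖ ^ 2 = ‖v₀‖ ^ 2 + ‖v₀x‖ ^ 2 :=
    hv₀x.norm_sq_eq (by rw [← ev, hY.bes_vAt_eq_pOf hr0 hrσ hσ self_mem_Ici])
  refine hflow.false_of_global (E := energy c u₀ u₁ w₁ v₀ v₀x v₁) ?_ ?_
  · rw [cubic_eq_integral hham hr, ev, evt, ep, hwt, ← hd.data.u, ← hd.data.ut, energy]
    ring
  · rw [ev, evt, hw, hwt, ← hd.data.u, ← hd.data.ut]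
    exact hE
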